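/- Let $\mathfrak l\xrightarrow{\beta}\mathfrak h\xrightarrow{\alpha}\mathfrak g$ be a nice differential 2-crossed module of finite-dimensional real Lie algebras, with actions $\vartriangleright$ of $\mathfrak g$ by derivations and Peiffer lifting $\{\,,\}:\mathfrak h\times\mathfrak h\to\mathfrak l$; nice means $\alpha(Y)\vartriangleright Y'=[Y,Y']$ for $Y,Y'\in\mathfrak h$. Let $\langle\,,\rangle$ denote $\mathfrak g$-invariant non-degenerate symmetric bilinear forms on $\mathfrak g,\mathfrak h,\mathfrak l$. Define maps $\sigma,\kappa,\eta_1,\eta_2,\alpha^*,\beta^*$ by $$\langle\sigma(Y,Y'),X\rangle=-\langle Y,X\vartriangleright Y'\rangle,\quad \langle\kappa(Z,Z'),X\rangle=-\langle Z,X\vartriangleright Z'\rangle,$$ $$\langle\{Y,Y'\},Z\rangle=-\langle Y',\eta_1(Z,Y)\rangle=-\langle Y,\eta_2(Z,Y')\rangle,$$ $$\langle Y,\alpha^*(X)\rangle=\langle\alpha(Y),X\rangle,\quad \langle Z,\beta^*(Y)\rangle=\langle\beta(Z),Y\rangle,$$ and let $\overline\sigma,\overline\kappa,\overline\eta_i$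 be their extensions to Lie algebra valued forms, $\overline\sigma(\theta\otimes Y,\theta'\otimes Y')=\theta\wedge\theta'\otimes\sigma(Y,Y')$ etc. Let $M$ be an oriented smooth manifold without boundary (Hausdorff, $\sigma$-compact) of dimension $d\ge 4$ with a smooth metric tensor of signature $(\sigma,+1,\dots,+1)$, $\sigma=\pm1$ (the number $\sigma$ is not to be confused with the map $\sigma$), let $*$ be its Hodge star, and let $e\neq0$ be real. All fields are smooth: $A\in\Lambda^1(M,\mathfrak g)$, $B\in\Lambda^2(M,\mathfrak h)$, $C\in\Lambda^3(M,\mathfrak l)$ and $\overline B\in\Lambda^{d-2}(M,\mathfrak g)$, $\overline C\in\Lambda^{d-3}(M,\mathfrak h)$, $\overline D\in\Lambda^{d-4}(M,\mathfrak l)$. Put $$\mathcal F=dA+A\wedge A-\alpha(B),\quad \mathcal G=dB+A\wedge^{\vartriangleright}B-\beta(C),\quad \mathcal H=dC+A\wedge^{\vartriangleright}C+B\wedge^{\{,\}}B,$$ where $A\wedge A=\tfrac12A\wedge^{[,]}A$, and $$S_{3BF}=\int_M\langle\overline B,\mathcal F\rangle+\langle\overline C,\mathcal G\rangle+\langle\overline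 D,\mathcal H\rangle,$$ $$S_{3BFYM}=\int_M\langle\overline B,\mathcal F\rangle+e^2\langle\overline B,*\overline B\rangle+\langle\overline C,\mathcal G\rangle+e^2\langle\overline C,*\overline C\rangle+\langle\overline D,\mathcal H\rangle+e^2\langle\overline D,*\overline D\rangle,$$ $$S_{3YM}=-\frac{\sigma}{4e^2}\int_M\langle\mathcal F,*\mathcal F\rangle+\langle\mathcal G,*\mathcal G\rangle+\langle\mathcal H,*\mathcal H\rangle .$$ A field configuration is critical if the first variation of the action vanishes for all smooth compactly supported variations of the fields (on non-compact $M$ one integrates the difference of the varied and the original Lagrangian). Then: 1. $(A,B,C,\overline B,\overline C,\overline D)$ is critical for $S_{3BFYM}$ if and only if $$\mathcal F+2e^2*\overline B=0,\qquad \mathcal G+2e^2*\overline C=0,\qquad \mathcal H+2e^2*\overline D=0,$$ $$d\overline B+A\wedge^{[,]}\overline B=(-1)^{d+1}\overline\sigma(\overline C,B)+(-1)^d\overline\kappa(\overline D,C),$$ $$d\overline C+A\wedge^{\vartriangleright}\overline C=(-1)^d\alpha^*(\overline B)+(-1)^d\big(\overline\eta_2(\overline D,B)+\overline\eta_1(\overline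 D,B)\big),$$ $$d\overline D+A\wedge^{\vartriangleright}\overline D=(-1)^{d+1}\beta^*(\overline C).$$ 2. The first three of these equations are equivalent to $$\overline B=-\frac{\sigma}{2e^2}*\mathcal F,\qquad \overline C=(-1)^d\frac{\sigma}{2e^2}*\mathcal G,\qquad \overline D=-\frac{\sigma}{2e^2}*\mathcal H. \tag{$\dagger$}$$ 3. For multipliers given by $(\dagger)$, which are smooth, the last three equations are equivalent to the 3-form Yang–Mills equations $$d*\mathcal F+A\wedge^{[,]}*\mathcal F=\overline\sigma(*\mathcal G,B)+(-1)^d\overline\kappa(*\mathcal H,C),$$ $$d*\mathcal G+A\wedge^{\vartriangleright}*\mathcal G=-\overline\eta_2(*\mathcal H,B)-\overline\eta_1(*\mathcal H,B)-\alpha^*(*\mathcal F),$$ $$d*\mathcal H+A\wedge^{\vartriangleright}*\mathcal H=\beta^*(*\mathcal G),$$ and the 3BFYM Lagrangian and action become the 3YM Lagrangian and action. 4. The 3-form Yang–Mills equations hold if and only if $(A,B,C)$ is critical for $S_{3YM}$. 5. The two theories are classically equivalent: $(A,B,C,\overline B,\overline C,\overline D)\mapsto(A,B,C)$ is a bijection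 from the critical configurations of $S_{3BFYM}$ to those of $S_{3YM}$, with inverse given by $(\dagger)$. 6. For multipliers of compact support, $S_{3BFYM}\to S_{3BF}$ as $e\to0$. -/

import Mathlib

open scoped Manifold ContDiff

noncomputable section

/-! ### Finite dimensional real Lie algebras and differential 2-crossed modules -/

/-- A real Lie algebra whose underlying vector space also carries a norm.  No compatibility between
norm and bracket is asked for: the norm only serves to speak of derivatives of vector valued maps,
and all norms on a finite dimensional space give the same notions. -/
class NormedRealLieAlgebra (L : Type*) extends
  NormedAddCommGroup L, LieRing L, NormedSpace ℝ L, LieAlgebra ℝ L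

section Algebra

variable (𝔤 𝔥 𝔩 : Type*) [NormedRealLieAlgebra 𝔤] [NormedRealLieAlgebra 𝔥]
  [NormedRealLieAlgebra 𝔩]

/-- A differential 2-crossed module `𝔩 → 𝔥 → 𝔤`: a complex of Lie algebras with actions of `𝔤` by
derivations on `𝔥` and `𝔩` and a `𝔤`-equivariant bilinear Peiffer lifting. -/
structure DifferentialTwoCrossedModule where
  /-- The Lie algebra map `β : 𝔩 → 𝔥`. -/
  β : 𝔩 →ₗ⁅ℝ⁆ 𝔥
  /-- The Lie algebra map `α : 𝔥 → 𝔤`. -/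
  α : 𝔥 →ₗ⁅ℝ⁆ 𝔤
  /-- The left action of `𝔤` on `𝔥` by derivations. -/
  actH : 𝔤 →ₗ⁅ℝ⁆ LieDerivation ℝ 𝔥 𝔥
  /-- The left action of `𝔤` on `𝔩` by derivations. -/
  actL : 𝔤 →ₗ⁅ℝ⁆ LieDerivation ℝ 𝔩 𝔩
  /-- The Peiffer lifting `{ , } : 𝔥 × 𝔥 → 𝔩`. -/
  lift : 𝔥 →ₗ[ℝ] 𝔥 →ₗ[ℝ] 𝔩
  lift_equivariant : ∀ X Y₁ Y₂, actL X (lift Y₁ Y₂) = lift (actH X Y₁) Y₂ + lift Y₁ (actH X Y₂)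
  α_equivariant : ∀ X Y, α (actH X Y) = ⁅X, α Y⁆
  β_equivariant : ∀ X Z, β (actL X Z) = actH X (β Z)
  α_comp_β : ∀ Z, α (β Z) = 0
  β_lift : ∀ Y₁ Y₂, β (lift Y₁ Y₂) = ⁅Y₁, Y₂⁆ - actH (α Y₁) Y₂
  lift_β_β : ∀ Z₁ Z₂, ⁅Z₁, Z₂⁆ = lift (β Z₁) (β Z₂)
  lift_lie_left : ∀ Y₁ Y₂ Y₃, lift ⁅Y₁, Y₂⁆ Y₃ =
    actL (α Y₁) (lift Y₂ Y₃) + lift Y₁ ⁅Y₂, Y₃⁆ - actL (α Y₂) (lift Y₁ Y₃) - lift Y₂ ⁅Y₁, Y₃⁆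
  lift_lie_right : ∀ Y₁ Y₂ Y₃, lift Y₁ ⁅Y₂, Y₃⁆ =
    lift (β (lift Y₁ Y₂)) Y₃ - lift (β (lift Y₁ Y₃)) Y₂
  lift_β_add : ∀ Y Z, lift (β Z) Y + lift Y (β Z) = -(actL (α Y) Z)

variable {𝔤 𝔥 𝔩}

namespace DifferentialTwoCrossedModule

variable (D : DifferentialTwoCrossedModule 𝔤 𝔥 𝔩)

/-- The 2-crossed module is nice if `(𝔥, 𝔤; α, ▷)` is a differential crossed module, that is, if the
Peiffer commutator `⟦Y, Y'⟧ = [Y, Y'] - α(Y) ▷ Y'` vanishes. -/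
def IsNice : Prop := ∀ Y Y' : 𝔥, D.actH (D.α Y) Y' = ⁅Y, Y'⁆

/-- `(X, Y) ↦ X ▷ Y` as a bilinear map `𝔤 × 𝔥 → 𝔥`. -/
def actHₗ : 𝔤 →ₗ[ℝ] 𝔥 →ₗ[ℝ] 𝔥 :=
  LinearMap.mk₂ ℝ (fun X Y => D.actH X Y) (by simp) (by simp) (by simp) (by simp)

/-- `(X, Z) ↦ X ▷ Z` as a bilinear map `𝔤 × 𝔩 → 𝔩`. -/
def actLₗ : 𝔤 →ₗ[ℝ] 𝔩 →ₗ[ℝ] 𝔩 :=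
  LinearMap.mk₂ ℝ (fun X Z => D.actL X Z) (by simp) (by simp) (by simp) (by simp)

end DifferentialTwoCrossedModule

/-- The Lie bracket as a bilinear map. -/
def lieBracketₗ (L : Type*) [NormedRealLieAlgebra L] : L →ₗ[ℝ] L →ₗ[ℝ] L :=
  LinearMap.mk₂ ℝ (fun X Y : L => ⁅X, Y⁆) (by simp) (by simp) (by simp) (by simp)

/-- Invariant non-degenerate symmetric bilinear forms on `𝔤`, `𝔥` and `𝔩`.  Invariance is asked for
at the Lie algebra level; it follows from invariance under a Lie group integrating `𝔤`. -/
structure InvariantForms (D : DifferentialTwoCrossedModule 𝔤 𝔥 𝔩) where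
  /-- The form on `𝔤`. -/
  formG : LinearMap.BilinForm ℝ 𝔤
  /-- The form on `𝔥`. -/
  formH : LinearMap.BilinForm ℝ 𝔥
  /-- The form on `𝔩`. -/
  formL : LinearMap.BilinForm ℝ 𝔩
  nondegG : formG.Nondegenerate
  nondegH : formH.Nondegenerate
  nondegL : formL.Nondegenerate
  symmG : ∀ X X', formG X X' = formG X' X
  symmH : ∀ Y Y', formH Y Y' = formH Y' Y
  symmL : ∀ Z Z', formL Z Z' = formL Z' Z
  invG : ∀ X X' X'' : 𝔤, formG ⁅X, X'⁆ X'' = -formG X' ⁅X, X''⁆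
  invH : ∀ X Y Y', formH (D.actH X Y) Y' = -formH Y (D.actH X Y')
  invL : ∀ X Z Z', formL (D.actL X Z) Z' = -formL Z (D.actL X Z')

namespace InvariantForms

variable [FiniteDimensional ℝ 𝔤] [FiniteDimensional ℝ 𝔥] [FiniteDimensional ℝ 𝔩]
  {D : DifferentialTwoCrossedModule 𝔤 𝔥 𝔩} (Q : InvariantForms D)

/-- The element of `𝔤` representing a linear functional: `⟨Q.rieszG f, X⟩ = f X`. -/
def rieszG : Module.Dual ℝ 𝔤 →ₗ[ℝ] 𝔤 :=
  (LinearMap.BilinForm.toDual Q.formG Q.nondegG).symm.toLinearMap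

/-- The element of `𝔥` representing a linear functional: `⟨Q.rieszH f, Y⟩ = f Y`. -/
def rieszH : Module.Dual ℝ 𝔥 →ₗ[ℝ] 𝔥 :=
  (LinearMap.BilinForm.toDual Q.formH Q.nondegH).symm.toLinearMap

/-- The element of `𝔩` representing a linear functional: `⟨Q.rieszL f, Z⟩ = f Z`. -/
def rieszL : Module.Dual ℝ 𝔩 →ₗ[ℝ] 𝔩 :=
  (LinearMap.BilinForm.toDual Q.formL Q.nondegL).symm.toLinearMap

/-- `σ : 𝔥 × 𝔥 → 𝔤`, determined by `⟨σ(Y, Y'), X⟩ = -⟨Y, X ▷ Y'⟩`. -/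
def sigma : 𝔥 →ₗ[ℝ] 𝔥 →ₗ[ℝ] 𝔤 :=
  LinearMap.mk₂ ℝ (fun Y Y' => Q.rieszG (-(Q.formH Y ∘ₗ D.actHₗ.flip Y')))
    (by intros; rw [← map_add]; congr 1; ext; simp; ring)
    (by intros; rw [← map_smul]; congr 1; ext; simp)
    (by intros; rw [← map_add]; congr 1; ext; simp; ring)
    (by intros; rw [← map_smul]; congr 1; ext; simp)

/-- `κ : 𝔩 × 𝔩 → 𝔤`, determined by `⟨κ(Z, Z'), X⟩ = -⟨Z, X ▷ Z'⟩`. -/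
def kappa : 𝔩 →ₗ[ℝ] 𝔩 →ₗ[ℝ] 𝔤 :=
  LinearMap.mk₂ ℝ (fun Z Z' => Q.rieszG (-(Q.formL Z ∘ₗ D.actLₗ.flip Z')))
    (by intros; rw [← map_add]; congr 1; ext; simp; ring)
    (by intros; rw [← map_smul]; congr 1; ext; simp)
    (by intros; rw [← map_add]; congr 1; ext; simp; ring)
    (by intros; rw [← map_smul]; congr 1; ext; simp)

/-- `η₁ : 𝔩 × 𝔥 → 𝔥`, determined by `⟨{Y, Y'}, Z⟩ = -⟨Y', η₁(Z, Y)⟩`. -/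
def eta₁ : 𝔩 →ₗ[ℝ] 𝔥 →ₗ[ℝ] 𝔥 :=
  LinearMap.mk₂ ℝ (fun Z Y => Q.rieszH (-(Q.formL Z ∘ₗ D.lift Y)))
    (by intros; rw [← map_add]; congr 1; ext; simp; ring)
    (by intros; rw [← map_smul]; congr 1; ext; simp)
    (by intros; rw [← map_add]; congr 1; ext; simp; ring)
    (by intros; rw [← map_smul]; congr 1; ext; simp)

/-- `η₂ : 𝔩 × 𝔥 → 𝔥`, determined by `⟨{Y, Y'}, Z⟩ = -⟨Y, η₂(Z, Y')⟩`. -/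
def eta₂ : 𝔩 →ₗ[ℝ] 𝔥 →ₗ[ℝ] 𝔥 :=
  LinearMap.mk₂ ℝ (fun Z Y' => Q.rieszH (-(Q.formL Z ∘ₗ D.lift.flip Y')))
    (by intros; rw [← map_add]; congr 1; ext; simp; ring)
    (by intros; rw [← map_smul]; congr 1; ext; simp)
    (by intros; rw [← map_add]; congr 1; ext; simp; ring)
    (by intros; rw [← map_smul]; congr 1; ext; simp)

/-- `α* : 𝔤 → 𝔥`, determined by `⟨Y, α*(X)⟩ = ⟨α(Y), X⟩`. -/
def alphaStar : 𝔤 →ₗ[ℝ] 𝔥 := Q.rieszH ∘ₗ D.α.toLinearMap.dualMap ∘ₗ Q.formG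

/-- `β* : 𝔥 → 𝔩`, determined by `⟨Z, β*(Y)⟩ = ⟨β(Z), Y⟩`. -/
def betaStar : 𝔥 →ₗ[ℝ] 𝔩 := Q.rieszL ∘ₗ D.β.toLinearMap.dualMap ∘ₗ Q.formH

end InvariantForms

end Algebra

/-! ### Vector valued differential forms on a manifold -/

/-- The model space `ℝ^d`. -/
abbrev Model (d : ℕ) := EuclideanSpace ℝ (Fin d)

/-- A (not necessarily smooth) differential `k`-form on the `d`-manifold `M` with values in `V`. -/
abbrev DForm (d : ℕ) (M : Type*) [TopologicalSpace M] [ChartedSpace (Model d) M] (k : ℕ)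
    (V : Type*) [NormedAddCommGroup V] [NormedSpace ℝ V] :=
  (x : M) → TangentSpace (𝓡 d) x [⋀^Fin k]→L[ℝ] V

section Pointwise

theorem update_castAdd {p q r : ℕ} (h : p + q = r) [DecidableEq (Fin r)] {X : Type*} (v : Fin r → X)
    (k : Fin p) (x : X) :
    (fun i => Function.update v (Fin.cast h (Fin.castAdd q k)) x (Fin.cast h (Fin.castAdd q i))) =
        Function.update (fun i => v (Fin.cast h (Fin.castAdd q i))) k x ∧
      (fun j => Function.update v (Fin.cast h (Fin.castAdd q k)) x (Fin.cast h (Fin.natAdd p j))) =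
        fun j => v (Fin.cast h (Fin.natAdd p j)) := by
  constructor
  · ext i
    by_cases hi : i = k
    · simp [hi]
    · rw [Function.update_of_ne hi, Function.update_of_ne (by simp [Fin.ext_iff] at hi ⊢; omega)]
  · ext j
    rw [Function.update_of_ne (by simp [Fin.ext_iff]; omega)]

theorem update_natAdd {p q r : ℕ} (h : p + q = r) [DecidableEq (Fin r)] {X : Type*} (v : Fin r → X)
    (k : Fin q) (x : X) :
    (fun i => Function.update v (Fin.cast h (Fin.natAdd p k)) x (Fin.cast h (Fin.castAdd q i))) =
        (fun i => v (Fin.cast h (Fin.castAdd q i))) ∧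
      (fun j => Function.update v (Fin.cast h (Fin.natAdd p k)) x (Fin.cast h (Fin.natAdd p j))) =
        Function.update (fun j => v (Fin.cast h (Fin.natAdd p j))) k x := by
  constructor
  · ext i
    rw [Function.update_of_ne (by simp [Fin.ext_iff]; omega)]
  · ext j
    by_cases hj : j = k
    · simp [hj]
    · rw [Function.update_of_ne hj, Function.update_of_ne (by simp [Fin.ext_iff] at hj ⊢; omega)]

theorem exists_index {p q r : ℕ} (h : p + q = r) (k : Fin r) :
    (∃ i, k = Fin.cast h (Fin.castAdd q i)) ∨ ∃ j, k = Fin.cast h (Fin.natAdd p j) := by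
  subst h
  induction k using Fin.addCases with
  | left i => exact Or.inl ⟨i, rfl⟩
  | right j => exact Or.inr ⟨j, rfl⟩

variable {T V W U : Type*} [AddCommGroup T] [Module ℝ T] [TopologicalSpace T]
  [NormedAddCommGroup V] [NormedSpace ℝ V] [NormedAddCommGroup W] [NormedSpace ℝ W]
  [NormedAddCommGroup U] [NormedSpace ℝ U]

/-- The continuous multilinear map `v ↦ b (θ(v₁, …, v_p), η(v_{p+1}, …, v_{p+q}))`. -/
def prodMultilinear {p q r : ℕ} (h : p + q = r) (b : V →L[ℝ] W →L[ℝ] U)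
    (θ : T [⋀^Fin p]→L[ℝ] V) (η : T [⋀^Fin q]→L[ℝ] W) :
    ContinuousMultilinearMap ℝ (fun _ : Fin r => T) U where
  toFun v := b (θ fun i => v (Fin.cast h (Fin.castAdd q i)))
    (η fun j => v (Fin.cast h (Fin.natAdd p j)))
  map_update_add' := by
    intro _ v k x y
    rcases exists_index h k with ⟨i, rfl⟩ | ⟨j, rfl⟩
    · simp only [update_castAdd, ContinuousAlternatingMap.map_update_add, map_add,
        add_apply]
    · simp only [update_natAdd, ContinuousAlternatingMap.map_update_add, map_add]
  map_update_smul' := by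
    intro _ v k c x
    rcases exists_index h k with ⟨i, rfl⟩ | ⟨j, rfl⟩
    · simp only [update_castAdd, ContinuousAlternatingMap.map_update_smul, map_smul,
        smul_apply]
    · simp only [update_natAdd, ContinuousAlternatingMap.map_update_smul, map_smul]
  cont := by fun_prop

/-- The wedge product of two vector valued alternating forms along a bilinear map `b`:
`(θ ∧ᵇ η)(v) = 1/(p! q!) ∑_τ sign(τ) b(θ(v_{τ(1)}, …, v_{τ(p)}), η(v_{τ(p+1)}, …, v_{τ(p+q)}))`. -/
def wedgeAt {p q r : ℕ} (h : p + q = r) (b : V →L[ℝ] W →L[ℝ] U)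
    (θ : T [⋀^Fin p]→L[ℝ] V) (η : T [⋀^Fin q]→L[ℝ] W) : T [⋀^Fin r]→L[ℝ] U :=
  ((p.factorial : ℝ) * (q.factorial : ℝ))⁻¹ •
    ContinuousMultilinearMap.alternatization (prodMultilinear h b θ η)

/-- The form `dx^{J 1} ∧ ⋯ ∧ dx^{J s}` on `ℝ^d`. -/
def coordWedge {d s : ℕ} (J : Fin s → Fin d) : Model d [⋀^Fin s]→L[ℝ] ℝ :=
  ContinuousMultilinearMap.alternatization
    ((ContinuousMultilinearMap.mkPiAlgebra ℝ (Fin s) ℝ).compContinuousLinearMap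
      fun a => (EuclideanSpace.proj (J a) : Model d →L[ℝ] ℝ))

/-- The Levi-Civita symbol: the sign of `f` if `f` is a permutation, and `0` otherwise. -/
def leviCivita {d : ℕ} (f : Fin d → Fin d) : ℝ :=
  (Matrix.of fun a b => if f a = b then (1 : ℝ) else 0).det

/-- The Hodge star on `r`-forms on `ℝ^d` (standard orientation) for the scalar product with Gram
matrix `G`:
`*θ = √|det G| / (r! s!) ∑ θ^{i₁ … i_r} ε_{i₁ … i_r j₁ … j_s} dx^{j₁} ∧ ⋯ ∧ dx^{j_s}`,
where the indices of `θ` are raised with the inverse of `G`. -/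
def hodgeCoord {d r s : ℕ} (h : r + s = d) (G : Matrix (Fin d) (Fin d) ℝ)
    (θ : Model d [⋀^Fin r]→L[ℝ] V) : Model d [⋀^Fin s]→L[ℝ] V :=
  (Real.sqrt |G.det| / ((r.factorial : ℝ) * (s.factorial : ℝ))) •
    ∑ i : Fin r → Fin d, ∑ i' : Fin r → Fin d, ∑ j : Fin s → Fin d,
      ((∏ a, G⁻¹ (i a) (i' a)) * leviCivita fun a => Fin.append i j (Fin.cast h.symm a)) •
        (ContinuousLinearMap.toSpanSingleton ℝ
          (θ fun a => EuclideanSpace.single (i' a) 1)).compContinuousAlternatingMap (coordWedge j)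

end Pointwise

section Manifold

variable {d : ℕ} {M : Type*} [TopologicalSpace M] [ChartedSpace (Model d) M]
  {V W U : Type*} [NormedAddCommGroup V] [NormedSpace ℝ V] [NormedAddCommGroup W]
  [NormedSpace ℝ W] [NormedAddCommGroup U] [NormedSpace ℝ U]

/-- The differential at `y` of the inverse of the chart around `x₀`; it sends the standard basis to
the coordinate frame `∂_1, …, ∂_d`. -/
def chartFrame (x₀ : M) (y : Model d) :
    Model d →L[ℝ] TangentSpace (𝓡 d) ((extChartAt (𝓡 d) x₀).symm y) :=
  mfderiv 𝓘(ℝ, Model d) (𝓡 d) (extChartAt (𝓡 d) x₀).symm y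

/-- The differential at `x` of the chart around `x`. -/
def chartDiff (x : M) : TangentSpace (𝓡 d) x →L[ℝ] Model d :=
  mfderiv (𝓡 d) 𝓘(ℝ, Model d) (extChartAt (𝓡 d) x) x

namespace DForm

variable {k : ℕ}

/-- The coordinate expression of a form in the chart around `x₀`: its pullback to `ℝ^d`. -/
def inChart (θ : DForm d M k V) (x₀ : M) (y : Model d) : Model d [⋀^Fin k]→L[ℝ] V :=
  (θ ((extChartAt (𝓡 d) x₀).symm y)).compContinuousLinearMap (chartFrame x₀ y)

/-- A form is smooth if all its coordinate expressions are. -/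
def IsSmooth (θ : DForm d M k V) : Prop :=
  ∀ x₀ : M, ContDiffOn ℝ ∞ (θ.inChart x₀) (extChartAt (𝓡 d) x₀).target

/-- A form has compact support if it vanishes outside a compact set. -/
def IsCompactlySupported (θ : DForm d M k V) : Prop :=
  ∃ K : Set M, IsCompact K ∧ ∀ x ∉ K, θ x = 0

/-- The exterior derivative, computed at `x` in the chart around `x`. -/
def extd (θ : DForm d M k V) : DForm d M (k + 1) V := fun x =>
  (extDeriv (θ.inChart x) (extChartAt (𝓡 d) x x)).compContinuousLinearMap (chartDiff x)

/-- The wedge product of vector valued forms along a bilinear map `b`. -/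
def wedge [FiniteDimensional ℝ V] [FiniteDimensional ℝ W] {p q r : ℕ} (b : V →ₗ[ℝ] W →ₗ[ℝ] U)
    (θ : DForm d M p V) (η : DForm d M q W) (h : p + q = r := by omega) : DForm d M r U :=
  fun x => wedgeAt h b.toContinuousBilinearMap (θ x) (η x)

/-- The image of a `V`-valued form under a linear map `V → W`. -/
def map [FiniteDimensional ℝ V] (f : V →ₗ[ℝ] W) (θ : DForm d M k V) : DForm d M k W :=
  fun x => (LinearMap.toContinuousLinearMap f).compContinuousAlternatingMap (θ x)

end DForm

/-- The Gram matrix `g_{ij}` of a field of bilinear forms in the chart around `x₀`. -/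
def gramInChart (g : (x : M) → LinearMap.BilinForm ℝ (TangentSpace (𝓡 d) x)) (x₀ : M)
    (y : Model d) : Matrix (Fin d) (Fin d) ℝ :=
  Matrix.of fun i j => g ((extChartAt (𝓡 d) x₀).symm y)
    (chartFrame x₀ y (EuclideanSpace.single i 1)) (chartFrame x₀ y (EuclideanSpace.single j 1))

variable (d M) in
/-- A smooth metric tensor of signature `(σ, +1, …, +1)` on the `d`-manifold `M`. -/
structure MetricTensor (σ : ℝ) where
  /-- The bilinear form on each tangent space. -/
  val : (x : M) → LinearMap.BilinForm ℝ (TangentSpace (𝓡 d) x)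
  smooth : ∀ (x₀ : M) (i j : Fin d),
    ContDiffOn ℝ ∞ (fun y => gramInChart val x₀ y i j) (extChartAt (𝓡 d) x₀).target
  signature : ∀ x, ∃ b : Module.Basis (Fin d) ℝ (TangentSpace (𝓡 d) x), ∀ i j,
    val x (b i) (b j) = if i = j then (if i.val = 0 then σ else 1) else 0

variable (d M) in
/-- The atlas of `M` is oriented: all transition maps have positive Jacobian determinant. -/
def IsOrientedAtlas : Prop :=
  ∀ e ∈ atlas (Model d) M, ∀ e' ∈ atlas (Model d) M, ∀ y ∈ (e.symm.trans e').source,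
    0 < (fderiv ℝ (e.symm.trans e') y).det

/-- The Hodge star of a vector valued form, for the orientation given by the charts. -/
def DForm.hodge {σ : ℝ} (g : MetricTensor d M σ) {r s : ℕ} (θ : DForm d M r V)
    (h : r + s = d := by omega) : DForm d M s V := fun x =>
  (hodgeCoord h (gramInChart g.val x (extChartAt (𝓡 d) x x))
    (θ.inChart x (extChartAt (𝓡 d) x x))).compContinuousLinearMap (chartDiff x)

section Integral

variable [IsManifold (𝓡 d) ∞ M] [T2Space M] [SigmaCompactSpace M]

variable (d M) in
/-- A partition of unity subordinate to the charts. -/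
def chartPartition : SmoothPartitionOfUnity M (𝓡 d) M Set.univ :=
  (SmoothPartitionOfUnity.exists_isSubordinate_chartAt_source (𝓡 d) M).choose

/-- The integral of a `d`-form over the oriented manifold `M`: with `ρ` a partition of unity
subordinate to the charts, `∫_M θ = ∑_{x₀} ∫ ρ_{x₀} θ_{1 … d} dy¹ ⋯ dy^d`, the summand being
computed in the chart around `x₀`. -/
def DForm.integral (θ : DForm d M d ℝ) : ℝ :=
  ∑' x₀ : M, ∫ y in (extChartAt (𝓡 d) x₀).target,
    chartPartition d M x₀ ((extChartAt (𝓡 d) x₀).symm y) *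
      θ.inChart x₀ y fun i => EuclideanSpace.single i 1

end Integral

end Manifold

/-! ### 3-gauge fields, the 3BF, 3BFYM and 3YM actions -/

section Fields

variable (n : ℕ) (M : Type*) [TopologicalSpace M] [ChartedSpace (Model (n + 4)) M]
  (𝔤 𝔥 𝔩 : Type*) [NormedRealLieAlgebra 𝔤] [NormedRealLieAlgebra 𝔥] [NormedRealLieAlgebra 𝔩]

/-- A 3-gauge field `(A, B, C)` (smoothness is the predicate `IsSmooth` below) on a manifold of
dimension `d = n + 4`. -/
structure GaugeField where
  /-- The `𝔤`-valued 1-form. -/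
  A : DForm (n + 4) M 1 𝔤
  /-- The `𝔥`-valued 2-form. -/
  B : DForm (n + 4) M 2 𝔥
  /-- The `𝔩`-valued 3-form. -/
  C : DForm (n + 4) M 3 𝔩

/-- The Lagrange multipliers `(B̄, C̄, D̄)`, of degrees `d - 2`, `d - 3`, `d - 4`. -/
structure Multipliers where
  /-- The `𝔤`-valued `(d-2)`-form. -/
  Bb : DForm (n + 4) M (n + 2) 𝔤
  /-- The `𝔥`-valued `(d-3)`-form. -/
  Cb : DForm (n + 4) M (n + 1) 𝔥
  /-- The `𝔩`-valued `(d-4)`-form. -/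
  Db : DForm (n + 4) M n 𝔩

variable {n M 𝔤 𝔥 𝔩}

namespace GaugeField

/-- All components are smooth. -/
def IsSmooth (φ : GaugeField n M 𝔤 𝔥 𝔩) : Prop := φ.A.IsSmooth ∧ φ.B.IsSmooth ∧ φ.C.IsSmooth

/-- All components have compact support. -/
def IsCompactlySupported (φ : GaugeField n M 𝔤 𝔥 𝔩) : Prop :=
  φ.A.IsCompactlySupported ∧ φ.B.IsCompactlySupported ∧ φ.C.IsCompactlySupported

/-- The varied field `φ + t δφ`. -/
def vary (φ δφ : GaugeField n M 𝔤 𝔥 𝔩) (t : ℝ) : GaugeField n M 𝔤 𝔥 𝔩 :=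
  ⟨φ.A + t • δφ.A, φ.B + t • δφ.B, φ.C + t • δφ.C⟩

end GaugeField

namespace Multipliers

/-- All components are smooth. -/
def IsSmooth (m : Multipliers n M 𝔤 𝔥 𝔩) : Prop := m.Bb.IsSmooth ∧ m.Cb.IsSmooth ∧ m.Db.IsSmooth

/-- All components have compact support. -/
def IsCompactlySupported (m : Multipliers n M 𝔤 𝔥 𝔩) : Prop :=
  m.Bb.IsCompactlySupported ∧ m.Cb.IsCompactlySupported ∧ m.Db.IsCompactlySupported

/-- The varied multipliers `m + t δm`. -/
def vary (m δm : Multipliers n M 𝔤 𝔥 𝔩) (t : ℝ) : Multipliers n M 𝔤 𝔥 𝔩 :=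
  ⟨m.Bb + t • δm.Bb, m.Cb + t • δm.Cb, m.Db + t • δm.Db⟩

end Multipliers

variable [FiniteDimensional ℝ 𝔤] [FiniteDimensional ℝ 𝔥] [FiniteDimensional ℝ 𝔩]
  (D : DifferentialTwoCrossedModule 𝔤 𝔥 𝔩)

namespace GaugeField

variable (φ : GaugeField n M 𝔤 𝔥 𝔩)

/-- The fake curvature `𝓕 = dA + A ∧ A - α(B)`; for a `𝔤`-valued 1-form `A ∧ A` is one half of
`A ∧^{[,]} A`. -/
def curvF : DForm (n + 4) M 2 𝔤 :=
  φ.A.extd + (1 / 2 : ℝ) • DForm.wedge (lieBracketₗ 𝔤) φ.A φ.A - φ.B.map D.α.toLinearMap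

/-- The fake 2-curvature `𝓖 = dB + A ∧^▷ B - β(C)`. -/
def curvG : DForm (n + 4) M 3 𝔥 :=
  φ.B.extd + DForm.wedge D.actHₗ φ.A φ.B - φ.C.map D.β.toLinearMap

/-- The 3-curvature `𝓗 = dC + A ∧^▷ C + B ∧^{{,}} B`. -/
def curvH : DForm (n + 4) M 4 𝔩 :=
  φ.C.extd + DForm.wedge D.actLₗ φ.A φ.C + DForm.wedge D.lift φ.B φ.B

end GaugeField

variable {D} (Q : InvariantForms D) {σ : ℝ} (g : MetricTensor (n + 4) M σ)

/-- The 3BF Lagrangian `⟨B̄, 𝓕⟩ + ⟨C̄, 𝓖⟩ + ⟨D̄, 𝓗⟩`. -/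
def lagrangian3BF (φ : GaugeField n M 𝔤 𝔥 𝔩) (m : Multipliers n M 𝔤 𝔥 𝔩) :
    DForm (n + 4) M (n + 4) ℝ :=
  DForm.wedge Q.formG m.Bb (φ.curvF D) + DForm.wedge Q.formH m.Cb (φ.curvG D) +
    DForm.wedge Q.formL m.Db (φ.curvH D)

/-- The 3BFYM Lagrangian
`⟨B̄, 𝓕⟩ + e²⟨B̄, *B̄⟩ + ⟨C̄, 𝓖⟩ + e²⟨C̄, *C̄⟩ + ⟨D̄, 𝓗⟩ + e²⟨D̄, *D̄⟩`. -/
def lagrangian3BFYM (e : ℝ) (φ : GaugeField n M 𝔤 𝔥 𝔩) (m : Multipliers n M 𝔤 𝔥 𝔩) :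
    DForm (n + 4) M (n + 4) ℝ :=
  DForm.wedge Q.formG m.Bb (φ.curvF D) +
    e ^ 2 • DForm.wedge Q.formG m.Bb (m.Bb.hodge g : DForm (n + 4) M 2 𝔤) +
  DForm.wedge Q.formH m.Cb (φ.curvG D) +
    e ^ 2 • DForm.wedge Q.formH m.Cb (m.Cb.hodge g : DForm (n + 4) M 3 𝔥) +
  DForm.wedge Q.formL m.Db (φ.curvH D) +
    e ^ 2 • DForm.wedge Q.formL m.Db (m.Db.hodge g : DForm (n + 4) M 4 𝔩)

/-- The 3YM Lagrangian `-(σ/4e²) (⟨𝓕, *𝓕⟩ + ⟨𝓖, *𝓖⟩ + ⟨𝓗, *𝓗⟩)`. -/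
def lagrangian3YM (e : ℝ) (φ : GaugeField n M 𝔤 𝔥 𝔩) : DForm (n + 4) M (n + 4) ℝ :=
  (-(σ / (4 * e ^ 2))) •
    (DForm.wedge Q.formG (φ.curvF D) ((φ.curvF D).hodge g : DForm (n + 4) M (n + 2) 𝔤) +
      DForm.wedge Q.formH (φ.curvG D) ((φ.curvG D).hodge g : DForm (n + 4) M (n + 1) 𝔥) +
      DForm.wedge Q.formL (φ.curvH D) ((φ.curvH D).hodge g : DForm (n + 4) M n 𝔩))

/-- The values of the multipliers determined by the gauge field:
`B̄ = -(σ/2e²) *𝓕`, `C̄ = (-1)^d (σ/2e²) *𝓖`, `D̄ = -(σ/2e²) *𝓗`. -/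
def solvedMultipliers (D : DifferentialTwoCrossedModule 𝔤 𝔥 𝔩) (e : ℝ)
    (φ : GaugeField n M 𝔤 𝔥 𝔩) : Multipliers n M 𝔤 𝔥 𝔩 where
  Bb := (-(σ / (2 * e ^ 2))) • (φ.curvF D).hodge g
  Cb := ((-1) ^ (n + 4) * (σ / (2 * e ^ 2))) • (φ.curvG D).hodge g
  Db := (-(σ / (2 * e ^ 2))) • (φ.curvH D).hodge g

/-- The equations of motion of the multipliers:
`𝓕 + 2e² *B̄ = 0`, `𝓖 + 2e² *C̄ = 0`, `𝓗 + 2e² *D̄ = 0`. -/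
def MultiplierEquations (D : DifferentialTwoCrossedModule 𝔤 𝔥 𝔩) (e : ℝ)
    (φ : GaugeField n M 𝔤 𝔥 𝔩) (m : Multipliers n M 𝔤 𝔥 𝔩) : Prop :=
  φ.curvF D + (2 * e ^ 2) • m.Bb.hodge g = 0 ∧
  φ.curvG D + (2 * e ^ 2) • m.Cb.hodge g = 0 ∧
  φ.curvH D + (2 * e ^ 2) • m.Db.hodge g = 0

/-- The equations of motion of the gauge field in the 3BFYM theory:
`dB̄ + A ∧^{[,]} B̄ = (-1)^{d+1} σ̄(C̄, B) + (-1)^d κ̄(D̄, C)`,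
`dC̄ + A ∧^▷ C̄ = (-1)^d α*(B̄) + (-1)^d (η̄₂(D̄, B) + η̄₁(D̄, B))`,
`dD̄ + A ∧^▷ D̄ = (-1)^{d+1} β*(C̄)`. -/
def GaugeEquations3BFYM (φ : GaugeField n M 𝔤 𝔥 𝔩) (m : Multipliers n M 𝔤 𝔥 𝔩) : Prop :=
  (m.Bb.extd + DForm.wedge (lieBracketₗ 𝔤) φ.A m.Bb : DForm (n + 4) M (n + 3) 𝔤) =
    (-1 : ℝ) ^ (n + 4 + 1) • DForm.wedge Q.sigma m.Cb φ.B +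
      (-1 : ℝ) ^ (n + 4) • DForm.wedge Q.kappa m.Db φ.C ∧
  (m.Cb.extd + DForm.wedge D.actHₗ φ.A m.Cb : DForm (n + 4) M (n + 2) 𝔥) =
    (-1 : ℝ) ^ (n + 4) • m.Bb.map Q.alphaStar +
      (-1 : ℝ) ^ (n + 4) • (DForm.wedge Q.eta₂ m.Db φ.B + DForm.wedge Q.eta₁ m.Db φ.B) ∧
  (m.Db.extd + DForm.wedge D.actLₗ φ.A m.Db : DForm (n + 4) M (n + 1) 𝔩) =
    (-1 : ℝ) ^ (n + 4 + 1) • m.Cb.map Q.betaStar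

/-- The 3-form Yang-Mills equations:
`d*𝓕 + A ∧^{[,]} *𝓕 = σ̄(*𝓖, B) + (-1)^d κ̄(*𝓗, C)`,
`d*𝓖 + A ∧^▷ *𝓖 = -η̄₂(*𝓗, B) - η̄₁(*𝓗, B) - α*(*𝓕)`,
`d*𝓗 + A ∧^▷ *𝓗 = β*(*𝓖)`. -/
def Equations3YM (φ : GaugeField n M 𝔤 𝔥 𝔩) : Prop :=
  let sF : DForm (n + 4) M (n + 2) 𝔤 := (φ.curvF D).hodge g
  let sG : DForm (n + 4) M (n + 1) 𝔥 := (φ.curvG D).hodge g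
  let sH : DForm (n + 4) M n 𝔩 := (φ.curvH D).hodge g
  (sF.extd + DForm.wedge (lieBracketₗ 𝔤) φ.A sF : DForm (n + 4) M (n + 3) 𝔤) =
    DForm.wedge Q.sigma sG φ.B + (-1 : ℝ) ^ (n + 4) • DForm.wedge Q.kappa sH φ.C ∧
  (sG.extd + DForm.wedge D.actHₗ φ.A sG : DForm (n + 4) M (n + 2) 𝔥) =
    -DForm.wedge Q.eta₂ sH φ.B - DForm.wedge Q.eta₁ sH φ.B - sF.map Q.alphaStar ∧
  (sH.extd + DForm.wedge D.actLₗ φ.A sH : DForm (n + 4) M (n + 1) 𝔩) = sG.map Q.betaStar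

variable [IsManifold (𝓡 (n + 4)) ∞ M] [T2Space M] [SigmaCompactSpace M]

/-- The 3BF action. -/
def action3BF (φ : GaugeField n M 𝔤 𝔥 𝔩) (m : Multipliers n M 𝔤 𝔥 𝔩) : ℝ :=
  (lagrangian3BF Q φ m).integral

/-- The 3BFYM action. -/
def action3BFYM (e : ℝ) (φ : GaugeField n M 𝔤 𝔥 𝔩) (m : Multipliers n M 𝔤 𝔥 𝔩) : ℝ :=
  (lagrangian3BFYM Q g e φ m).integral

/-- The 3YM action. -/
def action3YM (e : ℝ) (φ : GaugeField n M 𝔤 𝔥 𝔩) : ℝ :=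
  (lagrangian3YM Q g e φ).integral

/-- `(φ, m)` is a critical point of the 3BFYM action: the first variation vanishes for all smooth
compactly supported variations of all fields.  Since `M` need not be compact, the variation is
computed from the integral of the difference of the Lagrangians, which has compact support. -/
def IsCritical3BFYM (e : ℝ) (φ : GaugeField n M 𝔤 𝔥 𝔩) (m : Multipliers n M 𝔤 𝔥 𝔩) : Prop :=
  ∀ (δφ : GaugeField n M 𝔤 𝔥 𝔩) (δm : Multipliers n M 𝔤 𝔥 𝔩),
    δφ.IsSmooth → δφ.IsCompactlySupported → δm.IsSmooth → δm.IsCompactlySupported →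
    HasDerivAt (fun t : ℝ => (lagrangian3BFYM Q g e (φ.vary δφ t) (m.vary δm t) -
      lagrangian3BFYM Q g e φ m : DForm (n + 4) M (n + 4) ℝ).integral) 0 0

/-- `φ` is a critical point of the 3YM action, in the same sense. -/
def IsCritical3YM (e : ℝ) (φ : GaugeField n M 𝔤 𝔥 𝔩) : Prop :=
  ∀ δφ : GaugeField n M 𝔤 𝔥 𝔩, δφ.IsSmooth → δφ.IsCompactlySupported →
    HasDerivAt (fun t : ℝ => (lagrangian3YM Q g e (φ.vary δφ t) -
      lagrangian3YM Q g e φ : DForm (n + 4) M (n + 4) ℝ).integral) 0 0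

/-- The space of (smooth) solutions of the 3BFYM theory. -/
def solutions3BFYM (e : ℝ) : Set (GaugeField n M 𝔤 𝔥 𝔩 × Multipliers n M 𝔤 𝔥 𝔩) :=
  {p | p.1.IsSmooth ∧ p.2.IsSmooth ∧ IsCritical3BFYM Q g e p.1 p.2}

/-- The space of (smooth) solutions of the 3YM theory. -/
def solutions3YM (e : ℝ) : Set (GaugeField n M 𝔤 𝔥 𝔩) :=
  {φ | φ.IsSmooth ∧ IsCritical3YM Q g e φ}

end Fields

end

set_option linter.unusedSectionVars false

/-! Along a variation with parameter t each curvature is exactly quadratic in t and each multiplier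
is affine. Every Lagrangian is thus a polynomial in t of degree at most four, and its non-constant
coefficients are smooth with compact support. The first variation is therefore the integral of the
linear coefficient (`FirstVariation.hasDerivAt`), and no differentiation under the integral sign is
needed.

For variations of the multipliers, symmetry of `⟨θ, *η⟩` in `θ` and `η` (`wedge_hodge_symm`) makes
the quadratic term contribute twice `⟨δθ, *θ⟩`, and the fundamental lemma
(`eq_zero_of_integral_wedge_eq_zero`) gives the first three equations. For variations of the gauge
field, invariance of the bilinear forms permits covariant integration by parts, while `σ`, `κ`,
`η₁`, `η₂`, `α*`, `β*` transpose the algebraic operations. In `gaugeVariation_eq` this turns the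
linear coefficient into an exact form plus the pairing of `δA`, `δB`, `δC` with the residuals of the
other three equations. Stokes' theorem removes the exact form and the fundamental lemma concludes.

Since `**` is `(-1)^(pq) σ` on forms, the star is invertible and the first three equations can be
solved for the multipliers. The linear coefficient of the 3YM Lagrangian is exactly the gauge
variation of the 3BF terms taken at these solved multipliers (`firstVariation_lagrangian3YM`). Both
theories thus impose the same condition on `(A, B, C)`, which gives the bijection of critical
configurations.

The supporting calculus rests on two reductions. Identities for wedge products are checked on the
forms `dx^J ⊗ v` (`form_induction`, `wedgeAt_simpleForm`), where they become statements about
concatenated multi-indices. Identities for the Hodge star are checked in a positively oriented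
orthonormal frame (`hodgeCoord_pullback`, `HasSigns.exists_pos`). On the manifold, `d` and `*` are
defined at each point in the preferred chart there, and `inChart_extd` and `inChart_hodge` give the
same formulas in every chart. -/

noncomputable section

/-! ### Vector valued alternating forms on `ℝ^d` and their wedge product -/

section CoordinateForms

variable {d : ℕ} {V W U : Type*} [NormedAddCommGroup V] [NormedSpace ℝ V]
  [NormedAddCommGroup W] [NormedSpace ℝ W] [NormedAddCommGroup U] [NormedSpace ℝ U]

/-- The standard basis vectors of `ℝ^d`. -/
abbrev stdVec (i : Fin d) : Model d := EuclideanSpace.single i 1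

theorem stdVec_apply (i j : Fin d) : stdVec i j = if j = i then (1 : ℝ) else 0 := by
  simp

theorem coordWedge_apply {s : ℕ} (J : Fin s → Fin d) (v : Fin s → Model d) :
    coordWedge J v = (Matrix.of fun i a => v i (J a)).det := by
  rw [coordWedge, ContinuousMultilinearMap.alternatization_apply_apply, Matrix.det_apply]
  simp

theorem coordWedge_comp_perm {s : ℕ} (J : Fin s → Fin d) (ρ : Equiv.Perm (Fin s)) :
    coordWedge (J ∘ ρ) = ((Equiv.Perm.sign ρ : ℤ) : ℝ) • coordWedge J := by
  ext v
  rw [ContinuousAlternatingMap.smul_apply, coordWedge_apply, coordWedge_apply]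
  exact Matrix.det_permute' ρ (Matrix.of fun i a => v i (J a))

/-- The form `dx^{J 1} ∧ ⋯ ∧ dx^{J s} ⊗ v`. -/
def simpleForm {s : ℕ} (J : Fin s → Fin d) (v : V) : Model d [⋀^Fin s]→L[ℝ] V :=
  (ContinuousLinearMap.toSpanSingleton ℝ v).compContinuousAlternatingMap (coordWedge J)

@[simp] theorem simpleForm_apply {s : ℕ} (J : Fin s → Fin d) (v : V) (x : Fin s → Model d) :
    simpleForm J v x = coordWedge J x • v := rfl

theorem alternating_ext_stdVec {k : ℕ} {θ η : Model d [⋀^Fin k]→L[ℝ] V}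
    (h : ∀ J : Fin k → Fin d, θ (fun a => stdVec (J a)) = η (fun a => stdVec (J a))) : θ = η := by
  apply ContinuousAlternatingMap.toAlternatingMap_injective
  apply AlternatingMap.coe_multilinearMap_injective
  refine Module.Basis.ext_multilinear (fun _ => (EuclideanSpace.basisFun (Fin d) ℝ).toBasis) ?_
  intro J
  simpa using h J

/-- Summing over all multi-indices instead of the increasing ones counts every basis form `k!`
times, hence the factor `1/k!`. No ordering of indices has to be chosen. -/
theorem form_eq_sum {k : ℕ} (θ : Model d [⋀^Fin k]→L[ℝ] V) :
    θ = ∑ J : Fin k → Fin d, simpleForm J ((k.factorial : ℝ)⁻¹ • θ fun a => stdVec (J a)) := by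
  apply alternating_ext_stdVec
  intro K
  -- In the Leibniz formula the term of `ρ` survives exactly when `J = K ∘ ρ`. Writing this as a sum
  -- of indicators also covers a non-injective `K`.
  have key : ∀ (J : Fin k → Fin d), coordWedge J (fun a => stdVec (K a)) =
      ∑ ρ : Equiv.Perm (Fin k), if J = K ∘ ρ then ((Equiv.Perm.sign ρ : ℤ) : ℝ) else 0 := by
    intro J
    rw [coordWedge_apply, Matrix.det_apply]
    refine Finset.sum_congr rfl fun ρ _ => ?_
    simp only [Matrix.of_apply, stdVec_apply, Finset.prod_boole, funext_iff, Function.comp_apply,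
      Finset.mem_univ, true_imp_iff]
    split_ifs <;> simp [Units.smul_def]
  rw [ContinuousAlternatingMap.sum_apply]
  simp only [simpleForm_apply, key, Finset.sum_smul, ite_smul, zero_smul]
  rw [Finset.sum_comm]
  simp only [Finset.sum_ite_eq', Finset.mem_univ, if_true]
  have : ∀ ρ : Equiv.Perm (Fin k), ((Equiv.Perm.sign ρ : ℤ) : ℝ) • (k.factorial : ℝ)⁻¹ •
      (θ fun a => stdVec ((K ∘ ρ) a)) = (k.factorial : ℝ)⁻¹ • θ fun a => stdVec (K a) := by
    intro ρ
    have h := θ.toAlternatingMap.map_perm (fun a => stdVec (K a)) ρ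
    have h' : (θ fun a => stdVec ((K ∘ ρ) a)) =
      ((Equiv.Perm.sign ρ : ℤ) : ℝ) • θ fun a => stdVec (K a) := by
      rw [Int.cast_smul_eq_zsmul]; exact h
    rw [h', smul_comm, smul_smul, smul_smul]
    congr 1
    rcases Int.units_eq_one_or (Equiv.Perm.sign ρ) with h | h <;> simp [h]
  rw [Finset.sum_congr rfl fun ρ _ => this ρ]
  rw [Finset.sum_const, Finset.card_univ, Fintype.card_perm, Fintype.card_fin,
    ← Nat.cast_smul_eq_nsmul ℝ, smul_smul, mul_inv_cancel₀ (by positivity), one_smul]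

/-- Used to reduce identities that are linear in each form to `dx^J ⊗ v`. -/
theorem form_induction {k : ℕ} {P : (Model d [⋀^Fin k]→L[ℝ] V) → Prop}
    (zero : P 0) (add : ∀ θ η, P θ → P η → P (θ + η))
    (simple : ∀ J v, P (simpleForm J v)) (θ : Model d [⋀^Fin k]→L[ℝ] V) : P θ := by
  rw [form_eq_sum θ]
  exact Finset.sum_induction _ P add zero fun J _ => simple J _

/-- Finite dimensionality makes every linear or bilinear operation on forms continuous, hence
smooth, which is how smoothness of wedge products, images and stars is obtained below. -/
instance finiteDimensional_form [FiniteDimensional ℝ V] (k : ℕ) :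
    FiniteDimensional ℝ (Model d [⋀^Fin k]→L[ℝ] V) := by
  let f : (Model d [⋀^Fin k]→L[ℝ] V) →ₗ[ℝ] ((Fin k → Fin d) → V) :=
    { toFun := fun θ J => θ fun a => stdVec (J a)
      map_add' := fun _ _ => rfl
      map_smul' := fun _ _ => rfl }
  exact Module.Finite.of_injective f fun θ η h => alternating_ext_stdVec fun J => congrFun h J

/-- Concatenation of multi-indices. -/
def appendIndex {X : Type*} {p q r : ℕ} (h : p + q = r) (J : Fin p → X) (K : Fin q → X) :
    Fin r → X :=
  fun a => Fin.append J K (Fin.cast h.symm a)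

theorem wedgeAt_apply {T : Type*} [AddCommGroup T] [Module ℝ T] [TopologicalSpace T] {p q r : ℕ}
    (h : p + q = r) (b : V →L[ℝ] W →L[ℝ] U) (θ : T [⋀^Fin p]→L[ℝ] V) (η : T [⋀^Fin q]→L[ℝ] W)
    (v : Fin r → T) :
    wedgeAt h b θ η v = ((p.factorial : ℝ) * (q.factorial : ℝ))⁻¹ •
      ∑ τ : Equiv.Perm (Fin r), ((Equiv.Perm.sign τ : ℤ) : ℝ) •
        b (θ fun i => v (τ (Fin.cast h (Fin.castAdd q i))))
          (η fun j => v (τ (Fin.cast h (Fin.natAdd p j)))) := by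
  rw [wedgeAt, ContinuousAlternatingMap.smul_apply,
    ContinuousMultilinearMap.alternatization_apply_apply]
  simp only [Units.smul_def, Int.cast_smul_eq_zsmul]
  rfl

section Bilinear

variable {T : Type*} [AddCommGroup T] [Module ℝ T] [TopologicalSpace T] {p q r : ℕ}
    (h : p + q = r) (b b' : V →L[ℝ] W →L[ℝ] U)

theorem wedgeAt_add_left (θ θ' : T [⋀^Fin p]→L[ℝ] V) (η : T [⋀^Fin q]→L[ℝ] W) :
    wedgeAt h b (θ + θ') η = wedgeAt h b θ η + wedgeAt h b θ' η := by
  ext v; simp [wedgeAt_apply, Finset.sum_add_distrib]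

theorem wedgeAt_add_right (θ : T [⋀^Fin p]→L[ℝ] V) (η η' : T [⋀^Fin q]→L[ℝ] W) :
    wedgeAt h b θ (η + η') = wedgeAt h b θ η + wedgeAt h b θ η' := by
  ext v; simp [wedgeAt_apply, Finset.sum_add_distrib]

theorem wedgeAt_smul_left (c : ℝ) (θ : T [⋀^Fin p]→L[ℝ] V) (η : T [⋀^Fin q]→L[ℝ] W) :
    wedgeAt h b (c • θ) η = c • wedgeAt h b θ η := by
  ext v; simp [wedgeAt_apply, Finset.smul_sum, smul_comm c]

theorem wedgeAt_smul_right (c : ℝ) (θ : T [⋀^Fin p]→L[ℝ] V) (η : T [⋀^Fin q]→L[ℝ] W) :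
    wedgeAt h b θ (c • η) = c • wedgeAt h b θ η := by
  ext v; simp [wedgeAt_apply, Finset.smul_sum, smul_comm c]

theorem wedgeAt_neg_bilin (θ : T [⋀^Fin p]→L[ℝ] V) (η : T [⋀^Fin q]→L[ℝ] W) :
    wedgeAt h (-b) θ η = -wedgeAt h b θ η := by
  ext v; simp [wedgeAt_apply]

theorem wedgeAt_zero_left (η : T [⋀^Fin q]→L[ℝ] W) :
    wedgeAt h b (0 : T [⋀^Fin p]→L[ℝ] V) η = 0 := by
  ext v; simp [wedgeAt_apply]

theorem wedgeAt_zero_right (θ : T [⋀^Fin p]→L[ℝ] V) :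
    wedgeAt h b θ (0 : T [⋀^Fin q]→L[ℝ] W) = 0 := by
  ext v; simp [wedgeAt_apply]

theorem wedgeAt_compContinuousLinearMap {T' : Type*} [AddCommGroup T'] [Module ℝ T']
    [TopologicalSpace T'] (f : T' →L[ℝ] T) (θ : T [⋀^Fin p]→L[ℝ] V) (η : T [⋀^Fin q]→L[ℝ] W) :
    (wedgeAt h b θ η).compContinuousLinearMap f =
      wedgeAt h b (θ.compContinuousLinearMap f) (η.compContinuousLinearMap f) := by
  ext v
  rw [ContinuousAlternatingMap.compContinuousLinearMap_apply, wedgeAt_apply, wedgeAt_apply]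
  rfl

end Bilinear

/-- Expanding both determinants gives a sum over `(τ, ρ, ρ')`. For fixed `ρ` and `ρ'` the
substitution `τ ↦ τ (ρ ⊕ ρ')` turns the sum over `τ` into the Leibniz formula for the concatenated
index, so the total is `p! q!` copies of one determinant. -/
theorem sum_sign_mul_coordWedge {p q : ℕ} (J : Fin p → Fin d) (K : Fin q → Fin d)
    (v : Fin (p + q) → Model d) :
    ∑ τ : Equiv.Perm (Fin (p + q)), ((Equiv.Perm.sign τ : ℤ) : ℝ) *
      (coordWedge J (fun i => v (τ (Fin.castAdd q i))) *
        coordWedge K (fun j => v (τ (Fin.natAdd p j)))) =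
      ((p.factorial : ℝ) * (q.factorial : ℝ)) * coordWedge (Fin.append J K) v := by
  have expand : ∀ τ : Equiv.Perm (Fin (p + q)), ((Equiv.Perm.sign τ : ℤ) : ℝ) *
      (coordWedge J (fun i => v (τ (Fin.castAdd q i))) *
        coordWedge K (fun j => v (τ (Fin.natAdd p j)))) =
      ∑ ρ : Equiv.Perm (Fin p), ∑ ρ' : Equiv.Perm (Fin q),
        ((Equiv.Perm.sign (τ * finSumFinEquiv.permCongr (Equiv.sumCongr ρ ρ')) : ℤ) : ℝ) *
          ∏ a : Fin (p + q), v ((τ * finSumFinEquiv.permCongr (Equiv.sumCongr ρ ρ')) a)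
            (Fin.append J K a) := by
    intro τ
    rw [coordWedge_apply, coordWedge_apply, Matrix.det_apply', Matrix.det_apply',
      Finset.sum_mul_sum, Finset.mul_sum]
    refine Finset.sum_congr rfl fun ρ _ => ?_
    rw [Finset.mul_sum]
    refine Finset.sum_congr rfl fun ρ' _ => ?_
    rw [Fin.prod_univ_add, Equiv.Perm.sign_mul, Equiv.Perm.sign_permCongr,
      Equiv.Perm.sign_sumCongr]
    simp [Equiv.permCongr_apply]
    ring
  rw [Finset.sum_congr rfl fun τ _ => expand τ, Finset.sum_comm]
  have inner : ∀ ρ : Equiv.Perm (Fin p), ∑ τ : Equiv.Perm (Fin (p + q)),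
      ∑ ρ' : Equiv.Perm (Fin q),
        ((Equiv.Perm.sign (τ * finSumFinEquiv.permCongr (Equiv.sumCongr ρ ρ')) : ℤ) : ℝ) *
          ∏ a : Fin (p + q), v ((τ * finSumFinEquiv.permCongr (Equiv.sumCongr ρ ρ')) a)
            (Fin.append J K a) = (q.factorial : ℝ) * coordWedge (Fin.append J K) v := by
    intro ρ
    rw [Finset.sum_comm]
    have : ∀ ρ' : Equiv.Perm (Fin q), ∑ τ : Equiv.Perm (Fin (p + q)),
        ((Equiv.Perm.sign (τ * finSumFinEquiv.permCongr (Equiv.sumCongr ρ ρ')) : ℤ) : ℝ) *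
          ∏ a : Fin (p + q), v ((τ * finSumFinEquiv.permCongr (Equiv.sumCongr ρ ρ')) a)
            (Fin.append J K a) = coordWedge (Fin.append J K) v := by
      intro ρ'
      rw [coordWedge_apply, Matrix.det_apply']
      exact Equiv.sum_comp (Equiv.mulRight (finSumFinEquiv.permCongr (Equiv.sumCongr ρ ρ')))
        fun τ : Equiv.Perm (Fin (p + q)) => ((Equiv.Perm.sign τ : ℤ) : ℝ) *
          ∏ a : Fin (p + q), v (τ a) (Fin.append J K a)
    rw [Finset.sum_congr rfl fun ρ' _ => this ρ']
    simp [Fintype.card_perm]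
  rw [Finset.sum_congr rfl fun ρ _ => inner ρ]
  simp [Fintype.card_perm, mul_assoc]

/-- The normalization `1/(p! q!)` is what makes the wedge product plain concatenation of indices.
Commutativity, associativity and the Leibniz rule all reduce to this. -/
theorem wedgeAt_simpleForm {p q r : ℕ} (h : p + q = r) (b : V →L[ℝ] W →L[ℝ] U)
    (J : Fin p → Fin d) (v : V) (K : Fin q → Fin d) (w : W) :
    wedgeAt h b (simpleForm J v) (simpleForm K w) = simpleForm (appendIndex h J K) (b v w) := by
  subst h
  ext x
  have := sum_sign_mul_coordWedge J K x
  rw [wedgeAt_apply]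
  simp only [simpleForm_apply, Fin.cast_eq_self, map_smul, smul_smul,
    smul_apply, ← Finset.sum_smul]
  congr 1
  have hne : ((p.factorial : ℝ) * (q.factorial : ℝ)) ≠ 0 := by positivity
  rw [inv_mul_eq_iff_eq_mul₀ hne]
  convert this using 2 with τ
  · ring
  · rfl

theorem finRotate_pow_apply (n k : ℕ) (i : Fin (n + 1)) :
    (((finRotate (n + 1)) ^ k) i : ℕ) = (i + k) % (n + 1) := by
  induction k with
  | zero => simp [Nat.mod_eq_of_lt i.2]
  | succ k ih =>
    rw [pow_succ', Equiv.Perm.mul_apply, finRotate_apply, Fin.val_add, ih]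
    simp [add_assoc]

/-- Exchanging the two blocks is a cyclic shift by `p` places, a power of the rotation, so its sign
can be computed from that of the rotation. -/
theorem appendIndex_swap {X : Type*} {p q r : ℕ} (h : p + q = r) (h' : q + p = r) (J : Fin p → X)
    (K : Fin q → X) : appendIndex h' K J = appendIndex h J K ∘ ((finRotate r) ^ p) := by
  rcases r with _ | n
  · funext a; exact a.elim0
  funext a
  simp only [appendIndex, Function.comp_apply, Fin.append, Fin.addCases]
  have hv := finRotate_pow_apply n p a
  have ha := a.2
  by_cases hq : (a : ℕ) < q
  · have h1 : (((finRotate (n + 1)) ^ p) a : ℕ) = a + p := by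
      rw [hv, Nat.mod_eq_of_lt (by omega)]
    rw [dif_pos (by simpa using hq), dif_neg (by simp [h1])]
    simp only [eq_rec_constant]
    congr 1
    ext; simp [h1]
  · have h1 : (((finRotate (n + 1)) ^ p) a : ℕ) = a - q := by
      rw [hv, show (a : ℕ) + p = (a - q) + (n + 1) by omega, Nat.add_mod_right,
        Nat.mod_eq_of_lt (by omega)]
    rw [dif_neg (by simpa using hq), dif_pos (by simp [h1]; omega)]
    simp only [eq_rec_constant]
    congr 1
    ext; simp [h1]

/-- The rotation of `r` points has sign `(-1)^(r-1)`, and `(r-1) p = p q + (p-1) p` with `(p-1) p`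
even. -/
theorem sign_finRotate_pow {p q r : ℕ} (h : p + q = r) :
    ((Equiv.Perm.sign ((finRotate r) ^ p) : ℤ) : ℝ) = (-1) ^ (p * q) := by
  rw [map_pow, sign_finRotate]
  rcases Nat.eq_zero_or_pos p with rfl | hp
  · simp
  push_cast
  rw [← pow_mul, show (r - 1) * p = p * q + (p - 1) * p by
    obtain ⟨p, rfl⟩ := Nat.exists_eq_add_of_le hp
    subst h
    simp only [Nat.add_sub_cancel_left, show 1 + p + q - 1 = p + q by omega]
    ring, pow_add]
  have : Even ((p - 1) * p) := by
    have := Nat.even_mul_pred_self p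
    rwa [mul_comm] at this
  rw [this.neg_one_pow, mul_one]

theorem simpleForm_append_swap {p q r : ℕ} (h : p + q = r) (h' : q + p = r) (J : Fin p → Fin d)
    (K : Fin q → Fin d) (v : V) :
    simpleForm (appendIndex h' K J) v = (-1 : ℝ) ^ (p * q) • simpleForm (appendIndex h J K) v := by
  ext x
  rw [appendIndex_swap h h', ContinuousAlternatingMap.smul_apply, simpleForm_apply,
    simpleForm_apply, coordWedge_comp_perm, sign_finRotate_pow h,
    ContinuousAlternatingMap.smul_apply, smul_assoc]

/-- Graded commutativity of the wedge product. -/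
theorem wedgeAt_swap {p q r : ℕ} (h : p + q = r) (h' : q + p = r) (b : V →L[ℝ] W →L[ℝ] U)
    (θ : Model d [⋀^Fin p]→L[ℝ] V) (η : Model d [⋀^Fin q]→L[ℝ] W) :
    wedgeAt h b θ η = (-1 : ℝ) ^ (p * q) • wedgeAt h' b.flip η θ := by
  induction θ using form_induction with
  | zero => simp [wedgeAt_zero_left, wedgeAt_zero_right]
  | add θ θ' h₁ h₂ => simp [wedgeAt_add_left, wedgeAt_add_right, h₁, h₂]
  | simple J v =>
    induction η using form_induction with
    | zero => simp [wedgeAt_zero_left, wedgeAt_zero_right]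
    | add θ θ' h₁ h₂ => simp [wedgeAt_add_left, wedgeAt_add_right, h₁, h₂]
    | simple K w =>
      rw [wedgeAt_simpleForm, wedgeAt_simpleForm, simpleForm_append_swap h' h, mul_comm q p]
      rfl

theorem appendIndex_assoc {X : Type*} {p q r s t u : ℕ} (h₁ : q + r = s) (h₂ : p + s = t)
    (h₃ : p + q = u) (h₄ : u + r = t) (J : Fin p → X) (K : Fin q → X) (L : Fin r → X) :
    appendIndex h₂ J (appendIndex h₁ K L) = appendIndex h₄ (appendIndex h₃ J K) L := by
  subst h₁ h₂ h₃
  funext a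
  change Fin.append J (Fin.append K L) a = Fin.append (Fin.append J K) L (Fin.cast h₄.symm a)
  rw [Fin.append_assoc]
  rfl

/-- Associativity of the wedge product along compatible bilinear maps. -/
theorem wedgeAt_assoc {V₁ V₂ V₃ V₄ V₅ V₆ : Type*} [NormedAddCommGroup V₁] [NormedSpace ℝ V₁]
    [NormedAddCommGroup V₂] [NormedSpace ℝ V₂] [NormedAddCommGroup V₃] [NormedSpace ℝ V₃]
    [NormedAddCommGroup V₄] [NormedSpace ℝ V₄] [NormedAddCommGroup V₅] [NormedSpace ℝ V₅]
    [NormedAddCommGroup V₆] [NormedSpace ℝ V₆]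
    {p q r s t u : ℕ} (h₁ : q + r = s) (h₂ : p + s = t) (h₃ : p + q = u) (h₄ : u + r = t)
    (b₁ : V₂ →L[ℝ] V₃ →L[ℝ] V₄) (b₂ : V₁ →L[ℝ] V₄ →L[ℝ] V₆)
    (b₃ : V₁ →L[ℝ] V₂ →L[ℝ] V₅) (b₄ : V₅ →L[ℝ] V₃ →L[ℝ] V₆)
    (hb : ∀ u v w, b₂ u (b₁ v w) = b₄ (b₃ u v) w)
    (θ : Model d [⋀^Fin p]→L[ℝ] V₁) (η : Model d [⋀^Fin q]→L[ℝ] V₂)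
    (ζ : Model d [⋀^Fin r]→L[ℝ] V₃) :
    wedgeAt h₂ b₂ θ (wedgeAt h₁ b₁ η ζ) = wedgeAt h₄ b₄ (wedgeAt h₃ b₃ θ η) ζ := by
  induction θ using form_induction with
  | zero => simp [wedgeAt_zero_left]
  | add θ θ' h₁ h₂ => simp [wedgeAt_add_left, h₁, h₂]
  | simple J u =>
    induction η using form_induction with
    | zero => simp [wedgeAt_zero_left, wedgeAt_zero_right]
    | add θ θ' h₁ h₂ => simp [wedgeAt_add_left, wedgeAt_add_right, h₁, h₂]
    | simple K v =>
      induction ζ using form_induction with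
      | zero => simp [wedgeAt_zero_right]
      | add θ θ' h₁ h₂ => simp [wedgeAt_add_right, h₁, h₂]
      | simple L w =>
        rw [wedgeAt_simpleForm, wedgeAt_simpleForm, wedgeAt_simpleForm, wedgeAt_simpleForm, hb,
          appendIndex_assoc h₁ h₂ h₃ h₄]

/-- Wedge products with linear maps applied to the arguments. -/
theorem wedgeAt_map_eq {V' W' : Type*} [NormedAddCommGroup V'] [NormedSpace ℝ V']
    [NormedAddCommGroup W'] [NormedSpace ℝ W'] {T : Type*} [AddCommGroup T] [Module ℝ T]
    [TopologicalSpace T] {p q r : ℕ} (h : p + q = r) (b : V →L[ℝ] W →L[ℝ] U)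
    (b' : V' →L[ℝ] W' →L[ℝ] U) (f : V →L[ℝ] V') (g : W' →L[ℝ] W)
    (hb : ∀ v w', b v (g w') = b' (f v) w')
    (θ : T [⋀^Fin p]→L[ℝ] V) (η : T [⋀^Fin q]→L[ℝ] W') :
    wedgeAt h b θ (g.compContinuousAlternatingMap η) =
      wedgeAt h b' (f.compContinuousAlternatingMap θ) η := by
  ext v
  simp [wedgeAt_apply, hb]

end CoordinateForms

/-! ### Exterior derivative on `ℝ^d` and the Leibniz rule -/

section ExteriorDerivative

variable {d : ℕ} {V W U : Type*} [NormedAddCommGroup V] [NormedSpace ℝ V]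
  [NormedAddCommGroup W] [NormedSpace ℝ W] [NormedAddCommGroup U] [NormedSpace ℝ U]

/-- The wedge product of alternating forms as a bilinear map. -/
def wedgeₗ {p q r : ℕ} (h : p + q = r) (b : V →L[ℝ] W →L[ℝ] U) :
    (Model d [⋀^Fin p]→L[ℝ] V) →ₗ[ℝ] (Model d [⋀^Fin q]→L[ℝ] W) →ₗ[ℝ] (Model d [⋀^Fin r]→L[ℝ] U) :=
  LinearMap.mk₂ ℝ (wedgeAt h b) (wedgeAt_add_left h b) (wedgeAt_smul_left h b)
    (wedgeAt_add_right h b) (fun c => wedgeAt_smul_right h b c)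

/-- The wedge product of alternating forms as a continuous bilinear map. -/
def wedgeL [FiniteDimensional ℝ V] [FiniteDimensional ℝ W] {p q r : ℕ} (h : p + q = r)
    (b : V →L[ℝ] W →L[ℝ] U) : (Model d [⋀^Fin p]→L[ℝ] V) →L[ℝ] (Model d [⋀^Fin q]→L[ℝ] W) →L[ℝ]
      (Model d [⋀^Fin r]→L[ℝ] U) :=
  (wedgeₗ h b).toContinuousBilinearMap

theorem wedgeL_apply [FiniteDimensional ℝ V] [FiniteDimensional ℝ W] {p q r : ℕ} (h : p + q = r)
    (b : V →L[ℝ] W →L[ℝ] U) (θ : Model d [⋀^Fin p]→L[ℝ] V) (η : Model d [⋀^Fin q]→L[ℝ] W) :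
    wedgeL h b θ η = wedgeAt h b θ η := rfl

/-- The operation `dx^i ∧ ·`. -/
def dxWedge {k : ℕ} (i : Fin d) :
    (Model d [⋀^Fin k]→L[ℝ] V) →ₗ[ℝ] (Model d [⋀^Fin (k + 1)]→L[ℝ] V) where
  toFun θ := .alternatizeUncurryFin ((EuclideanSpace.proj i : Model d →L[ℝ] ℝ).smulRight θ)
  map_add' θ η := by
    rw [← ContinuousAlternatingMap.alternatizeUncurryFin_add]
    congr 1; ext; simp
  map_smul' c θ := by
    rw [RingHom.id_apply, ← ContinuousAlternatingMap.alternatizeUncurryFin_smul]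
    congr 1; ext; simp [smul_comm c]

/-- Applied to a derivative, this is the classical `d = ∑ dx^i ∧ ∂_i`. The Leibniz rule for `d` then
reduces to the product rule for `∂_i` and to moving `dx^i` through a wedge product. -/
theorem alternatizeUncurryFin_eq_sum {k : ℕ} (φ : Model d →L[ℝ] Model d [⋀^Fin k]→L[ℝ] V) :
    ContinuousAlternatingMap.alternatizeUncurryFin φ = ∑ i, dxWedge i (φ (stdVec i)) := by
  ext v
  rw [ContinuousAlternatingMap.sum_apply]
  simp only [dxWedge, LinearMap.coe_mk, AddHom.coe_mk,
    ContinuousAlternatingMap.alternatizeUncurryFin_apply]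
  rw [Finset.sum_comm]
  refine Finset.sum_congr rfl fun k _ => ?_
  rw [← Finset.smul_sum]
  congr 1
  have : v k = ∑ i, v k i • stdVec i := by
    ext j
    simp [Finset.sum_apply, Pi.single_apply]
  conv_lhs => rw [this, map_sum, ContinuousAlternatingMap.sum_apply]
  refine Finset.sum_congr rfl fun i _ => ?_
  simp

/-- The alternating sum in `alternatizeUncurryFin` is the Laplace expansion of the determinant along
its first column. -/
theorem dxWedge_simpleForm {k : ℕ} (i : Fin d) (J : Fin k → Fin d) (v : V) :
    dxWedge i (simpleForm J v) = simpleForm (Fin.cons i J : Fin (k + 1) → Fin d) v := by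
  ext x
  simp only [dxWedge, LinearMap.coe_mk, AddHom.coe_mk,
    ContinuousAlternatingMap.alternatizeUncurryFin_apply]
  rw [simpleForm_apply, coordWedge_apply, Matrix.det_succ_column_zero, Finset.sum_smul]
  refine Finset.sum_congr rfl fun a _ => ?_
  simp only [ContinuousLinearMap.smulRight_apply, ContinuousAlternatingMap.smul_apply,
    simpleForm_apply, coordWedge_apply, Matrix.of_apply, Fin.cons_zero]
  rw [← smul_assoc, ← smul_assoc, zsmul_eq_mul]
  push_cast
  rfl

theorem appendIndex_cons {X : Type*} {p q r : ℕ} (h : p + q = r) (h' : p + 1 + q = r + 1)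
    (i : X) (J : Fin p → X) (K : Fin q → X) :
    (Fin.cons i (appendIndex h J K) : Fin (r + 1) → X) =
      appendIndex h' (Fin.cons i J : Fin (p + 1) → X) K := by
  subst h
  funext a
  simp only [appendIndex, Fin.append_cons]
  rfl

theorem dxWedge_wedgeAt {p q r : ℕ} (h : p + q = r) (h' : p + 1 + q = r + 1)
    (b : V →L[ℝ] W →L[ℝ] U) (i : Fin d) (θ : Model d [⋀^Fin p]→L[ℝ] V)
    (η : Model d [⋀^Fin q]→L[ℝ] W) :
    dxWedge i (wedgeAt h b θ η) = wedgeAt h' b (dxWedge i θ) η := by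
  induction θ using form_induction with
  | zero => simp [wedgeAt_zero_left]
  | add θ θ' h₁ h₂ => simp [wedgeAt_add_left, h₁, h₂]
  | simple J v =>
    induction η using form_induction with
    | zero => simp [wedgeAt_zero_right]
    | add θ θ' h₁ h₂ => simp [wedgeAt_add_right, h₁, h₂]
    | simple K w =>
      rw [wedgeAt_simpleForm, dxWedge_simpleForm, dxWedge_simpleForm, wedgeAt_simpleForm,
        appendIndex_cons h h']

theorem neg_one_pow_mul_self (n : ℕ) : (-1 : ℝ) ^ n * (-1 : ℝ) ^ n = 1 := by
  rw [← mul_pow]; norm_num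

/-- Swapping the factors before and after inserting `dx^i` costs `(-1)^(pq)` and `(-1)^((q+1)p)`,
whose product is `(-1)^p`. -/
theorem dxWedge_wedgeAt_right {p q r : ℕ} (h : p + q = r) (h' : p + (q + 1) = r + 1)
    (b : V →L[ℝ] W →L[ℝ] U) (i : Fin d) (θ : Model d [⋀^Fin p]→L[ℝ] V)
    (η : Model d [⋀^Fin q]→L[ℝ] W) :
    dxWedge i (wedgeAt h b θ η) = (-1 : ℝ) ^ p • wedgeAt h' b θ (dxWedge i η) := by
  rw [wedgeAt_swap h (by omega), map_smul, dxWedge_wedgeAt (by omega) (by omega),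
    wedgeAt_swap (by omega) h', smul_smul, ContinuousLinearMap.flip_flip]
  congr 1
  rw [add_mul, one_mul, pow_add, ← mul_assoc, mul_comm q p, neg_one_pow_mul_self, one_mul]

/-- The Leibniz rule for the exterior derivative on `ℝ^d`. -/
theorem extDeriv_wedgeAt [FiniteDimensional ℝ V] [FiniteDimensional ℝ W] {p q r : ℕ}
    (h : p + q = r) (h₁ : p + 1 + q = r + 1) (h₂ : p + (q + 1) = r + 1)
    (b : V →L[ℝ] W →L[ℝ] U) {θ : Model d → Model d [⋀^Fin p]→L[ℝ] V}
    {η : Model d → Model d [⋀^Fin q]→L[ℝ] W} {y : Model d} (hθ : DifferentiableAt ℝ θ y)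
    (hη : DifferentiableAt ℝ η y) :
    extDeriv (fun y => wedgeAt h b (θ y) (η y)) y =
      wedgeAt h₁ b (extDeriv θ y) (η y) + (-1 : ℝ) ^ p • wedgeAt h₂ b (θ y) (extDeriv η y) := by
  have hd := (wedgeL (d := d) h b).hasFDerivAt_of_bilinear hθ.hasFDerivAt hη.hasFDerivAt
  have hd' : fderiv ℝ (fun y => wedgeAt h b (θ y) (η y)) y = _ := hd.fderiv
  rw [extDeriv, hd', alternatizeUncurryFin_eq_sum, extDeriv, extDeriv,
    alternatizeUncurryFin_eq_sum, alternatizeUncurryFin_eq_sum]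
  change _ = wedgeL h₁ b _ _ + (-1 : ℝ) ^ p • wedgeL h₂ b _ _
  rw [map_sum, map_sum, sum_apply, Finset.smul_sum, ← Finset.sum_add_distrib]
  refine Finset.sum_congr rfl fun i _ => ?_
  rw [wedgeL_apply, wedgeL_apply, ← dxWedge_wedgeAt h, ← dxWedge_wedgeAt_right h, ← map_add]
  exact congrArg (dxWedge i) (add_comm _ _)

end ExteriorDerivative

/-! ### Pointwise Hodge star: naturality, square and symmetry -/

section HodgeStar

variable {d : ℕ} {V W U : Type*} [NormedAddCommGroup V] [NormedSpace ℝ V]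
  [NormedAddCommGroup W] [NormedSpace ℝ W] [NormedAddCommGroup U] [NormedSpace ℝ U]

theorem appendIndex_update_right {X : Type*} {p q r : ℕ} [DecidableEq (Fin q)] (h : p + q = r)
    (u : Fin p → X) (v : Fin q → X) (k : Fin q) (x : X) :
    appendIndex h u (Function.update v k x) =
      Function.update (appendIndex h u v) (Fin.cast h (Fin.natAdd p k)) x := by
  subst h
  funext a
  simp only [appendIndex]
  induction a using Fin.addCases with
  | left i =>
    rw [Function.update_of_ne (by simp [Fin.ext_iff]; omega)]
    simp [appendIndex]
  | right j =>
    by_cases hj : j = k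
    · subst hj; simp
    · rw [Function.update_of_ne (by simp [Fin.ext_iff] at hj ⊢; omega)]
      simp [hj, appendIndex]

theorem of_update_eq_updateRow (w : Fin d → Model d) (c : Fin d) (x : Model d) :
    (Matrix.of fun a b => Function.update w c x a b) =
      (Matrix.of fun a b => w a b).updateRow c x := by
  ext a b
  rw [Matrix.of_apply, Matrix.updateRow_apply, Function.update_apply]
  split_ifs <;> rfl

/-- The determinant of the vectors `u₁, …, u_r, v₁, …, v_s` as a form in `v`. -/
def volAppend {r s : ℕ} (h : r + s = d) (u : Fin r → Model d) : Model d [⋀^Fin s]→L[ℝ] ℝ where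
  toFun v := (Matrix.of fun a b => appendIndex h u v a b).det
  map_update_add' v k x y := by
    simp only [appendIndex_update_right, of_update_eq_updateRow]
    exact Matrix.det_updateRow_add _ _ _ _
  map_update_smul' v k c x := by
    simp only [appendIndex_update_right, of_update_eq_updateRow]
    exact Matrix.det_updateRow_smul _ _ _ _
  cont := by
    refine Continuous.matrix_det (continuous_matrix fun a b => ?_)
    rcases exists_index h a with ⟨i, rfl⟩ | ⟨j, rfl⟩ <;> simp [appendIndex] <;> fun_prop
  map_eq_zero_of_eq' v i j hij hne := by
    refine Matrix.det_zero_of_row_eq (i := Fin.cast h (Fin.natAdd r i))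
      (j := Fin.cast h (Fin.natAdd r j)) (by simpa [Fin.ext_iff] using hne) ?_
    funext b
    simp [appendIndex, hij]

theorem volAppend_apply {r s : ℕ} (h : r + s = d) (u : Fin r → Model d) (v : Fin s → Model d) :
    volAppend h u v = (Matrix.of fun a b => appendIndex h u v a b).det := rfl

theorem appendIndex_comp {X Y : Type*} {p q r : ℕ} (h : p + q = r) (f : X → Y) (J : Fin p → X)
    (K : Fin q → X) (a : Fin r) : f (appendIndex h J K a) =
      appendIndex h (fun i => f (J i)) (fun i => f (K i)) a := by
  subst h
  simp only [appendIndex]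
  induction a using Fin.addCases <;> simp

theorem volAppend_stdVec {r s : ℕ} (h : r + s = d) (i : Fin r → Fin d) (j : Fin s → Fin d) :
    volAppend h (fun a => stdVec (i a)) (fun b => stdVec (j b)) =
      leviCivita (appendIndex h i j) := by
  rw [volAppend_apply, leviCivita]
  congr 1
  ext a b
  rw [Matrix.of_apply, Matrix.of_apply, ← appendIndex_comp h stdVec, stdVec_apply]
  simp [eq_comm]

theorem volAppend_swap {r s : ℕ} (h : r + s = d) (h' : s + r = d) (u : Fin r → Model d)
    (v : Fin s → Model d) : volAppend h' v u = (-1 : ℝ) ^ (r * s) * volAppend h u v := by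
  rw [volAppend_apply, volAppend_apply, appendIndex_swap h h', ← sign_finRotate_pow h]
  exact Matrix.det_permute ((finRotate d) ^ r) (Matrix.of fun a b => appendIndex h u v a b)

theorem leviCivita_swap {r s : ℕ} (h : r + s = d) (h' : s + r = d) (i : Fin r → Fin d)
    (j : Fin s → Fin d) : leviCivita (appendIndex h' j i) =
      (-1 : ℝ) ^ (r * s) * leviCivita (appendIndex h i j) := by
  rw [← volAppend_stdVec, ← volAppend_stdVec, volAppend_swap h h']

theorem alternating_sum_expand {k m : ℕ} (θ : Model d [⋀^Fin k]→L[ℝ] V) (c : Fin k → Fin m → ℝ)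
    (e : Fin m → Model d) : (θ fun a => ∑ j, c a j • e j) =
      ∑ J : Fin k → Fin m, (∏ a, c a (J a)) • θ fun a => e (J a) := by
  have := θ.toMultilinearMap.map_sum fun (a : Fin k) (j : Fin m) => c a j • e j
  refine this.trans (Finset.sum_congr rfl fun J _ => ?_)
  exact θ.toMultilinearMap.map_smul_univ (fun a => c a (J a)) fun a => e (J a)

/-- `volAppend` is packaged as an alternating form in its last block only. Expansion in the first
block goes through two block swaps, whose signs cancel. -/
theorem volAppend_sum_expand {r s m : ℕ} (h : r + s = d) (c : Fin r → Fin m → ℝ)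
    (e : Fin m → Model d) (v : Fin s → Model d) :
    volAppend h (fun a => ∑ j, c a j • e j) v =
      ∑ J : Fin r → Fin m, (∏ a, c a (J a)) * volAppend h (fun a => e (J a)) v := by
  have h' : s + r = d := by omega
  rw [volAppend_swap h' h, alternating_sum_expand, Finset.mul_sum]
  refine Finset.sum_congr rfl fun J _ => ?_
  rw [volAppend_swap h' h, smul_eq_mul]
  ring

/-- The `m`-th row of a matrix as a vector. -/
def rowVec (P : Matrix (Fin d) (Fin d) ℝ) (m : Fin d) : Model d := ∑ m', P m m' • stdVec m'

/-- The sum over `j` of Levi-Civita symbols times `dx^j` is `s!` times the determinant form, and the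
sum over `i'` feeds rows of `G⁻¹` into `θ`. Determinants and row vectors transform simply under
linear maps, which the original index formula hides. -/
theorem hodgeCoord_apply {r s : ℕ} (h : r + s = d) (G : Matrix (Fin d) (Fin d) ℝ)
    (θ : Model d [⋀^Fin r]→L[ℝ] V) (v : Fin s → Model d) :
    hodgeCoord h G θ v = (Real.sqrt |G.det| / r.factorial) • ∑ i : Fin r → Fin d,
      volAppend h (fun a => stdVec (i a)) v • θ fun a => rowVec G⁻¹ (i a) := by
  have key : ∀ i : Fin r → Fin d, volAppend h (fun a => stdVec (i a)) v =
      (s.factorial : ℝ)⁻¹ * ∑ j : Fin s → Fin d,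
        leviCivita (appendIndex h i j) * coordWedge j v := by
    intro i
    conv_lhs => rw [form_eq_sum (volAppend h fun a => stdVec (i a))]
    rw [ContinuousAlternatingMap.sum_apply, Finset.mul_sum]
    refine Finset.sum_congr rfl fun j _ => ?_
    rw [simpleForm_apply, volAppend_stdVec, smul_eq_mul, smul_eq_mul]
    ring
  simp only [rowVec, key, alternating_sum_expand]
  rw [hodgeCoord, ContinuousAlternatingMap.smul_apply, ContinuousAlternatingMap.sum_apply,
    Finset.smul_sum, Finset.smul_sum]
  refine Finset.sum_congr rfl fun i _ => ?_
  rw [ContinuousAlternatingMap.sum_apply, Finset.smul_sum, Finset.smul_sum, Finset.smul_sum]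
  refine Finset.sum_congr rfl fun i' _ => ?_
  rw [ContinuousAlternatingMap.sum_apply, Finset.mul_sum, Finset.sum_smul, Finset.smul_sum,
    Finset.smul_sum]
  refine Finset.sum_congr rfl fun j _ => ?_
  rw [ContinuousAlternatingMap.smul_apply]
  change (_ : ℝ) • (_ : ℝ) • (coordWedge j v • (θ fun a => stdVec (i' a))) = _
  simp only [smul_smul]
  congr 1
  have h1 : (r.factorial : ℝ) ≠ 0 := by positivity
  have h2 : (s.factorial : ℝ) ≠ 0 := by positivity
  change _ / _ * (_ * leviCivita (appendIndex h i j) * _) = _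
  field_simp

theorem hodgeCoord_add {r s : ℕ} (h : r + s = d) (G : Matrix (Fin d) (Fin d) ℝ)
    (θ η : Model d [⋀^Fin r]→L[ℝ] V) :
    hodgeCoord h G (θ + η) = hodgeCoord h G θ + hodgeCoord h G η := by
  ext v; simp [hodgeCoord_apply, Finset.sum_add_distrib]

theorem hodgeCoord_smul {r s : ℕ} (h : r + s = d) (G : Matrix (Fin d) (Fin d) ℝ) (c : ℝ)
    (θ : Model d [⋀^Fin r]→L[ℝ] V) : hodgeCoord h G (c • θ) = c • hodgeCoord h G θ := by
  ext v; simp [hodgeCoord_apply, Finset.smul_sum, smul_comm c]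

theorem volAppend_map {r s : ℕ} (h : r + s = d) (f : Model d →L[ℝ] Model d)
    (A : Matrix (Fin d) (Fin d) ℝ) (hf : ∀ i j, f (stdVec j) i = A i j)
    (u : Fin r → Model d) (v : Fin s → Model d) :
    volAppend h (fun a => f (u a)) (fun b => f (v b)) = A.det * volAppend h u v := by
  have hf' : ∀ (x : Model d) i, f x i = ∑ j, x j * A i j := by
    intro x i
    have : x = ∑ j, x j • stdVec j := by
      ext k; simp [Finset.sum_apply, Pi.single_apply]
    conv_lhs => rw [this]
    simp [map_sum, Finset.sum_apply, hf]
  rw [volAppend_apply, volAppend_apply, mul_comm, ← Matrix.det_transpose A, ← Matrix.det_mul]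
  congr 1
  ext a b
  rw [Matrix.of_apply, ← appendIndex_comp h f, hf', Matrix.mul_apply]
  rfl

/-- The Hodge star commutes with pullback along orientation preserving linear maps. -/
theorem hodgeCoord_pullback {r s : ℕ} (h : r + s = d) (G A : Matrix (Fin d) (Fin d) ℝ)
    (hA : 0 < A.det) (f : Model d →L[ℝ] Model d)
    (hf : ∀ i j, f (stdVec j) i = A i j) (θ : Model d [⋀^Fin r]→L[ℝ] V) :
    hodgeCoord h (A.transpose * G * A) (θ.compContinuousLinearMap f) =
      (hodgeCoord h G θ).compContinuousLinearMap f := by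
  have hu : IsUnit A.det := isUnit_iff_ne_zero.2 hA.ne'
  have hfs : ∀ j, f (stdVec j) = ∑ i, A i j • stdVec i := by
    intro j; ext i; simp [Finset.sum_apply, Pi.single_apply, hf]
  -- The vectors with raised index transform with `A⁻¹`, because `(Aᵀ G A)⁻¹ Aᵀ = A⁻¹ G⁻¹`.
  -- Expanding the standard basis in the images `f (stdVec i)` produces the same coefficients on the
  -- other side.
  have hrow : ∀ i, f (rowVec (A.transpose * G * A)⁻¹ i) = ∑ m, A⁻¹ i m • rowVec G⁻¹ m := by
    intro i
    have hinv : (A.transpose * G * A)⁻¹ * A.transpose = A⁻¹ * G⁻¹ := by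
      rw [Matrix.mul_assoc, Matrix.mul_inv_rev, Matrix.mul_inv_rev, Matrix.mul_assoc,
        Matrix.mul_assoc, Matrix.nonsing_inv_mul _ (by simpa using hu), Matrix.mul_one]
    have hl : f (rowVec (A.transpose * G * A)⁻¹ i) =
        ∑ k, ((A.transpose * G * A)⁻¹ * A.transpose) i k • stdVec k := by
      rw [rowVec, map_sum]
      simp only [map_smul, hfs, Finset.smul_sum, Matrix.mul_apply, Finset.sum_smul, smul_smul,
        Matrix.transpose_apply]
      rw [Finset.sum_comm]
    rw [hl, hinv]
    simp only [rowVec, Finset.smul_sum, Matrix.mul_apply, Finset.sum_smul, smul_smul]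
    rw [Finset.sum_comm]
  have hstd : ∀ m, stdVec m = ∑ i, A⁻¹ i m • f (stdVec i) := by
    intro m
    have : A * A⁻¹ = 1 := Matrix.mul_nonsing_inv _ hu
    simp only [hfs, Finset.smul_sum, smul_smul]
    rw [Finset.sum_comm]
    ext k
    have hk := congrFun (congrFun this k) m
    rw [Matrix.mul_apply, Matrix.one_apply] at hk
    simp only [← Finset.sum_smul]
    simp [Finset.sum_apply, Pi.single_apply, mul_comm (A⁻¹ _ _), hk]
  ext v
  rw [hodgeCoord_apply, ContinuousAlternatingMap.compContinuousLinearMap_apply, hodgeCoord_apply]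
  have hR : ∀ m : Fin r → Fin d, volAppend h (fun a => stdVec (m a)) (⇑f ∘ v) =
      ∑ i : Fin r → Fin d, (∏ a, A⁻¹ (i a) (m a)) *
        (A.det * volAppend h (fun a => stdVec (i a)) v) := by
    intro m
    have : (fun a => stdVec (m a)) = fun a => ∑ i, A⁻¹ i (m a) • f (stdVec i) := by
      funext a; exact hstd (m a)
    rw [this, volAppend_sum_expand h (fun a i => A⁻¹ i (m a))]
    refine Finset.sum_congr rfl fun i _ => ?_
    rw [← volAppend_map h f A hf]
    rfl
  have hL : ∀ i : Fin r → Fin d, (θ.compContinuousLinearMap f)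
      (fun a => rowVec (A.transpose * G * A)⁻¹ (i a)) =
      ∑ m : Fin r → Fin d, (∏ a, A⁻¹ (i a) (m a)) • θ fun a => rowVec G⁻¹ (m a) := by
    intro i
    rw [ContinuousAlternatingMap.compContinuousLinearMap_apply, ← alternating_sum_expand]
    congr 1
    funext a
    exact hrow (i a)
  simp only [hR, hL, Finset.smul_sum, Finset.sum_smul]
  rw [Finset.sum_comm]
  refine Finset.sum_congr rfl fun m _ => Finset.sum_congr rfl fun i _ => ?_
  simp only [smul_smul]
  congr 1
  -- Orientation enters here: the square root yields `|det A|`, whereas carrying `f` through the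
  -- volume form yielded `det A`.
  have : Real.sqrt |(A.transpose * G * A).det| = Real.sqrt |G.det| * A.det := by
    rw [Matrix.det_mul, Matrix.det_mul, Matrix.det_transpose,
      show A.det * G.det * A.det = G.det * (A.det * A.det) by ring, abs_mul,
      Real.sqrt_mul (abs_nonneg _), abs_mul_self, Real.sqrt_mul_self hA.le]
  rw [this]
  ring

theorem leviCivita_mul_self {f : Fin d → Fin d} (hf : Function.Injective f) :
    leviCivita f * leviCivita f = 1 := by
  obtain ⟨π, rfl⟩ : ∃ π : Equiv.Perm (Fin d), ⇑π = f :=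
    ⟨Equiv.ofBijective f (Finite.injective_iff_bijective.1 hf), rfl⟩
  have : leviCivita π = ((Equiv.Perm.sign π : ℤ) : ℝ) := by
    have h := Matrix.det_permute π (1 : Matrix (Fin d) (Fin d) ℝ)
    rw [Matrix.det_one, mul_one] at h
    rw [← h, leviCivita]
    congr 1
  rw [this]
  rcases Int.units_eq_one_or (Equiv.Perm.sign π) with h | h <;> simp [h]

theorem leviCivita_eq_zero {f : Fin d → Fin d} (hf : ¬ Function.Injective f) :
    leviCivita f = 0 := by
  simp only [Function.Injective, not_forall] at hf
  obtain ⟨i, j, hij, hne⟩ := hf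
  refine Matrix.det_zero_of_row_eq hne ?_
  funext b
  simp [hij]

theorem exists_complement {r s : ℕ} (h : r + s = d) {l : Fin r → Fin d}
    (hl : Function.Injective l) :
    ∃ k : Fin s → Fin d, Function.Injective (appendIndex h l k) := by
  classical
  have hc : Fintype.card {x : Fin d // x ∉ Set.range l} = s := by
    have h1 := Fintype.card_subtype_compl fun x => x ∈ Set.range l
    have h2 : Fintype.card {x // x ∈ Set.range l} = r := by
      rw [Set.card_range_of_injective hl, Fintype.card_fin]
    rw [h2, Fintype.card_fin] at h1
    omega
  let E := (Fintype.equivFinOfCardEq hc).symm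
  refine ⟨fun b => (E b).1, ?_⟩
  subst h
  change Function.Injective (Fin.append l fun b => (E b).1)
  rw [Fin.append_injective_iff]
  refine ⟨hl, fun a b hab => E.injective (Subtype.ext hab), ?_⟩
  rintro i j hij
  exact (E j).2 ⟨i, hij⟩

theorem appendIndex_injective_iff {X : Type*} {p q r : ℕ} (h : p + q = r) {J : Fin p → X}
    {K : Fin q → X} : Function.Injective (appendIndex h J K) ↔
      Function.Injective J ∧ Function.Injective K ∧ ∀ i j, J i ≠ K j := by
  subst h
  exact Fin.append_injective_iff

/-- The Hodge star of a diagonal metric on complementary basis multivectors. -/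
theorem hodgeCoord_diagonal_apply {r s : ℕ} (h : r + s = d) (η : Fin d → ℝ)
    (hη : ∀ i, η i = 1 ∨ η i = -1) (θ : Model d [⋀^Fin r]→L[ℝ] V) (i : Fin r → Fin d)
    (k : Fin s → Fin d) (hik : Function.Injective (appendIndex h i k)) :
    hodgeCoord h (Matrix.diagonal η) θ (fun b => stdVec (k b)) =
      (leviCivita (appendIndex h i k) * ∏ a, η (i a)) • θ fun a => stdVec (i a) := by
  classical
  have hdet : Real.sqrt |(Matrix.diagonal η).det| = 1 := by
    rw [Matrix.det_diagonal, Finset.abs_prod, Finset.prod_eq_one, Real.sqrt_one]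
    intro i _
    rcases hη i with h | h <;> simp [h]
  have hinv : (Matrix.diagonal η)⁻¹ = Matrix.diagonal η := by
    refine Matrix.inv_eq_left_inv ?_
    rw [Matrix.diagonal_mul_diagonal, ← Matrix.diagonal_one]
    congr 1
    funext i
    rcases hη i with h | h <;> simp [h]
  have hrow : ∀ m, rowVec (Matrix.diagonal η) m = η m • stdVec m := by
    intro m
    rw [rowVec, Finset.sum_eq_single m]
    · simp
    · intro b _ hb; simp [Matrix.diagonal_apply_ne _ hb.symm]
    · simp
  have hθ : ∀ m : Fin r → Fin d, (θ fun a => η (m a) • stdVec (m a)) =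
      (∏ a, η (m a)) • θ fun a => stdVec (m a) := fun m =>
    θ.toMultilinearMap.map_smul_univ (fun a => η (m a)) fun a => stdVec (m a)
  rw [hodgeCoord_apply, hdet, hinv]
  simp only [volAppend_stdVec, hrow, hθ, smul_smul]
  obtain ⟨hi, hk, hdis⟩ := (appendIndex_injective_iff h).1 hik
  have hinj : Function.Injective fun ρ : Equiv.Perm (Fin r) => i ∘ ρ := by
    intro ρ ρ' hρ
    ext a
    exact congrArg Fin.val (hi (congrFun hρ a))
  -- The symbol vanishes unless the indices `m` fill the complement of the range of `k`, that is,
  -- unless `m` is a reordering of `i`.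
  have hsum : ∑ m : Fin r → Fin d, (leviCivita (appendIndex h m k) * ∏ a, η (m a)) •
      (θ fun a => stdVec (m a)) = ∑ ρ : Equiv.Perm (Fin r),
        (leviCivita (appendIndex h (i ∘ ρ) k) * ∏ a, η ((i ∘ ρ) a)) •
          (θ fun a => stdVec ((i ∘ ρ) a)) := by
    rw [← Finset.sum_image (s := Finset.univ) (g := fun ρ : Equiv.Perm (Fin r) => i ∘ ρ)
      (f := fun m : Fin r → Fin d => (leviCivita (appendIndex h m k) * ∏ a, η (m a)) •
      (θ fun a => stdVec (m a))) hinj.injOn]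
    symm
    refine Finset.sum_subset (Finset.subset_univ _) fun m _ hm => ?_
    by_cases hmk : Function.Injective (appendIndex h m k)
    · exfalso
      apply hm
      obtain ⟨hm1, -, hm2⟩ := (appendIndex_injective_iff h).1 hmk
      have hsurj : ∀ x, (∃ a, i a = x) ∨ ∃ b, k b = x := by
        intro x
        obtain ⟨a, rfl⟩ := (Finite.injective_iff_surjective.1 hik) x
        rcases exists_index h a with ⟨c, rfl⟩ | ⟨c, rfl⟩
        · exact Or.inl ⟨c, by simp [appendIndex]⟩
        · exact Or.inr ⟨c, by simp [appendIndex]⟩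
      have hex : ∀ a, ∃ c, i c = m a := by
        intro a
        rcases hsurj (m a) with h | ⟨b, hb⟩
        · exact h
        · exact absurd hb.symm (hm2 a b)
      choose ρ hρ using hex
      have hρi : Function.Injective ρ := fun a b hab => hm1 (by rw [← hρ, ← hρ, hab])
      refine Finset.mem_image.2
        ⟨Equiv.ofBijective ρ (Finite.injective_iff_bijective.1 hρi), Finset.mem_univ _, ?_⟩
      funext a
      exact hρ a
    · rw [leviCivita_eq_zero hmk, zero_mul, zero_smul]
  -- The sign of the reordering occurs once in `θ` and once in the Levi-Civita symbol, so all `r!`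
  -- terms agree and absorb the factor `1/r!`.
  have hterm : ∀ ρ : Equiv.Perm (Fin r),
      (leviCivita (appendIndex h (i ∘ ρ) k) * ∏ a, η ((i ∘ ρ) a)) •
          (θ fun a => stdVec ((i ∘ ρ) a)) =
        (leviCivita (appendIndex h i k) * ∏ a, η (i a)) • θ fun a => stdVec (i a) := by
    intro ρ
    have h1 : (θ fun a => stdVec ((i ∘ ρ) a)) =
        ((Equiv.Perm.sign ρ : ℤ) : ℝ) • θ fun a => stdVec (i a) := by
      rw [Int.cast_smul_eq_zsmul]
      exact θ.toAlternatingMap.map_perm (fun a => stdVec (i a)) ρ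
    have h2 : leviCivita (appendIndex h (i ∘ ρ) k) =
        ((Equiv.Perm.sign ρ : ℤ) : ℝ) * leviCivita (appendIndex h i k) := by
      have h' : s + r = d := by omega
      rw [leviCivita_swap h' h, leviCivita_swap h' h k i, ← volAppend_stdVec, ← volAppend_stdVec]
      have h3 := (volAppend h' fun b => stdVec (k b)).toAlternatingMap.map_perm
        (fun a => stdVec (i a)) ρ
      have h4 : (volAppend h' (fun b => stdVec (k b))) (fun a => stdVec ((i ∘ ρ) a)) =
        ((Equiv.Perm.sign ρ : ℤ) : ℝ) • volAppend h' (fun b => stdVec (k b))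
          (fun a => stdVec (i a)) := by
        rw [Int.cast_smul_eq_zsmul]; exact h3
      rw [h4, smul_eq_mul]
      ring
    have h3 : ∏ a, η ((i ∘ ρ) a) = ∏ a, η (i a) := Equiv.prod_comp ρ fun a => η (i a)
    rw [h1, h2, h3, smul_smul]
    congr 1
    rcases Int.units_eq_one_or (Equiv.Perm.sign ρ) with h | h <;> simp [h]
  rw [hsum, Finset.sum_congr rfl fun ρ _ => hterm ρ, Finset.sum_const, Finset.card_univ,
    Fintype.card_perm, Fintype.card_fin, ← Nat.cast_smul_eq_nsmul ℝ, smul_smul, one_div,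
    inv_mul_cancel₀ (by positivity), one_smul]

theorem alternating_apply_stdVec_eq_zero {k : ℕ} (θ : Model d [⋀^Fin k]→L[ℝ] V)
    {J : Fin k → Fin d} (hJ : ¬ Function.Injective J) : (θ fun a => stdVec (J a)) = 0 := by
  simp only [Function.Injective, not_forall] at hJ
  obtain ⟨i, j, hij, hne⟩ := hJ
  exact θ.map_eq_zero_of_eq _ (congrArg stdVec hij) hne

/-- Evaluated on a block `l` with complementary block `k`, the two Levi-Civita symbols differ by the
block swap sign `(-1)^(rs)`, and the metric signs over `l` and over `k` multiply to the full
product. -/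
theorem hodgeCoord_hodgeCoord_diagonal {r s : ℕ} (h : r + s = d) (h' : s + r = d)
    (η : Fin d → ℝ) (hη : ∀ i, η i = 1 ∨ η i = -1) (θ : Model d [⋀^Fin r]→L[ℝ] V) :
    hodgeCoord h' (Matrix.diagonal η) (hodgeCoord h (Matrix.diagonal η) θ) =
      ((-1 : ℝ) ^ (r * s) * ∏ i, η i) • θ := by
  refine alternating_ext_stdVec fun l => ?_
  by_cases hl : Function.Injective l
  swap
  · rw [alternating_apply_stdVec_eq_zero _ hl, alternating_apply_stdVec_eq_zero _ hl]
  obtain ⟨k, hk⟩ := exists_complement h hl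
  have hk' : Function.Injective (appendIndex h' k l) := by
    rw [appendIndex_swap h h']
    exact hk.comp (Equiv.injective _)
  rw [hodgeCoord_diagonal_apply h' η hη _ k l hk', hodgeCoord_diagonal_apply h η hη _ l k hk,
    smul_smul, ContinuousAlternatingMap.smul_apply, leviCivita_swap h h']
  congr 1
  have hprod : ∏ i, η i = (∏ a, η (l a)) * ∏ b, η (k b) := by
    rw [← Equiv.prod_comp (Equiv.ofBijective _ (Finite.injective_iff_bijective.1 hk))]
    subst h
    rw [Fin.prod_univ_add]
    simp [appendIndex]
  rw [hprod]
  linear_combination ((-1 : ℝ) ^ (r * s) * (∏ a, η (l a)) * ∏ b, η (k b)) * leviCivita_mul_self hk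

/-- The symmetry holds term by term: in each summand the star evaluates its argument on the very
block on which the other form is evaluated, up to a coefficient that depends only on the indices. -/
theorem wedgeAt_hodgeCoord_diagonal_symm {r s : ℕ} (h : r + s = d) (η : Fin d → ℝ)
    (hη : ∀ i, η i = 1 ∨ η i = -1) (b : V →L[ℝ] V →L[ℝ] U) (hb : ∀ v w, b v w = b w v)
    (α β : Model d [⋀^Fin r]→L[ℝ] V) :
    wedgeAt h b α (hodgeCoord h (Matrix.diagonal η) β) =
      wedgeAt h b β (hodgeCoord h (Matrix.diagonal η) α) := by
  refine alternating_ext_stdVec fun J => ?_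
  by_cases hJ : Function.Injective J
  swap
  · rw [alternating_apply_stdVec_eq_zero _ hJ, alternating_apply_stdVec_eq_zero _ hJ]
  rw [wedgeAt_apply, wedgeAt_apply]
  congr 1
  refine Finset.sum_congr rfl fun τ _ => ?_
  have hinj : Function.Injective (appendIndex h
      (fun i => J (τ (Fin.cast h (Fin.castAdd s i))))
      (fun j => J (τ (Fin.cast h (Fin.natAdd r j))))) := by
    have : appendIndex h (fun i => J (τ (Fin.cast h (Fin.castAdd s i))))
      (fun j => J (τ (Fin.cast h (Fin.natAdd r j)))) = J ∘ τ := by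
      funext a
      rcases exists_index h a with ⟨c, rfl⟩ | ⟨c, rfl⟩ <;> simp [appendIndex]
    rw [this]
    exact hJ.comp τ.injective
  rw [hodgeCoord_diagonal_apply h η hη β _ _ hinj, hodgeCoord_diagonal_apply h η hη α _ _ hinj,
    map_smul, map_smul, hb]

/-- `G` is the Gram matrix of a scalar product with orthonormal frame of signs `η`. -/
def HasSigns (G : Matrix (Fin d) (Fin d) ℝ) (η : Fin d → ℝ) : Prop :=
  (∀ i, η i = 1 ∨ η i = -1) ∧ ∃ A : Matrix (Fin d) (Fin d) ℝ, A.det ≠ 0 ∧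
    A.transpose * G * A = Matrix.diagonal η

/-- Reversing one vector of an orthonormal frame changes the sign of the determinant but not the
Gram matrix, so the frame can be taken positively oriented, as `hodgeCoord_pullback` demands. -/
theorem HasSigns.exists_pos {G : Matrix (Fin d) (Fin d) ℝ} {η : Fin d → ℝ} (hG : HasSigns G η)
    (hd : 0 < d) : ∃ A : Matrix (Fin d) (Fin d) ℝ, 0 < A.det ∧
      A.transpose * G * A = Matrix.diagonal η := by
  obtain ⟨-, A, hA, hAG⟩ := hG
  rcases lt_or_gt_of_ne hA with hneg | hpos
  swap
  · exact ⟨A, hpos, hAG⟩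
  let δ : Fin d → ℝ := fun i => if i = ⟨0, hd⟩ then -1 else 1
  refine ⟨A * Matrix.diagonal δ, ?_, ?_⟩
  · rw [Matrix.det_mul, Matrix.det_diagonal]
    simp only [δ, Finset.prod_ite_eq', Finset.mem_univ, if_true]
    linarith
  · rw [Matrix.transpose_mul, Matrix.diagonal_transpose,
      show Matrix.diagonal δ * A.transpose * G * (A * Matrix.diagonal δ) =
        Matrix.diagonal δ * (A.transpose * G * A) * Matrix.diagonal δ by
        simp only [Matrix.mul_assoc], hAG, Matrix.diagonal_mul_diagonal,
      Matrix.diagonal_mul_diagonal]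
    congr 1
    funext i
    simp only [δ]
    split_ifs <;> ring

theorem exists_equiv_of_matrix (A : Matrix (Fin d) (Fin d) ℝ) (hA : A.det ≠ 0) :
    ∃ f : Model d →L[ℝ] Model d, Function.Surjective f ∧ ∀ i j, f (stdVec j) i = A i j := by
  refine ⟨LinearMap.toContinuousLinearMap (Matrix.toEuclideanLin A), ?_, ?_⟩
  · intro y
    refine ⟨Matrix.toEuclideanLin A⁻¹ y, ?_⟩
    have : A * A⁻¹ = 1 := Matrix.mul_nonsing_inv _ (isUnit_iff_ne_zero.2 hA)
    ext i
    simp [Matrix.toLpLin_apply, Matrix.mulVec_mulVec, this]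
  · intro i j
    simp [Matrix.toLpLin_apply]

theorem compContinuousLinearMap_injective {k : ℕ} {f : Model d →L[ℝ] Model d}
    (hf : Function.Surjective f) {θ η : Model d [⋀^Fin k]→L[ℝ] V}
    (h : θ.compContinuousLinearMap f = η.compContinuousLinearMap f) : θ = η := by
  ext v
  choose w hw using fun a => hf (v a)
  have := DFunLike.congr_fun h w
  simpa [Function.comp_def, hw] using this

/-- Pulling back along a positively oriented orthonormal frame is injective and commutes with the
star, so the diagonal case suffices. The same reduction gives the symmetry below. -/
theorem hodgeCoord_hodgeCoord {r s : ℕ} (h : r + s = d) (h' : s + r = d) (hd : 0 < d)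
    {G : Matrix (Fin d) (Fin d) ℝ} {η : Fin d → ℝ} (hG : HasSigns G η)
    (θ : Model d [⋀^Fin r]→L[ℝ] V) :
    hodgeCoord h' G (hodgeCoord h G θ) = ((-1 : ℝ) ^ (r * s) * ∏ i, η i) • θ := by
  obtain ⟨A, hA, hAG⟩ := hG.exists_pos hd
  obtain ⟨f, hf, hfA⟩ := exists_equiv_of_matrix A hA.ne'
  apply compContinuousLinearMap_injective hf
  rw [← hodgeCoord_pullback h' G A hA f hfA, ← hodgeCoord_pullback h G A hA f hfA, hAG,
    hodgeCoord_hodgeCoord_diagonal h h' η hG.1]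
  rfl

theorem wedgeAt_hodgeCoord_symm {r s : ℕ} (h : r + s = d) (hd : 0 < d)
    {G : Matrix (Fin d) (Fin d) ℝ} {η : Fin d → ℝ} (hG : HasSigns G η)
    (b : V →L[ℝ] V →L[ℝ] U) (hb : ∀ v w, b v w = b w v) (α β : Model d [⋀^Fin r]→L[ℝ] V) :
    wedgeAt h b α (hodgeCoord h G β) = wedgeAt h b β (hodgeCoord h G α) := by
  obtain ⟨A, hA, hAG⟩ := hG.exists_pos hd
  obtain ⟨f, hf, hfA⟩ := exists_equiv_of_matrix A hA.ne'
  apply compContinuousLinearMap_injective hf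
  rw [wedgeAt_compContinuousLinearMap, wedgeAt_compContinuousLinearMap,
    ← hodgeCoord_pullback h G A hA f hfA, ← hodgeCoord_pullback h G A hA f hfA, hAG,
    wedgeAt_hodgeCoord_diagonal_symm h η hG.1 b hb]

end HodgeStar

/-! ### Transition maps and coordinate changes of forms and metrics -/

section Charts

variable {d : ℕ} {M : Type*} [TopologicalSpace M] [ChartedSpace (Model d) M]
  {V W U : Type*} [NormedAddCommGroup V] [NormedSpace ℝ V] [NormedAddCommGroup W]
  [NormedSpace ℝ W] [NormedAddCommGroup U] [NormedSpace ℝ U]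

/-- The transition map from the chart around `a` to the chart around `b`. -/
def transition (a b : M) : Model d → Model d :=
  fun y => extChartAt (𝓡 d) b ((extChartAt (𝓡 d) a).symm y)

/-- The domain of the transition map from the chart around `a` to the chart around `b`. -/
def overlap (a b : M) : Set (Model d) :=
  {y | y ∈ (extChartAt (𝓡 d) a).target ∧
    (extChartAt (𝓡 d) a).symm y ∈ (extChartAt (𝓡 d) b).source}

theorem overlap_eq (a b : M) : overlap (d := d) a b =
    ((chartAt (Model d) a).symm.trans (chartAt (Model d) b)).source := by
  ext y
  simp [overlap]

theorem isOpen_overlap (a b : M) : IsOpen (overlap (d := d) a b) := by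
  rw [overlap_eq]
  exact OpenPartialHomeomorph.open_source _

theorem transition_eq (a b : M) : transition (d := d) a b =
    ((chartAt (Model d) a).symm.trans (chartAt (Model d) b)) := by
  ext y
  simp [transition]

theorem contDiffOn_transition [IsManifold (𝓡 d) ∞ M] (a b : M) :
    ContDiffOn ℝ ∞ (transition (d := d) a b) (overlap a b) := by
  have := contDiffOn_ext_coord_change (I := 𝓡 d) (n := ∞) b a
  refine this.mono ?_
  intro y hy
  rw [PartialEquiv.trans_source]
  exact hy

theorem contDiffAt_transition [IsManifold (𝓡 d) ∞ M] {a b : M} {y : Model d}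
    (hy : y ∈ overlap a b) : ContDiffAt ℝ ∞ (transition (d := d) a b) y :=
  (contDiffOn_transition a b).contDiffAt ((isOpen_overlap a b).mem_nhds hy)

theorem transition_mem_overlap {a b : M} {y : Model d} (hy : y ∈ overlap a b) :
    transition a b y ∈ overlap (d := d) b a := by
  refine ⟨(extChartAt (𝓡 d) b).map_source hy.2, ?_⟩
  rw [transition, (extChartAt (𝓡 d) b).left_inv hy.2]
  exact (extChartAt (𝓡 d) a).map_target hy.1

theorem symm_transition {a b : M} {y : Model d} (hy : y ∈ overlap a b) :
    (extChartAt (𝓡 d) b).symm (transition a b y) = (extChartAt (𝓡 d) a).symm y :=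
  (extChartAt (𝓡 d) b).left_inv hy.2

theorem transition_transition {a b c : M} {y : Model d} (hy : y ∈ overlap a b) :
    transition b c (transition a b y) = transition a c y := by
  rw [transition, symm_transition hy]; rfl

theorem transition_self {a : M} {y : Model d} (hy : y ∈ (extChartAt (𝓡 d) a).target) :
    transition a a y = y := (extChartAt (𝓡 d) a).right_inv hy

theorem mem_overlap_symm {a : M} {y : Model d} (hy : y ∈ (extChartAt (𝓡 d) a).target) :
    y ∈ overlap (d := d) a ((extChartAt (𝓡 d) a).symm y) :=
  ⟨hy, mem_extChartAt_source _⟩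

theorem fderiv_transition_comp [IsManifold (𝓡 d) ∞ M] {a b c : M} {y : Model d}
    (hy : y ∈ overlap a b) (hyc : y ∈ overlap a c) :
    fderiv ℝ (transition a c) y =
      (fderiv ℝ (transition b c) (transition a b y)).comp (fderiv ℝ (transition a b) y) := by
  have hbc : transition a b y ∈ overlap (d := d) b c :=
    ⟨(extChartAt (𝓡 d) b).map_source hy.2, by rw [symm_transition hy]; exact hyc.2⟩
  rw [← fderiv_comp _ ((contDiffAt_transition hbc).differentiableAt (by simp))
    ((contDiffAt_transition hy).differentiableAt (by simp))]
  refine Filter.EventuallyEq.fderiv_eq ?_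
  filter_upwards [(isOpen_overlap a b).mem_nhds hy] with z hz
  exact (transition_transition hz).symm

theorem fderiv_transition_self {a : M} {y : Model d} (hy : y ∈ (extChartAt (𝓡 d) a).target) :
    fderiv ℝ (transition a a) y = ContinuousLinearMap.id ℝ (Model d) := by
  have : transition a a =ᶠ[nhds y] id := by
    filter_upwards [(isOpen_extChartAt_target a).mem_nhds hy] with z hz
    exact transition_self hz
  rw [this.fderiv_eq, fderiv_id]

/-- The value of a form at a point, on the model space. -/
def DForm.value {k : ℕ} (θ : DForm d M k V) (x : M) : Model d [⋀^Fin k]→L[ℝ] V := θ x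

/-- A field of bilinear forms at a point, on the model space. -/
def bilinValue (g : (x : M) → LinearMap.BilinForm ℝ (TangentSpace (𝓡 d) x)) (x : M) :
    LinearMap.BilinForm ℝ (Model d) := g x

/-- The tangent space at `p` is by construction `ℝ^d`, read in the preferred chart at `p`. A
coordinate frame is therefore the Jacobian of the transition to that chart, and every comparison of
charts becomes the chain rule for transition maps. -/
theorem chartFrame_eq [IsManifold (𝓡 d) ∞ M] {a : M} {y : Model d}
    (hy : y ∈ (extChartAt (𝓡 d) a).target) :
    (chartFrame a y : Model d →L[ℝ] Model d) =
      fderiv ℝ (transition a ((extChartAt (𝓡 d) a).symm y)) y := by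
  have hmd : MDifferentiableAt 𝓘(ℝ, Model d) (𝓡 d) (extChartAt (𝓡 d) a).symm y := by
    have := (contMDiffOn_extChartAt_symm (I := 𝓡 d) (n := ∞) a).contMDiffAt
      ((isOpen_extChartAt_target a).mem_nhds hy)
    exact this.mdifferentiableAt (by simp)
  have h : mfderiv 𝓘(ℝ, Model d) (𝓡 d) (extChartAt (𝓡 d) a).symm y =
      fderivWithin ℝ (transition a ((extChartAt (𝓡 d) a).symm y)) Set.univ y := by
    unfold mfderiv
    exact (if_pos hmd).trans (by simp only [ModelWithCorners.range_eq_univ]; rfl)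
  rw [fderivWithin_univ] at h
  exact h

/-- In its own preferred chart the point sees the identity transition, so the pullbacks in the
definitions of `extd` and `hodge` do nothing. -/
theorem chartDiff_eq [IsManifold (𝓡 d) ∞ M] (x : M) : (chartDiff x : Model d →L[ℝ] Model d) =
    ContinuousLinearMap.id ℝ (Model d) := by
  have hmd : MDifferentiableAt (𝓡 d) 𝓘(ℝ, Model d) (extChartAt (𝓡 d) x) x :=
    (contMDiffAt_extChartAt (I := 𝓡 d) (n := ∞) (x := x)).mdifferentiableAt (by simp)
  have h : mfderiv (𝓡 d) 𝓘(ℝ, Model d) (extChartAt (𝓡 d) x) x =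
      fderivWithin ℝ (transition x x) Set.univ (extChartAt (𝓡 d) x x) := by
    unfold mfderiv
    exact (if_pos hmd).trans (by simp only [ModelWithCorners.range_eq_univ]; rfl)
  rw [fderivWithin_univ, fderiv_transition_self (mem_extChartAt_target x)] at h
  exact h

theorem inChart_eq [IsManifold (𝓡 d) ∞ M] {k : ℕ} (θ : DForm d M k V) {a p : M} {y : Model d}
    (hy : y ∈ (extChartAt (𝓡 d) a).target) (hp : (extChartAt (𝓡 d) a).symm y = p) :
    θ.inChart a y = (θ.value p).compContinuousLinearMap
      (fderiv ℝ (transition a p) y) := by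
  subst hp
  rw [← chartFrame_eq hy]
  rfl

theorem inChart_self [IsManifold (𝓡 d) ∞ M] {k : ℕ} (θ : DForm d M k V) (x : M) :
    θ.inChart x (extChartAt (𝓡 d) x x) = θ.value x := by
  rw [inChart_eq θ (mem_extChartAt_target x) (extChartAt_to_inv x),
    fderiv_transition_self (mem_extChartAt_target x)]
  rfl

theorem inChart_transition [IsManifold (𝓡 d) ∞ M] {k : ℕ} (θ : DForm d M k V) {a b : M}
    {y : Model d} (hy : y ∈ overlap a b) :
    θ.inChart a y = (θ.inChart b (transition a b y)).compContinuousLinearMap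
      (fderiv ℝ (transition a b) y) := by
  rw [inChart_eq θ hy.1 rfl, inChart_eq θ (transition_mem_overlap hy).1 (symm_transition hy),
    fderiv_transition_comp hy (mem_overlap_symm hy.1)]
  rfl

/-- The Jacobian matrix of a linear endomorphism of `ℝ^d`. -/
def stdMatrix (f : Model d →L[ℝ] Model d) : Matrix (Fin d) (Fin d) ℝ :=
  Matrix.of fun i j => f (stdVec j) i

theorem det_stdMatrix (f : Model d →L[ℝ] Model d) : (stdMatrix f).det = f.det := by
  rw [ContinuousLinearMap.det, ← LinearMap.det_toMatrix (EuclideanSpace.basisFun (Fin d) ℝ).toBasis]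
  congr 1

theorem gramInChart_eq [IsManifold (𝓡 d) ∞ M]
    (g : (x : M) → LinearMap.BilinForm ℝ (TangentSpace (𝓡 d) x)) {a p : M} {y : Model d}
    (hy : y ∈ (extChartAt (𝓡 d) a).target) (hp : (extChartAt (𝓡 d) a).symm y = p) :
    gramInChart g a y = Matrix.of fun i j =>
      bilinValue g p (fderiv ℝ (transition a p) y (stdVec i))
        (fderiv ℝ (transition a p) y (stdVec j)) := by
  subst hp
  rw [← chartFrame_eq hy]
  rfl

theorem bilin_stdMatrix (B : LinearMap.BilinForm ℝ (Model d)) (f : Model d →L[ℝ] Model d) :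
    (Matrix.of fun i j => B (f (stdVec i)) (f (stdVec j))) =
      (stdMatrix f).transpose * (Matrix.of fun i j => B (stdVec i) (stdVec j)) * stdMatrix f := by
  have hfs : ∀ j, f (stdVec j) = ∑ i, f (stdVec j) i • stdVec i := by
    intro j; ext i; simp [Finset.sum_apply, Pi.single_apply]
  ext i j
  rw [Matrix.of_apply, hfs i, hfs j]
  simp only [map_sum, map_smul, LinearMap.sum_apply, LinearMap.smul_apply, smul_eq_mul,
    Matrix.mul_apply, Matrix.transpose_apply, Matrix.of_apply, stdMatrix, Finset.sum_mul,
    Finset.mul_sum]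
  refine Finset.sum_congr rfl fun k _ => Finset.sum_congr rfl fun l _ => ?_
  ring

theorem gramInChart_self [IsManifold (𝓡 d) ∞ M]
    (g : (x : M) → LinearMap.BilinForm ℝ (TangentSpace (𝓡 d) x)) (x : M) :
    gramInChart g x (extChartAt (𝓡 d) x x) = Matrix.of fun i j =>
      bilinValue g x (stdVec i) (stdVec j) := by
  rw [gramInChart_eq g (mem_extChartAt_target x) (extChartAt_to_inv x),
    fderiv_transition_self (mem_extChartAt_target x)]
  rfl

/-- Changing charts acts on the Gram matrix by congruence with the Jacobian, which is the shape
needed for `hodgeCoord_pullback`. -/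
theorem gramInChart_symm [IsManifold (𝓡 d) ∞ M]
    (g : (x : M) → LinearMap.BilinForm ℝ (TangentSpace (𝓡 d) x)) {a p : M} {y : Model d}
    (hy : y ∈ (extChartAt (𝓡 d) a).target) (hp : (extChartAt (𝓡 d) a).symm y = p) :
    gramInChart g a y = (stdMatrix (fderiv ℝ (transition a p) y)).transpose *
      gramInChart g p (extChartAt (𝓡 d) p p) * stdMatrix (fderiv ℝ (transition a p) y) := by
  rw [gramInChart_eq g hy hp, gramInChart_self, bilin_stdMatrix]

theorem det_transition_pos (hM : IsOrientedAtlas d M) {a b : M} {y : Model d}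
    (hy : y ∈ overlap a b) : 0 < (fderiv ℝ (transition a b) y).det := by
  rw [transition_eq]
  exact hM _ (chart_mem_atlas _ a) _ (chart_mem_atlas _ b) y (by rwa [← overlap_eq])

/-- The signs `(σ, 1, …, 1)`. -/
def signatureSigns (d : ℕ) (σ : ℝ) (i : Fin d) : ℝ := if i.val = 0 then σ else 1

theorem prod_signatureSigns {d : ℕ} (hd : 0 < d) (σ : ℝ) : ∏ i, signatureSigns d σ i = σ := by
  obtain ⟨m, rfl⟩ := Nat.exists_eq_succ_of_ne_zero hd.ne'
  rw [Fin.prod_univ_succ]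
  simp [signatureSigns]

/-- The required matrix has the vectors of the basis supplied by `signature` as its columns. -/
theorem MetricTensor.hasSigns [IsManifold (𝓡 d) ∞ M] {σ : ℝ} (hσ : σ = 1 ∨ σ = -1)
    (g : MetricTensor d M σ) (x : M) :
    HasSigns (gramInChart g.val x (extChartAt (𝓡 d) x x)) (signatureSigns d σ) := by
  refine ⟨fun i => by unfold signatureSigns; split_ifs <;> simp [hσ], ?_⟩
  obtain ⟨b, hb⟩ := g.signature x
  let b' : Module.Basis (Fin d) ℝ (Model d) := b
  let f : Model d →L[ℝ] Model d := LinearMap.toContinuousLinearMap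
    ((EuclideanSpace.basisFun (Fin d) ℝ).toBasis.constr ℝ b')
  have hf : ∀ i, f (stdVec i) = b' i := by
    intro i
    have := (EuclideanSpace.basisFun (Fin d) ℝ).toBasis.constr_basis ℝ b' i
    rwa [OrthonormalBasis.coe_toBasis, EuclideanSpace.basisFun_apply] at this
  refine ⟨stdMatrix f, ?_, ?_⟩
  · rw [det_stdMatrix]
    have : LinearMap.det ((EuclideanSpace.basisFun (Fin d) ℝ).toBasis.constr ℝ b') ≠ 0 := by
      have h2 : ((EuclideanSpace.basisFun (Fin d) ℝ).toBasis.constr ℝ b') =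
          ((EuclideanSpace.basisFun (Fin d) ℝ).toBasis.equiv b' (Equiv.refl _)).toLinearMap := by
        apply (EuclideanSpace.basisFun (Fin d) ℝ).toBasis.ext
        intro i
        rw [Module.Basis.constr_basis]
        exact (Module.Basis.equiv_apply _ i _ (Equiv.refl _)).symm
      rw [h2]
      exact (LinearEquiv.isUnit_det' _).ne_zero
    exact this
  · rw [gramInChart_self, ← bilin_stdMatrix]
    ext i j
    rw [Matrix.of_apply, hf, hf, Matrix.diagonal_apply]
    exact hb i j

end Charts

/-! ### Calculus of differential forms on the manifold -/

section FormCalculus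

variable {d : ℕ} {M : Type*} [TopologicalSpace M] [ChartedSpace (Model d) M]
  {V W U : Type*} [NormedAddCommGroup V] [NormedSpace ℝ V] [NormedAddCommGroup W]
  [NormedSpace ℝ W] [NormedAddCommGroup U] [NormedSpace ℝ U]

namespace DForm

variable {k p q r s t u : ℕ}

/-! #### Coordinate expressions -/

theorem inChart_wedge [FiniteDimensional ℝ V] [FiniteDimensional ℝ W] (b : V →ₗ[ℝ] W →ₗ[ℝ] U)
    (θ : DForm d M p V) (η : DForm d M q W) (h : p + q = r) (a : M) (y : Model d) :
    (wedge b θ η h).inChart a y =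
      wedgeAt h b.toContinuousBilinearMap (θ.inChart a y) (η.inChart a y) :=
  wedgeAt_compContinuousLinearMap _ _ _ _ _

theorem value_wedge [FiniteDimensional ℝ V] [FiniteDimensional ℝ W] (b : V →ₗ[ℝ] W →ₗ[ℝ] U)
    (θ : DForm d M p V) (η : DForm d M q W) (h : p + q = r) (x : M) :
    (wedge b θ η h).value x = wedgeAt h b.toContinuousBilinearMap (θ.value x) (η.value x) := rfl

theorem ext_value {θ η : DForm d M k V} (h : ∀ x, θ.value x = η.value x) : θ = η := funext h

theorem value_extd [IsManifold (𝓡 d) ∞ M] (θ : DForm d M k V) (x : M) :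
    θ.extd.value x = extDeriv (θ.inChart x) (extChartAt (𝓡 d) x x) := by
  have h : θ.extd.value x = (extDeriv (θ.inChart x)
    (extChartAt (𝓡 d) x x)).compContinuousLinearMap (chartDiff x : Model d →L[ℝ] Model d) := rfl
  rw [h, chartDiff_eq]
  rfl

theorem value_hodge [IsManifold (𝓡 d) ∞ M] {σ : ℝ} (g : MetricTensor d M σ) (θ : DForm d M r V)
    (h : r + s = d) (x : M) : (θ.hodge g h).value x =
      hodgeCoord h (gramInChart g.val x (extChartAt (𝓡 d) x x)) (θ.value x) := by
  have h' : (θ.hodge g h).value x = (hodgeCoord h (gramInChart g.val x (extChartAt (𝓡 d) x x))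
    (θ.inChart x (extChartAt (𝓡 d) x x))).compContinuousLinearMap
      (chartDiff x : Model d →L[ℝ] Model d) := rfl
  rw [h', chartDiff_eq, inChart_self]
  rfl

/-- The definition uses a different chart at every point. Naturality of the exterior derivative
under the smooth transition map replaces it by one formula valid throughout any given chart. -/
theorem inChart_extd [IsManifold (𝓡 d) ∞ M] {θ : DForm d M k V} (hθ : θ.IsSmooth) {a : M}
    {y : Model d} (hy : y ∈ (extChartAt (𝓡 d) a).target) :
    θ.extd.inChart a y = extDeriv (θ.inChart a) y := by
  set p := (extChartAt (𝓡 d) a).symm y with hp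
  have hya : y ∈ overlap (d := d) a p := mem_overlap_symm hy
  have hev : θ.inChart a =ᶠ[nhds y] fun z => (θ.inChart p (transition a p z)).compContinuousLinearMap
      (fderiv ℝ (transition a p) z) := by
    filter_upwards [(isOpen_overlap a p).mem_nhds hya] with z hz
    exact inChart_transition θ hz
  have hty : transition a p y ∈ (extChartAt (𝓡 d) p).target := (transition_mem_overlap hya).1
  have hdiff : DifferentiableAt ℝ (θ.inChart p) (transition a p y) :=
    ((hθ p).contDiffAt ((isOpen_extChartAt_target p).mem_nhds hty)).differentiableAt (by simp)
  rw [hev.extDeriv_eq, extDeriv_pullback hdiff (contDiffAt_transition hya)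
    (by rw [minSmoothness_of_isRCLikeNormedField]; exact ENat.LEInfty.out), inChart_eq _ hy hp.symm,
    value_extd]
  rfl

/-- Positivity of the Jacobians of an oriented atlas is what makes the star independent of the
chart. -/
theorem inChart_hodge [IsManifold (𝓡 d) ∞ M] (hM : IsOrientedAtlas d M) {σ : ℝ}
    (g : MetricTensor d M σ) (θ : DForm d M r V) (h : r + s = d) {a : M}
    {y : Model d} (hy : y ∈ (extChartAt (𝓡 d) a).target) :
    (θ.hodge g h).inChart a y = hodgeCoord h (gramInChart g.val a y) (θ.inChart a y) := by
  rw [inChart_eq _ hy rfl, value_hodge, inChart_eq θ hy rfl, gramInChart_symm g.val hy rfl,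
    hodgeCoord_pullback h _ (stdMatrix _) (by
      rw [det_stdMatrix]; exact det_transition_pos hM (mem_overlap_symm hy)) _
      fun i j => by rw [stdMatrix, Matrix.of_apply]]

/-! #### Smoothness -/

theorem isSmooth_zero : (0 : DForm d M k V).IsSmooth := fun _ => contDiffOn_const (c := 0)

theorem IsSmooth.add {θ η : DForm d M k V} (hθ : θ.IsSmooth) (hη : η.IsSmooth) :
    (θ + η).IsSmooth := fun a => (hθ a).add (hη a)

theorem IsSmooth.smul (c : ℝ) {θ : DForm d M k V} (hθ : θ.IsSmooth) : (c • θ).IsSmooth :=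
  fun a => (hθ a).const_smul c

theorem IsSmooth.neg {θ : DForm d M k V} (hθ : θ.IsSmooth) : (-θ).IsSmooth :=
  fun a => (hθ a).neg

theorem IsSmooth.sub {θ η : DForm d M k V} (hθ : θ.IsSmooth) (hη : η.IsSmooth) :
    (θ - η).IsSmooth := fun a => (hθ a).sub (hη a)

theorem IsSmooth.wedge [FiniteDimensional ℝ V] [FiniteDimensional ℝ W] (b : V →ₗ[ℝ] W →ₗ[ℝ] U)
    {θ : DForm d M p V} {η : DForm d M q W} (hθ : θ.IsSmooth) (hη : η.IsSmooth) (h : p + q = r) :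
    (wedge b θ η h).IsSmooth := by
  intro a
  have : ContDiffOn ℝ ∞ (fun y => wedgeL h b.toContinuousBilinearMap (θ.inChart a y)
      (η.inChart a y)) (extChartAt (𝓡 d) a).target :=
    (contDiffOn_const.clm_apply (hθ a)).clm_apply (hη a)
  exact this.congr fun y _ => inChart_wedge b θ η h a y

theorem IsSmooth.map [FiniteDimensional ℝ V] (f : V →ₗ[ℝ] W) {θ : DForm d M k V}
    (hθ : θ.IsSmooth) : (θ.map f).IsSmooth := by
  intro a
  let F : (Model d [⋀^Fin k]→L[ℝ] V) →ₗ[ℝ] (Model d [⋀^Fin k]→L[ℝ] W) :=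
    { toFun := fun θ => (LinearMap.toContinuousLinearMap f).compContinuousAlternatingMap θ
      map_add' := fun θ η => by ext; simp
      map_smul' := fun c θ => by ext; simp }
  exact (LinearMap.toContinuousLinearMap F).contDiff.comp_contDiffOn (hθ a)

theorem IsSmooth.extd [IsManifold (𝓡 d) ∞ M] {θ : DForm d M k V} (hθ : θ.IsSmooth) :
    θ.extd.IsSmooth := by
  intro a
  have h1 : ContDiffOn ℝ ∞ (fderiv ℝ (θ.inChart a)) (extChartAt (𝓡 d) a).target :=
    (hθ a).fderiv_of_isOpen (isOpen_extChartAt_target a) (by simp)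
  have h2 : ContDiffOn ℝ ∞ (fun y => ContinuousAlternatingMap.alternatizeUncurryFinCLM ℝ (Model d) V
      (fderiv ℝ (θ.inChart a) y)) (extChartAt (𝓡 d) a).target :=
    (ContinuousLinearMap.contDiff _).comp_contDiffOn h1
  exact h2.congr fun y hy => inChart_extd hθ hy

/-- The Gram matrix is congruent, by invertible matrices, to a diagonal matrix of signs.
Non-vanishing is needed both to invert it smoothly and to take a smooth `√|det|`. -/
theorem gramInChart_det_ne_zero [IsManifold (𝓡 d) ∞ M] (hM : IsOrientedAtlas d M) {σ : ℝ}
    (hσ : σ = 1 ∨ σ = -1) (g : MetricTensor d M σ) {a : M} {y : Model d}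
    (hy : y ∈ (extChartAt (𝓡 d) a).target) : (gramInChart g.val a y).det ≠ 0 := by
  rw [gramInChart_symm g.val hy rfl, Matrix.det_mul, Matrix.det_mul, Matrix.det_transpose,
    det_stdMatrix]
  have h1 := (det_transition_pos hM (mem_overlap_symm hy)).ne'
  have h2 : ∀ p, (gramInChart g.val p (extChartAt (𝓡 d) p p)).det ≠ 0 := by
    intro p
    obtain ⟨hs, A, hA, hAG⟩ := g.hasSigns hσ p
    intro h0
    have := congrArg Matrix.det hAG
    rw [Matrix.det_mul, Matrix.det_mul, h0, mul_zero, zero_mul, Matrix.det_diagonal] at this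
    refine Finset.prod_ne_zero_iff.2 (fun i _ => ?_) this.symm
    rcases hs i with h | h <;> simp [h]
  exact mul_ne_zero (mul_ne_zero h1 (h2 _)) h1

theorem contDiffOn_matrix_det {E : Type*} [NormedAddCommGroup E] [NormedSpace ℝ E] {S : Set E}
    {m : ℕ} {G : E → Matrix (Fin m) (Fin m) ℝ}
    (hG : ∀ i j, ContDiffOn ℝ ∞ (fun y => G y i j) S) :
    ContDiffOn ℝ ∞ (fun y => (G y).det) S := by
  simp only [Matrix.det_apply']
  exact ContDiffOn.sum fun τ _ => contDiffOn_const.mul (contDiffOn_prod fun i _ => hG _ _)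

theorem contDiffOn_matrix_inv {E : Type*} [NormedAddCommGroup E] [NormedSpace ℝ E] {S : Set E}
    {m : ℕ} {G : E → Matrix (Fin m) (Fin m) ℝ}
    (hG : ∀ i j, ContDiffOn ℝ ∞ (fun y => G y i j) S) (h0 : ∀ y ∈ S, (G y).det ≠ 0) (i j : Fin m) :
    ContDiffOn ℝ ∞ (fun y => (G y)⁻¹ i j) S := by
  have hadj : ContDiffOn ℝ ∞ (fun y => (G y).adjugate i j) S := by
    simp only [Matrix.adjugate_apply]
    refine contDiffOn_matrix_det fun k l => ?_
    simp only [Matrix.updateRow_apply]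
    split_ifs
    · exact contDiffOn_const
    · exact hG k l
  have : ContDiffOn ℝ ∞ (fun y => ((G y).det)⁻¹ * (G y).adjugate i j) S :=
    ((contDiffOn_matrix_det hG).inv h0).mul hadj
  refine this.congr fun y _ => ?_
  simp [Matrix.inv_def]

/-- By `inChart_hodge` the star in a fixed chart is linear in the components of `θ`, with
coefficients built from `√|det G|` and entries of `G⁻¹`, all smooth because `det G` never vanishes.
-/
theorem IsSmooth.hodge [IsManifold (𝓡 d) ∞ M] [FiniteDimensional ℝ V] (hM : IsOrientedAtlas d M)
    {σ : ℝ} (hσ : σ = 1 ∨ σ = -1) (g : MetricTensor d M σ) {θ : DForm d M r V} (hθ : θ.IsSmooth)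
    (h : r + s = d) : (θ.hodge g h).IsSmooth := by
  intro a
  have hdet := contDiffOn_matrix_det (g.smooth a)
  have hne : ∀ y ∈ (extChartAt (𝓡 d) a).target, (gramInChart g.val a y).det ≠ 0 :=
    fun y hy => gramInChart_det_ne_zero hM hσ g hy
  have hinv := contDiffOn_matrix_inv (g.smooth a) hne
  have hsqrt : ContDiffOn ℝ ∞ (fun y => Real.sqrt |(gramInChart g.val a y).det|)
      (extChartAt (𝓡 d) a).target := by
    have habs : ContDiffOn ℝ ∞ (fun y => |(gramInChart g.val a y).det|)
        (extChartAt (𝓡 d) a).target := fun y hy =>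
      (hdet y hy).abs (hne y hy)
    exact habs.sqrt fun y hy => (abs_pos.2 (hne y hy)).ne'
  have hterm : ∀ (i' : Fin r → Fin d) (j : Fin s → Fin d), ContDiffOn ℝ ∞
      (fun y => simpleForm j (θ.inChart a y fun a => stdVec (i' a)))
      (extChartAt (𝓡 d) a).target := by
    intro i' j
    let F : (Model d [⋀^Fin r]→L[ℝ] V) →ₗ[ℝ] (Model d [⋀^Fin s]→L[ℝ] V) :=
      { toFun := fun θ => simpleForm j (θ fun a => stdVec (i' a))
        map_add' := fun θ η => by ext; simp
        map_smul' := fun c θ => by ext; simp [smul_comm c] }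
    exact (LinearMap.toContinuousLinearMap F).contDiff.comp_contDiffOn (hθ a)
  refine ContDiffOn.congr ?_ fun y hy => inChart_hodge hM g θ h hy
  refine ContDiffOn.smul (hsqrt.div_const _) ?_
  refine ContDiffOn.sum fun i _ => ContDiffOn.sum fun i' _ => ContDiffOn.sum fun j _ => ?_
  exact ((contDiffOn_prod fun b _ => hinv _ _).mul contDiffOn_const).smul (hterm i' j)

/-! #### Compact supports -/

theorem IsCompactlySupported.add {θ η : DForm d M k V} (hθ : θ.IsCompactlySupported)
    (hη : η.IsCompactlySupported) : (θ + η).IsCompactlySupported := by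
  obtain ⟨K, hK, h⟩ := hθ
  obtain ⟨L, hL, h'⟩ := hη
  refine ⟨K ∪ L, hK.union hL, fun x hx => ?_⟩
  simp only [Set.mem_union, not_or] at hx
  rw [Pi.add_apply, h x hx.1, h' x hx.2, add_zero]

theorem isCompactlySupported_zero : (0 : DForm d M k V).IsCompactlySupported :=
  ⟨∅, isCompact_empty, fun _ _ => rfl⟩

theorem IsCompactlySupported.smul (c : ℝ) {θ : DForm d M k V} (hθ : θ.IsCompactlySupported) :
    (c • θ).IsCompactlySupported := by
  obtain ⟨K, hK, h⟩ := hθ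
  exact ⟨K, hK, fun x hx => by rw [Pi.smul_apply, h x hx, smul_zero]⟩

theorem IsCompactlySupported.neg {θ : DForm d M k V} (hθ : θ.IsCompactlySupported) :
    (-θ).IsCompactlySupported := by
  obtain ⟨K, hK, h⟩ := hθ
  exact ⟨K, hK, fun x hx => by rw [Pi.neg_apply, h x hx, neg_zero]⟩

theorem IsCompactlySupported.sub {θ η : DForm d M k V} (hθ : θ.IsCompactlySupported)
    (hη : η.IsCompactlySupported) : (θ - η).IsCompactlySupported := by
  rw [sub_eq_add_neg]; exact hθ.add hη.neg

theorem IsCompactlySupported.wedge_left [FiniteDimensional ℝ V] [FiniteDimensional ℝ W]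
    (b : V →ₗ[ℝ] W →ₗ[ℝ] U) {θ : DForm d M p V} (η : DForm d M q W)
    (hθ : θ.IsCompactlySupported) (h : p + q = r) : (wedge b θ η h).IsCompactlySupported := by
  obtain ⟨K, hK, h0⟩ := hθ
  refine ⟨K, hK, fun x hx => ?_⟩
  change wedgeAt h _ (θ x) (η x) = 0
  rw [h0 x hx, wedgeAt_zero_left]

theorem IsCompactlySupported.wedge_right [FiniteDimensional ℝ V] [FiniteDimensional ℝ W]
    (b : V →ₗ[ℝ] W →ₗ[ℝ] U) (θ : DForm d M p V) {η : DForm d M q W}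
    (hη : η.IsCompactlySupported) (h : p + q = r) : (wedge b θ η h).IsCompactlySupported := by
  obtain ⟨K, hK, h0⟩ := hη
  refine ⟨K, hK, fun x hx => ?_⟩
  change wedgeAt h _ (θ x) (η x) = 0
  rw [h0 x hx, wedgeAt_zero_right]

theorem IsCompactlySupported.map [FiniteDimensional ℝ V] (f : V →ₗ[ℝ] W) {θ : DForm d M k V}
    (hθ : θ.IsCompactlySupported) : (θ.map f).IsCompactlySupported := by
  obtain ⟨K, hK, h0⟩ := hθ
  refine ⟨K, hK, fun x hx => ?_⟩
  change (LinearMap.toContinuousLinearMap f).compContinuousAlternatingMap (θ x) = 0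
  rw [h0 x hx]
  ext v
  simp

theorem inChart_eq_zero {θ : DForm d M k V} {a : M} {y : Model d}
    (h : θ ((extChartAt (𝓡 d) a).symm y) = 0) : θ.inChart a y = 0 := by
  rw [inChart, h]; rfl

/-- Locality of the derivative: since `K` is closed, the form vanishes in a whole neighbourhood of
`x`. -/
theorem extd_eq_zero [IsManifold (𝓡 d) ∞ M] {θ : DForm d M k V} {K : Set M} (hK : IsClosed K)
    (h0 : ∀ x ∉ K, θ x = 0) {x : M} (hx : x ∉ K) : θ.extd x = 0 := by
  change θ.extd.value x = 0
  have hev : θ.inChart x =ᶠ[nhds (extChartAt (𝓡 d) x x)] fun _ => 0 := by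
    have hcont := continuousAt_extChartAt_symm (I := 𝓡 d) x
    have hopen : Kᶜ ∈ nhds ((extChartAt (𝓡 d) x).symm (extChartAt (𝓡 d) x x)) := by
      rw [extChartAt_to_inv]; exact hK.isOpen_compl.mem_nhds hx
    filter_upwards [hcont hopen] with z hz
    exact inChart_eq_zero (h0 _ hz)
  rw [value_extd, hev.extDeriv_eq, extDeriv]
  have : fderiv ℝ (fun _ : Model d => (0 : Model d [⋀^Fin k]→L[ℝ] V))
      (extChartAt (𝓡 d) x x) = 0 := fderiv_const_apply _
  rw [this]
  exact (ContinuousAlternatingMap.alternatizeUncurryFinCLM ℝ (Model d) V).map_zero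

theorem IsCompactlySupported.extd [IsManifold (𝓡 d) ∞ M] [T2Space M] {θ : DForm d M k V}
    (hθ : θ.IsCompactlySupported) : θ.extd.IsCompactlySupported := by
  obtain ⟨K, hK, h0⟩ := hθ
  exact ⟨K, hK, fun x hx => extd_eq_zero hK.isClosed h0 hx⟩

theorem IsCompactlySupported.hodge [IsManifold (𝓡 d) ∞ M] {σ : ℝ} (g : MetricTensor d M σ)
    {θ : DForm d M r V} (hθ : θ.IsCompactlySupported) (h : r + s = d) :
    (θ.hodge g h).IsCompactlySupported := by
  obtain ⟨K, hK, h0⟩ := hθ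
  refine ⟨K, hK, fun x hx => ?_⟩
  change (θ.hodge g h).value x = 0
  have h1 : θ.value x = (0 : ℝ) • θ.value x := by rw [zero_smul]; exact h0 x hx
  rw [value_hodge, h1, hodgeCoord_smul, zero_smul]

/-! #### Algebraic identities -/

section Wedge

variable [FiniteDimensional ℝ V] [FiniteDimensional ℝ W] (b : V →ₗ[ℝ] W →ₗ[ℝ] U)

theorem wedge_add_left (θ θ' : DForm d M p V) (η : DForm d M q W) (h : p + q = r) :
    wedge b (θ + θ') η h = wedge b θ η h + wedge b θ' η h :=
  funext fun _ => wedgeAt_add_left _ _ _ _ _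

theorem wedge_add_right (θ : DForm d M p V) (η η' : DForm d M q W) (h : p + q = r) :
    wedge b θ (η + η') h = wedge b θ η h + wedge b θ η' h :=
  funext fun _ => wedgeAt_add_right _ _ _ _ _

theorem wedge_smul_left (c : ℝ) (θ : DForm d M p V) (η : DForm d M q W) (h : p + q = r) :
    wedge b (c • θ) η h = c • wedge b θ η h :=
  funext fun _ => wedgeAt_smul_left _ _ _ _ _

theorem wedge_smul_right (c : ℝ) (θ : DForm d M p V) (η : DForm d M q W) (h : p + q = r) :
    wedge b θ (c • η) h = c • wedge b θ η h :=
  funext fun _ => wedgeAt_smul_right _ _ _ _ _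

theorem wedge_neg_left (θ : DForm d M p V) (η : DForm d M q W) (h : p + q = r) :
    wedge b (-θ) η h = -wedge b θ η h := by
  rw [← neg_one_smul ℝ θ, wedge_smul_left, neg_one_smul]

theorem wedge_neg_right (θ : DForm d M p V) (η : DForm d M q W) (h : p + q = r) :
    wedge b θ (-η) h = -wedge b θ η h := by
  rw [← neg_one_smul ℝ η, wedge_smul_right, neg_one_smul]

theorem wedge_sub_left (θ θ' : DForm d M p V) (η : DForm d M q W) (h : p + q = r) :
    wedge b (θ - θ') η h = wedge b θ η h - wedge b θ' η h := by
  rw [sub_eq_add_neg, wedge_add_left, wedge_neg_left, ← sub_eq_add_neg]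

theorem wedge_sub_right (θ : DForm d M p V) (η η' : DForm d M q W) (h : p + q = r) :
    wedge b θ (η - η') h = wedge b θ η h - wedge b θ η' h := by
  rw [sub_eq_add_neg, wedge_add_right, wedge_neg_right, ← sub_eq_add_neg]

theorem wedge_zero_left (η : DForm d M q W) (h : p + q = r) :
    wedge b (0 : DForm d M p V) η h = 0 :=
  funext fun _ => wedgeAt_zero_left _ _ _

theorem wedge_zero_right (θ : DForm d M p V) (h : p + q = r) :
    wedge b θ (0 : DForm d M q W) h = 0 :=
  funext fun _ => wedgeAt_zero_right _ _ _

theorem wedge_swap (θ : DForm d M p V) (η : DForm d M q W) (h : p + q = r) (h' : q + p = r) :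
    wedge b θ η h = (-1 : ℝ) ^ (p * q) • wedge b.flip η θ h' :=
  funext fun x => wedgeAt_swap (d := d) h h' b.toContinuousBilinearMap (θ.value x) (η.value x)

/-- Graded commutativity for a symmetric bilinear map. -/
theorem wedge_comm_of_symm {b : V →ₗ[ℝ] V →ₗ[ℝ] U} (hb : ∀ v w, b v w = b w v)
    (θ : DForm d M p V) (η : DForm d M q V) (h : p + q = r) (h' : q + p = r) :
    wedge b θ η h = (-1 : ℝ) ^ (p * q) • wedge b η θ h' := by
  have : b.flip = b := by ext v w; exact hb w v
  rw [wedge_swap b θ η h h', this]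

end Wedge

theorem wedge_assoc {V₁ V₂ V₃ V₄ V₅ V₆ : Type*} [NormedAddCommGroup V₁] [NormedSpace ℝ V₁]
    [NormedAddCommGroup V₂] [NormedSpace ℝ V₂] [NormedAddCommGroup V₃] [NormedSpace ℝ V₃]
    [NormedAddCommGroup V₄] [NormedSpace ℝ V₄] [NormedAddCommGroup V₅] [NormedSpace ℝ V₅]
    [NormedAddCommGroup V₆] [NormedSpace ℝ V₆] [FiniteDimensional ℝ V₁] [FiniteDimensional ℝ V₂]
    [FiniteDimensional ℝ V₃] [FiniteDimensional ℝ V₄] [FiniteDimensional ℝ V₅]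
    (b₁ : V₂ →ₗ[ℝ] V₃ →ₗ[ℝ] V₄) (b₂ : V₁ →ₗ[ℝ] V₄ →ₗ[ℝ] V₆)
    (b₃ : V₁ →ₗ[ℝ] V₂ →ₗ[ℝ] V₅) (b₄ : V₅ →ₗ[ℝ] V₃ →ₗ[ℝ] V₆)
    (hb : ∀ u v w, b₂ u (b₁ v w) = b₄ (b₃ u v) w)
    (θ : DForm d M p V₁) (η : DForm d M q V₂) (ζ : DForm d M r V₃)
    (h₁ : q + r = s) (h₂ : p + s = t) (h₃ : p + q = u) (h₄ : u + r = t) :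
    wedge b₂ θ (wedge b₁ η ζ h₁) h₂ = wedge b₄ (wedge b₃ θ η h₃) ζ h₄ :=
  funext fun x => wedgeAt_assoc (d := d) h₁ h₂ h₃ h₄ b₁.toContinuousBilinearMap
    b₂.toContinuousBilinearMap b₃.toContinuousBilinearMap b₄.toContinuousBilinearMap hb
    (θ.value x) (η.value x) (ζ.value x)

theorem wedge_map_right_eq {V' W' : Type*} [NormedAddCommGroup V'] [NormedSpace ℝ V']
    [NormedAddCommGroup W'] [NormedSpace ℝ W'] [FiniteDimensional ℝ V] [FiniteDimensional ℝ W]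
    [FiniteDimensional ℝ V'] [FiniteDimensional ℝ W']
    (b : V →ₗ[ℝ] W →ₗ[ℝ] U) (b' : V' →ₗ[ℝ] W' →ₗ[ℝ] U) (f : V →ₗ[ℝ] V') (g : W' →ₗ[ℝ] W)
    (hb : ∀ v w', b v (g w') = b' (f v) w') (θ : DForm d M p V) (η : DForm d M q W')
    (h : p + q = r) : wedge b θ (η.map g) h = wedge b' (θ.map f) η h :=
  funext fun _ => wedgeAt_map_eq h b.toContinuousBilinearMap b'.toContinuousBilinearMap
    (LinearMap.toContinuousLinearMap f) (LinearMap.toContinuousLinearMap g) hb _ _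

theorem map_add_form [FiniteDimensional ℝ V] (f : V →ₗ[ℝ] W) (θ η : DForm d M k V) :
    (θ + η).map f = θ.map f + η.map f := by
  funext x; ext v; simp [map]

theorem map_smul_form [FiniteDimensional ℝ V] (f : V →ₗ[ℝ] W) (c : ℝ) (θ : DForm d M k V) :
    (c • θ).map f = c • θ.map f := by
  funext x; ext v; simp [map]

theorem IsSmooth.differentiableAt [IsManifold (𝓡 d) ∞ M] {θ : DForm d M k V} (hθ : θ.IsSmooth)
    {a : M} {y : Model d} (hy : y ∈ (extChartAt (𝓡 d) a).target) :
    DifferentiableAt ℝ (θ.inChart a) y :=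
  ((hθ a).contDiffAt ((isOpen_extChartAt_target a).mem_nhds hy)).differentiableAt (by simp)

theorem extd_add [IsManifold (𝓡 d) ∞ M] {θ η : DForm d M k V} (hθ : θ.IsSmooth)
    (hη : η.IsSmooth) : (θ + η).extd = θ.extd + η.extd := by
  refine ext_value fun x => ?_
  change _ = θ.extd.value x + η.extd.value x
  rw [value_extd, value_extd, value_extd]
  exact extDeriv_add (hθ.differentiableAt (mem_extChartAt_target x))
    (hη.differentiableAt (mem_extChartAt_target x))

theorem extd_smul [IsManifold (𝓡 d) ∞ M] (c : ℝ) (θ : DForm d M k V) :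
    (c • θ).extd = c • θ.extd := by
  refine ext_value fun x => ?_
  change _ = c • θ.extd.value x
  rw [value_extd, value_extd]
  exact extDeriv_smul c (θ.inChart x)

/-- The Leibniz rule. -/
theorem extd_wedge [IsManifold (𝓡 d) ∞ M] [FiniteDimensional ℝ V] [FiniteDimensional ℝ W]
    (b : V →ₗ[ℝ] W →ₗ[ℝ] U) {θ : DForm d M p V} {η : DForm d M q W} (hθ : θ.IsSmooth)
    (hη : η.IsSmooth) (h : p + q = r) (h₁ : p + 1 + q = r + 1) (h₂ : p + (q + 1) = r + 1) :
    (wedge b θ η h).extd = wedge b θ.extd η h₁ + (-1 : ℝ) ^ p • wedge b θ η.extd h₂ := by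
  refine ext_value fun x => ?_
  change _ = (wedge b θ.extd η h₁).value x + (-1 : ℝ) ^ p • (wedge b θ η.extd h₂).value x
  rw [value_extd, value_wedge, value_wedge, value_extd, value_extd, ← inChart_self θ,
    ← inChart_self η]
  have := extDeriv_wedgeAt h h₁ h₂ b.toContinuousBilinearMap
    (hθ.differentiableAt (mem_extChartAt_target x)) (hη.differentiableAt (mem_extChartAt_target x))
  rw [← this]
  congr 1
  funext y
  exact inChart_wedge b θ η h x y

section Hodge

variable [IsManifold (𝓡 d) ∞ M] {σ : ℝ} (g : MetricTensor d M σ)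

theorem hodge_add (θ η : DForm d M r V) (h : r + s = d) :
    (θ + η).hodge g h = θ.hodge g h + η.hodge g h := by
  refine ext_value fun x => ?_
  change _ = (θ.hodge g h).value x + (η.hodge g h).value x
  rw [value_hodge, value_hodge, value_hodge]
  exact hodgeCoord_add _ _ _ _

theorem hodge_smul (c : ℝ) (θ : DForm d M r V) (h : r + s = d) :
    (c • θ).hodge g h = c • θ.hodge g h := by
  refine ext_value fun x => ?_
  change _ = c • (θ.hodge g h).value x
  rw [value_hodge, value_hodge]
  exact hodgeCoord_smul _ _ _ _

/-- The factor `σ` is the product of the metric signs `(σ, 1, …, 1)`, which requires at least one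
coordinate. -/
theorem hodge_hodge (hσ : σ = 1 ∨ σ = -1) (hd : 0 < d) (θ : DForm d M r V) (h : r + s = d)
    (h' : s + r = d) : (θ.hodge g h).hodge g h' = ((-1 : ℝ) ^ (r * s) * σ) • θ := by
  refine ext_value fun x => ?_
  rw [value_hodge, value_hodge, hodgeCoord_hodgeCoord h h' hd (g.hasSigns hσ x),
    prod_signatureSigns hd]
  rfl

theorem wedge_hodge_symm [FiniteDimensional ℝ V] (hσ : σ = 1 ∨ σ = -1) (hd : 0 < d)
    (b : V →ₗ[ℝ] V →ₗ[ℝ] U) (hb : ∀ v w, b v w = b w v) (θ η : DForm d M r V) (h : r + s = d) :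
    wedge b θ (η.hodge g h) h = wedge b η (θ.hodge g h) h := by
  refine ext_value fun x => ?_
  rw [value_wedge, value_wedge, value_hodge, value_hodge]
  exact wedgeAt_hodgeCoord_symm h hd (g.hasSigns hσ x) _ hb _ _

end Hodge

end DForm

end FormCalculus

/-! ### Integration of compactly supported top degree forms -/

section Integration

open MeasureTheory

variable {d : ℕ} {M : Type*} [TopologicalSpace M] [ChartedSpace (Model d) M]

namespace DForm

/-- The coefficient of a top degree form in a chart. -/
def topCoeff (θ : DForm d M d ℝ) (a : M) (y : Model d) : ℝ :=
  θ.inChart a y fun i => stdVec i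

theorem topCoeff_add (θ η : DForm d M d ℝ) (a : M) (y : Model d) :
    (θ + η).topCoeff a y = θ.topCoeff a y + η.topCoeff a y := rfl

theorem topCoeff_smul (c : ℝ) (θ : DForm d M d ℝ) (a : M) (y : Model d) :
    (c • θ).topCoeff a y = c * θ.topCoeff a y := rfl

theorem topCoeff_eq_zero {θ : DForm d M d ℝ} {a : M} {y : Model d}
    (h : θ ((extChartAt (𝓡 d) a).symm y) = 0) : θ.topCoeff a y = 0 := by
  rw [topCoeff, inChart_eq_zero h]; rfl

theorem top_form_comp (θ : Model d [⋀^Fin d]→L[ℝ] ℝ) (f : Model d →L[ℝ] Model d) :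
    (θ.compContinuousLinearMap f fun i => stdVec i) = f.det * θ fun i => stdVec i := by
  have h1 := θ.toAlternatingMap.eq_smul_basis_det (EuclideanSpace.basisFun (Fin d) ℝ).toBasis
  have hb : ⇑(EuclideanSpace.basisFun (Fin d) ℝ).toBasis = fun i => stdVec i := by
    funext i; simp
  have h2 := (EuclideanSpace.basisFun (Fin d) ℝ).toBasis.det_comp f.toLinearMap
    (EuclideanSpace.basisFun (Fin d) ℝ).toBasis
  rw [Module.Basis.det_self, mul_one] at h2
  have h3 := congrArg (fun τ => τ (f.toLinearMap ∘ (EuclideanSpace.basisFun (Fin d) ℝ).toBasis)) h1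
  simp only [AlternatingMap.smul_apply, h2] at h3
  rw [hb, smul_eq_mul, mul_comm] at h3
  exact h3

theorem topCoeff_transition [IsManifold (𝓡 d) ∞ M] (θ : DForm d M d ℝ) {a b : M} {y : Model d}
    (hy : y ∈ overlap a b) : θ.topCoeff a y =
      (fderiv ℝ (transition a b) y).det * θ.topCoeff b (transition a b y) := by
  rw [topCoeff, inChart_transition θ hy, top_form_comp]
  rfl

theorem IsSmooth.continuousOn_topCoeff {θ : DForm d M d ℝ} (hθ : θ.IsSmooth) (a : M) :
    ContinuousOn (θ.topCoeff a) (extChartAt (𝓡 d) a).target := by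
  have h := (hθ a).continuousOn
  have h2 : Continuous fun τ : Model d [⋀^Fin d]→L[ℝ] ℝ => τ fun i => stdVec i :=
    continuous_eval_const _
  exact h2.comp_continuousOn h

end DForm

theorem integrableOn_of_compact_support {f : Model d → ℝ} {s K : Set (Model d)}
    (hs : MeasurableSet s) (hf : ContinuousOn f s) (hK : IsCompact K) (hKs : K ⊆ s)
    (h0 : ∀ y ∈ s, y ∉ K → f y = 0) : IntegrableOn f s :=
  IntegrableOn.of_forall_sdiff_eq_zero ((hf.mono hKs).integrableOn_compact hK) hs
    fun y hy => h0 y hy.1 hy.2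

theorem isCompact_chart_image {K : Set M} (hK : IsCompact K) {a : M}
    (h : K ⊆ (extChartAt (𝓡 d) a).source) : IsCompact (extChartAt (𝓡 d) a '' K) :=
  hK.image_of_continuousOn ((continuousOn_extChartAt a).mono h)

theorem chart_image_subset {K : Set M} {a : M} (h : K ⊆ (extChartAt (𝓡 d) a).source) :
    extChartAt (𝓡 d) a '' K ⊆ (extChartAt (𝓡 d) a).target := by
  rintro _ ⟨x, hx, rfl⟩
  exact (extChartAt (𝓡 d) a).map_source (h hx)

theorem notMem_of_notMem_image {K : Set M} {a : M} {y : Model d}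
    (hy : y ∈ (extChartAt (𝓡 d) a).target) (h : y ∉ extChartAt (𝓡 d) a '' K) :
    (extChartAt (𝓡 d) a).symm y ∉ K :=
  fun hK => h ⟨_, hK, (extChartAt (𝓡 d) a).right_inv hy⟩

theorem measurableSet_target (a : M) : MeasurableSet (extChartAt (𝓡 d) a).target :=
  (isOpen_extChartAt_target a).measurableSet

variable [IsManifold (𝓡 d) ∞ M] [T2Space M] [SigmaCompactSpace M]

theorem chartPartition_subordinate (a : M) :
    tsupport (chartPartition d M a) ⊆ (extChartAt (𝓡 d) a).source := by
  rw [extChartAt_source]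
  exact (SmoothPartitionOfUnity.exists_isSubordinate_chartAt_source (𝓡 d) M).choose_spec a

theorem chartPartition_finite {K : Set M} (hK : IsCompact K) :
    {a : M | (Function.support (chartPartition d M a) ∩ K).Nonempty}.Finite :=
  (chartPartition d M).locallyFinite.finite_nonempty_inter_compact hK

theorem chartPartition_sum {K : Set M} (hK : IsCompact K) {x : M} (hx : x ∈ K) :
    ∑ a ∈ (chartPartition_finite (d := d) hK).toFinset, chartPartition d M a x = 1 := by
  rw [← (chartPartition d M).sum_eq_one (Set.mem_univ x)]
  symm
  refine finsum_eq_sum_of_support_subset _ ?_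
  intro a ha
  simp only [Set.Finite.coe_toFinset, Set.mem_ofPred_eq]
  exact ⟨x, ha, hx⟩

theorem chartPartition_eq_zero {K : Set M} (hK : IsCompact K) {a : M}
    (ha : a ∉ (chartPartition_finite (d := d) hK).toFinset) {x : M} (hx : x ∈ K) :
    chartPartition d M a x = 0 := by
  by_contra h
  exact ha ((Set.Finite.mem_toFinset _).2 ⟨x, h, hx⟩)

theorem continuousOn_chartPartition_symm (a b : M) :
    ContinuousOn (fun y => chartPartition d M a ((extChartAt (𝓡 d) b).symm y))
      (extChartAt (𝓡 d) b).target :=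
  (chartPartition d M a).contMDiff.continuous.comp_continuousOn (continuousOn_extChartAt_symm b)

namespace DForm

/-- The contribution of a chart to the integral. -/
def chartIntegral (θ : DForm d M d ℝ) (a : M) : ℝ :=
  ∫ y in (extChartAt (𝓡 d) a).target,
    chartPartition d M a ((extChartAt (𝓡 d) a).symm y) * θ.topCoeff a y

theorem integral_eq_tsum (θ : DForm d M d ℝ) : θ.integral = ∑' a, θ.chartIntegral a := rfl

/-- The support of the form need not lie in the chart, and that of the partition function need not
be compact. Their intersection has both properties, so its chart image is a compact subset of the
target. -/
theorem integrableOn_chart {θ : DForm d M d ℝ} (hθ : θ.IsSmooth) (hc : θ.IsCompactlySupported)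
    (a : M) : IntegrableOn (fun y => chartPartition d M a ((extChartAt (𝓡 d) a).symm y) *
      θ.topCoeff a y) (extChartAt (𝓡 d) a).target := by
  obtain ⟨K, hK, h0⟩ := hc
  have hsub : K ∩ tsupport (chartPartition d M a) ⊆ (extChartAt (𝓡 d) a).source :=
    Set.inter_subset_right.trans (chartPartition_subordinate a)
  refine integrableOn_of_compact_support (measurableSet_target a)
    ((continuousOn_chartPartition_symm a a).mul (hθ.continuousOn_topCoeff a))
    (isCompact_chart_image (hK.inter_right (isClosed_tsupport _)) hsub)
    (chart_image_subset hsub) fun y hy hyK => ?_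
  have hn := notMem_of_notMem_image hy hyK
  by_cases h : (extChartAt (𝓡 d) a).symm y ∈ K
  · have : (extChartAt (𝓡 d) a).symm y ∉ tsupport (chartPartition d M a) := fun h' => hn ⟨h, h'⟩
    rw [image_eq_zero_of_notMem_tsupport this, zero_mul]
  · rw [topCoeff_eq_zero (h0 _ h), mul_zero]

theorem chartIntegral_eq_zero {θ : DForm d M d ℝ} {K : Set M} (hK : IsCompact K)
    (h0 : ∀ x ∉ K, θ x = 0) {a : M} (ha : a ∉ (chartPartition_finite (d := d) hK).toFinset) :
    θ.chartIntegral a = 0 := by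
  refine setIntegral_eq_zero_of_forall_eq_zero fun y hy => ?_
  by_cases h : (extChartAt (𝓡 d) a).symm y ∈ K
  · rw [chartPartition_eq_zero hK ha h, zero_mul]
  · rw [topCoeff_eq_zero (h0 _ h), mul_zero]

/-- Local finiteness of the partition leaves only finitely many charts meeting `K`, so the infinite
sum raises no convergence question. -/
theorem integral_eq_sum {θ : DForm d M d ℝ} {K : Set M} (hK : IsCompact K)
    (h0 : ∀ x ∉ K, θ x = 0) : θ.integral =
      ∑ a ∈ (chartPartition_finite (d := d) hK).toFinset, θ.chartIntegral a :=
  tsum_eq_sum fun _ ha => chartIntegral_eq_zero hK h0 ha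

theorem integral_add {θ η : DForm d M d ℝ} (hθ : θ.IsSmooth) (hθc : θ.IsCompactlySupported)
    (hη : η.IsSmooth) (hηc : η.IsCompactlySupported) :
    (θ + η).integral = θ.integral + η.integral := by
  obtain ⟨K, hK, h0⟩ := id hθc
  obtain ⟨L, hL, h0'⟩ := id hηc
  have hKL := hK.union hL
  have e1 : ∀ x ∉ K ∪ L, θ x = 0 := fun x hx => h0 x fun h => hx (Or.inl h)
  have e2 : ∀ x ∉ K ∪ L, η x = 0 := fun x hx => h0' x fun h => hx (Or.inr h)
  rw [integral_eq_sum hKL e1, integral_eq_sum hKL e2, integral_eq_sum (θ := θ + η) hKL fun x hx => by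
    rw [Pi.add_apply, e1 x hx, e2 x hx, add_zero], ← Finset.sum_add_distrib]
  refine Finset.sum_congr rfl fun a _ => ?_
  rw [chartIntegral, chartIntegral, chartIntegral,
    ← MeasureTheory.integral_add (integrableOn_chart hθ hθc a) (integrableOn_chart hη hηc a)]
  congr 1
  funext y
  rw [topCoeff_add, mul_add]

theorem integral_smul (c : ℝ) (θ : DForm d M d ℝ) : (c • θ).integral = c * θ.integral := by
  rw [integral_eq_tsum, integral_eq_tsum, ← tsum_mul_left]
  congr 1
  funext a
  rw [chartIntegral, chartIntegral, ← MeasureTheory.integral_const_mul]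
  congr 1
  funext y
  rw [topCoeff_smul]
  ring

theorem integral_zero : (0 : DForm d M d ℝ).integral = 0 := by
  rw [← zero_smul ℝ (0 : DForm d M d ℝ), integral_smul, zero_mul]

theorem integral_sum {ι : Type*} (s : Finset ι) (θ : ι → DForm d M d ℝ)
    (hθ : ∀ i ∈ s, (θ i).IsSmooth) (hc : ∀ i ∈ s, (θ i).IsCompactlySupported) :
    (∑ i ∈ s, θ i).integral = ∑ i ∈ s, (θ i).integral := by
  classical
  have : (∑ i ∈ s, θ i).IsSmooth ∧ (∑ i ∈ s, θ i).IsCompactlySupported ∧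
      (∑ i ∈ s, θ i).integral = ∑ i ∈ s, (θ i).integral := by
    induction s using Finset.induction_on with
    | empty => exact ⟨isSmooth_zero, isCompactlySupported_zero, integral_zero⟩
    | insert i s hi ih =>
      obtain ⟨h1, h2, h3⟩ := ih (fun j hj => hθ j (Finset.mem_insert_of_mem hj))
        fun j hj => hc j (Finset.mem_insert_of_mem hj)
      have h4 := hθ i (Finset.mem_insert_self i s)
      have h5 := hc i (Finset.mem_insert_self i s)
      rw [Finset.sum_insert hi, Finset.sum_insert hi]
      exact ⟨h4.add h1, h5.add h2, by rw [integral_add h4 h5 h1 h2, h3]⟩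
  exact this.2.2

/-- The part of the integral weighted by one function of the partition of unity may be computed
in any chart which contains the support of the form. -/
theorem chartIntegral_eq_of_support_subset (hM : IsOrientedAtlas d M) {θ : DForm d M d ℝ}
    {K : Set M} {b : M} (hKb : K ⊆ (extChartAt (𝓡 d) b).source) (h0 : ∀ x ∉ K, θ x = 0) (a : M) :
    θ.chartIntegral a = ∫ y in (extChartAt (𝓡 d) b).target,
      chartPartition d M a ((extChartAt (𝓡 d) b).symm y) * θ.topCoeff b y := by
  -- Off the overlap the form itself vanishes, being supported in chart `b`. In the companion
  -- restriction on the `b` side it is the partition function that vanishes, being supported in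
  -- chart `a`.
  have ha : θ.chartIntegral a = ∫ y in overlap a b,
      chartPartition d M a ((extChartAt (𝓡 d) a).symm y) * θ.topCoeff a y := by
    refine setIntegral_eq_of_subset_of_forall_sdiff_eq_zero (measurableSet_target a)
      (fun y hy => hy.1) fun y hy => ?_
    rw [topCoeff_eq_zero (h0 _ fun h => hy.2 ⟨hy.1, hKb h⟩), mul_zero]
  have hb : ∫ y in (extChartAt (𝓡 d) b).target,
      chartPartition d M a ((extChartAt (𝓡 d) b).symm y) * θ.topCoeff b y =
      ∫ y in overlap b a,
        chartPartition d M a ((extChartAt (𝓡 d) b).symm y) * θ.topCoeff b y := by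
    refine setIntegral_eq_of_subset_of_forall_sdiff_eq_zero (measurableSet_target b)
      (fun y hy => hy.1) fun y hy => ?_
    have : (extChartAt (𝓡 d) b).symm y ∉ tsupport (chartPartition d M a) :=
      fun h => hy.2 ⟨hy.1, chartPartition_subordinate a h⟩
    rw [image_eq_zero_of_notMem_tsupport this, zero_mul]
  have himage : transition a b '' overlap a b = overlap (d := d) b a := by
    ext z
    constructor
    · rintro ⟨y, hy, rfl⟩
      exact transition_mem_overlap hy
    · intro hz
      exact ⟨transition b a z, transition_mem_overlap hz, by
        rw [transition_transition hz, transition_self hz.1]⟩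
  have hinj : Set.InjOn (transition (d := d) a b) (overlap a b) := by
    intro y hy z hz h
    rw [← transition_self hy.1, ← transition_self hz.1, ← transition_transition hy,
      ← transition_transition hz, h]
  -- Change of variables along the transition map. Its `|det|` matches the signed Jacobian of a top
  -- form because the atlas is oriented.
  rw [ha, hb, ← himage, integral_image_eq_integral_abs_det_fderiv_smul volume
    (isOpen_overlap a b).measurableSet (fun y hy => ((contDiffAt_transition hy).differentiableAt
      (by simp)).hasFDerivAt.hasFDerivWithinAt) hinj]
  refine setIntegral_congr_fun (isOpen_overlap a b).measurableSet fun y hy => ?_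
  rw [topCoeff_transition θ hy, symm_transition hy, abs_of_pos (det_transition_pos hM hy),
    smul_eq_mul]
  ring

/-- The integral of a form supported in the domain of a chart. -/
theorem integral_eq_of_support_subset (hM : IsOrientedAtlas d M) {θ : DForm d M d ℝ}
    (hθ : θ.IsSmooth) {K : Set M} (hK : IsCompact K) {b : M}
    (hKb : K ⊆ (extChartAt (𝓡 d) b).source) (h0 : ∀ x ∉ K, θ x = 0) :
    θ.integral = ∫ y in (extChartAt (𝓡 d) b).target, θ.topCoeff b y := by
  rw [integral_eq_sum hK h0, Finset.sum_congr rfl fun a _ =>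
    chartIntegral_eq_of_support_subset hM hKb h0 a, ← MeasureTheory.integral_finsetSum]
  · refine setIntegral_congr_fun (measurableSet_target b) fun y _ => ?_
    rw [← Finset.sum_mul]
    by_cases h : (extChartAt (𝓡 d) b).symm y ∈ K
    · rw [chartPartition_sum hK h, one_mul]
    · rw [topCoeff_eq_zero (h0 _ h), mul_zero]
  · intro a _
    refine integrableOn_of_compact_support (measurableSet_target b)
      ((continuousOn_chartPartition_symm a b).mul (hθ.continuousOn_topCoeff b))
      (isCompact_chart_image hK hKb) (chart_image_subset hKb) fun y hy hyK => ?_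
    rw [topCoeff_eq_zero (h0 _ (notMem_of_notMem_image hy hyK)), mul_zero]

end DForm

end Integration

/-! ### Stokes' theorem -/

section Stokes

open MeasureTheory

/-- Integration by parts against the constant function `1`. -/
theorem integral_fderiv_eq_zero {d : ℕ} {f : Model d → ℝ} (hf : ContDiff ℝ 1 f)
    (hc : HasCompactSupport f) (v : Model d) : ∫ y, fderiv ℝ f y v = 0 := by
  have hf' : Continuous fun y => fderiv ℝ f y v := (hf.continuous_fderiv one_ne_zero).clm_apply
    continuous_const
  have hc' : HasCompactSupport fun y => fderiv ℝ f y v := hc.fderiv_apply (𝕜 := ℝ) v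
  have h := integral_bilinear_hasFDerivAt_right_eq_neg_left_of_integrable (μ := volume)
    (f := fun _ : Model d => (1 : ℝ)) (f' := fun _ => 0) (g := f) (g' := fderiv ℝ f) (v := v)
    (B := ContinuousLinearMap.mul ℝ ℝ) (by simp)
    (by simpa using hf'.integrable_of_hasCompactSupport hc')
    (by simpa using hf.continuous.integrable_of_hasCompactSupport hc)
    (fun x _ => hasFDerivAt_const _ _)
    (fun x _ => (hf.differentiable one_ne_zero x).hasFDerivAt)
  simpa using h

/-- The top coefficient of `dF` is an alternating sum of partial derivatives of compactly supported
functions, each of which integrates to zero. -/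
theorem integral_extDeriv_eq_zero {m : ℕ} {F : Model (m + 1) → Model (m + 1) [⋀^Fin m]→L[ℝ] ℝ}
    (hF : ContDiff ℝ 1 F) (hc : HasCompactSupport F) :
    ∫ y, extDeriv F y (fun i => stdVec i) = 0 := by
  have hcomp : ∀ i : Fin (m + 1), ContDiff ℝ 1
      fun y => F y (i.removeNth fun i => (stdVec i : Model (m + 1))) := fun i =>
    (ContinuousAlternatingMap.apply ℝ (Model (m + 1)) ℝ
      (i.removeNth fun i => (stdVec i : Model (m + 1)))).contDiff.comp hF
  have hsupp : ∀ i : Fin (m + 1), HasCompactSupport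
      fun y => F y (i.removeNth fun i => (stdVec i : Model (m + 1))) := fun i =>
    hc.comp_left (g := fun τ : Model (m + 1) [⋀^Fin m]→L[ℝ] ℝ =>
      τ (i.removeNth fun i => (stdVec i : Model (m + 1)))) rfl
  have heq : ∀ y, extDeriv F y (fun i => stdVec i) = ∑ i : Fin (m + 1), (-1 : ℝ) ^ (i : ℕ) *
      fderiv ℝ (fun y => F y (i.removeNth fun i => (stdVec i : Model (m + 1)))) y (stdVec i) := by
    intro y
    rw [extDeriv_apply (hF.differentiable one_ne_zero y)]
    refine Finset.sum_congr rfl fun i _ => ?_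
    rw [zsmul_eq_mul]
    push_cast
    rfl
  simp only [heq]
  rw [integral_finsetSum]
  · refine Finset.sum_eq_zero fun i _ => ?_
    rw [integral_const_mul, integral_fderiv_eq_zero (hcomp i) (hsupp i), mul_zero]
  · intro i _
    refine Integrable.const_mul ?_ _
    exact (((hcomp i).continuous_fderiv one_ne_zero).clm_apply
      continuous_const).integrable_of_hasCompactSupport ((hsupp i).fderiv_apply (𝕜 := ℝ) _)

namespace DForm

section FunctionMultiple

variable {d : ℕ} {M : Type*} [TopologicalSpace M] [ChartedSpace (Model d) M]
  {V : Type*} [NormedAddCommGroup V] [NormedSpace ℝ V] {k : ℕ}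

/-- The product of a function and a form. -/
def fsmul (f : M → ℝ) (θ : DForm d M k V) : DForm d M k V := fun x => f x • θ x

theorem IsSmooth.fsmul [IsManifold (𝓡 d) ∞ M] {f : M → ℝ} (hf : ContMDiff (𝓡 d) 𝓘(ℝ, ℝ) ∞ f)
    {θ : DForm d M k V} (hθ : θ.IsSmooth) : (fsmul f θ).IsSmooth := by
  intro a
  have h1 : ContDiffOn ℝ ∞ (fun y => f ((extChartAt (𝓡 d) a).symm y))
      (extChartAt (𝓡 d) a).target :=
    contMDiffOn_iff_contDiffOn.1 (hf.comp_contMDiffOn (contMDiffOn_extChartAt_symm a))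
  exact h1.smul (hθ a)

end FunctionMultiple

variable {m : ℕ} {M : Type*} [TopologicalSpace M] [ChartedSpace (Model (m + 1)) M]
  [IsManifold (𝓡 (m + 1)) ∞ M] [T2Space M] [SigmaCompactSpace M]

theorem integral_extd_eq_zero_of_support_subset (hM : IsOrientedAtlas (m + 1) M)
    {θ : DForm (m + 1) M m ℝ} (hθ : θ.IsSmooth) {K : Set M} (hK : IsCompact K) {b : M}
    (hKb : K ⊆ (extChartAt (𝓡 (m + 1)) b).source) (h0 : ∀ x ∉ K, θ x = 0) :
    θ.extd.integral = 0 := by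
  set T := (extChartAt (𝓡 (m + 1)) b).target with hT
  have hTo : IsOpen T := isOpen_extChartAt_target b
  have hK' : IsCompact (extChartAt (𝓡 (m + 1)) b '' K) := isCompact_chart_image hK hKb
  -- Extension by zero stays smooth because the support is a compact subset of the open target,
  -- hence closed in `ℝ^(m+1)`. This transfers the problem to all of Euclidean space.
  let F : Model (m + 1) → Model (m + 1) [⋀^Fin m]→L[ℝ] ℝ := T.indicator (θ.inChart b)
  have hF0 : ∀ y ∉ extChartAt (𝓡 (m + 1)) b '' K, F y = 0 := by
    intro y hy
    by_cases hyT : y ∈ T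
    · simp only [F, Set.indicator_of_mem hyT]
      exact inChart_eq_zero (h0 _ (notMem_of_notMem_image hyT hy))
    · exact Set.indicator_of_notMem hyT _
  have hFT : ∀ y ∈ T, F =ᶠ[nhds y] θ.inChart b := by
    intro y hy
    filter_upwards [hTo.mem_nhds hy] with z hz
    exact Set.indicator_of_mem hz _
  have hFn : ∀ y ∉ T, F =ᶠ[nhds y] fun _ => 0 := by
    intro y hy
    have : y ∉ extChartAt (𝓡 (m + 1)) b '' K := fun h => hy (chart_image_subset hKb h)
    filter_upwards [hK'.isClosed.isOpen_compl.mem_nhds this] with z hz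
    exact hF0 z hz
  have hFs : ContDiff ℝ ∞ F := by
    rw [contDiff_iff_contDiffAt]
    intro y
    by_cases hy : y ∈ T
    · exact ((hθ b).contDiffAt (hTo.mem_nhds hy)).congr_of_eventuallyEq (hFT y hy)
    · exact contDiffAt_const.congr_of_eventuallyEq (hFn y hy)
  have hext0 : ∀ y ∉ T, extDeriv F y (fun i => stdVec i) = 0 := by
    intro y hy
    rw [(hFn y hy).extDeriv_eq, extDeriv, fderiv_const_apply]
    exact DFunLike.congr_fun
      ((ContinuousAlternatingMap.alternatizeUncurryFinCLM ℝ (Model (m + 1)) ℝ).map_zero) _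
  calc θ.extd.integral = ∫ y in T, θ.extd.topCoeff b y :=
        integral_eq_of_support_subset hM hθ.extd hK hKb fun x hx => extd_eq_zero hK.isClosed h0 hx
    _ = ∫ y in T, extDeriv F y (fun i => stdVec i) :=
        setIntegral_congr_fun hTo.measurableSet fun y hy => by
          rw [topCoeff, inChart_extd hθ hy, (hFT y hy).extDeriv_eq]
    _ = ∫ y, extDeriv F y (fun i => stdVec i) := setIntegral_eq_integral_of_forall_compl_eq_zero hext0
    _ = 0 := integral_extDeriv_eq_zero (hFs.of_le (by simp)) (HasCompactSupport.intro hK' hF0)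

/-- Stokes' theorem for compactly supported forms on a manifold without boundary. -/
theorem integral_extd_eq_zero (hM : IsOrientedAtlas (m + 1) M) {θ : DForm (m + 1) M m ℝ}
    (hθ : θ.IsSmooth) (hc : θ.IsCompactlySupported) : θ.extd.integral = 0 := by
  classical
  obtain ⟨K, hK, h0⟩ := id hc
  let S := (chartPartition_finite (d := m + 1) hK).toFinset
  let P : M → DForm (m + 1) M m ℝ := fun b => fsmul (chartPartition (m + 1) M b) θ
  have hP : ∀ b, (P b).IsSmooth := fun b => hθ.fsmul (chartPartition (m + 1) M b).contMDiff
  have hPc : ∀ b, (P b).IsCompactlySupported := fun b =>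
    ⟨K, hK, fun x hx => by change _ • θ x = 0; rw [h0 x hx, smul_zero]⟩
  -- The form is cut by the partition of unity into finitely many pieces, each supported in one
  -- chart.
  have hsum : θ = ∑ b ∈ S, P b := by
    funext x
    rw [Finset.sum_apply]
    change θ x = ∑ b ∈ S, chartPartition (m + 1) M b x • θ x
    rw [← Finset.sum_smul]
    by_cases hx : x ∈ K
    · rw [chartPartition_sum hK hx, one_smul]
    · rw [h0 x hx, smul_zero]
  have hext : ∀ s : Finset M, (∑ b ∈ s, P b).IsSmooth ∧
      (∑ b ∈ s, P b).extd = ∑ b ∈ s, (P b).extd := by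
    intro s
    induction s using Finset.induction_on with
    | empty =>
      refine ⟨isSmooth_zero, ?_⟩
      rw [Finset.sum_empty, Finset.sum_empty, ← zero_smul ℝ (0 : DForm (m + 1) M m ℝ), extd_smul,
        zero_smul]
    | insert b s hb ih =>
      rw [Finset.sum_insert hb, Finset.sum_insert hb]
      exact ⟨(hP b).add ih.1, by rw [extd_add (hP b) ih.1, ih.2]⟩
  rw [hsum, (hext S).2, integral_sum _ _ (fun b _ => (hP b).extd) fun b _ => (hPc b).extd]
  refine Finset.sum_eq_zero fun b _ => ?_
  refine integral_extd_eq_zero_of_support_subset hM (hP b)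
    (hK.inter_right (isClosed_tsupport (chartPartition (m + 1) M b)))
    (Set.inter_subset_right.trans (chartPartition_subordinate b)) fun x hx => ?_
  change chartPartition (m + 1) M b x • θ x = 0
  by_cases h : x ∈ K
  · have : x ∉ tsupport (chartPartition (m + 1) M b) := fun h' => hx ⟨h, h'⟩
    rw [image_eq_zero_of_notMem_tsupport this, zero_smul]
  · rw [h0 x h, smul_zero]

end DForm

end Stokes

/-! ### Non-degeneracy of the wedge pairing and the fundamental lemma -/

section FundamentalLemma

open MeasureTheory

variable {d : ℕ} {V W U : Type*} [NormedAddCommGroup V] [NormedSpace ℝ V]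
  [NormedAddCommGroup W] [NormedSpace ℝ W] [NormedAddCommGroup U] [NormedSpace ℝ U]

/-- The wedge product along a non-degenerate pairing is a non-degenerate pairing of forms of
complementary degrees. -/
theorem eq_zero_of_wedgeAt_eq_zero {p q : ℕ} (h : p + q = d) (b : V →L[ℝ] W →L[ℝ] ℝ)
    (hb : ∀ w, (∀ v, b v w = 0) → w = 0) (η : Model d [⋀^Fin q]→L[ℝ] W)
    (H : ∀ δ : Model d [⋀^Fin p]→L[ℝ] V, wedgeAt h b δ η (fun i => stdVec i) = 0) : η = 0 := by
  have h' : q + p = d := by omega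
  have hone : ∀ i : Fin d, (fun _ => (1 : ℝ)) i = 1 ∨ (fun _ => (1 : ℝ)) i = -1 :=
    fun _ => Or.inl rfl
  -- The Euclidean star serves as an auxiliary tool, independent of the metric on the manifold: `η`
  -- is `±*ζ`, and positivity of the Euclidean metric will produce squares.
  set ζ := hodgeCoord h' (Matrix.diagonal fun _ => (1 : ℝ)) η with hζ
  have hη : hodgeCoord h (Matrix.diagonal fun _ => (1 : ℝ)) ζ = (-1 : ℝ) ^ (q * p) • η := by
    rw [hζ, hodgeCoord_hodgeCoord_diagonal h' h _ hone]
    simp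
  suffices hζ0 : ζ = 0 by
    have h1 : hodgeCoord h (Matrix.diagonal fun _ => (1 : ℝ)) ζ = 0 := by
      rw [hζ0, ← zero_smul ℝ (0 : Model d [⋀^Fin p]→L[ℝ] W), hodgeCoord_smul, zero_smul]
    rw [h1] at hη
    exact (smul_eq_zero.1 hη.symm).resolve_left (by simp)
  refine alternating_ext_stdVec fun I => ?_
  by_cases hI : Function.Injective I
  swap
  · exact alternating_apply_stdVec_eq_zero _ hI
  refine hb _ fun v => ?_
  -- With the test form `δ = b(v, ζ) ⊗ v`, every term of `δ ∧ *ζ` on the standard frame is the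
  -- square of a component of `b(v, ζ)`. Their sum vanishes, hence so does each of them. Symmetry of
  -- `b` plays no role.
  let β : Model d [⋀^Fin p]→L[ℝ] ℝ := (b v).compContinuousAlternatingMap ζ
  let δ : Model d [⋀^Fin p]→L[ℝ] V :=
    (ContinuousLinearMap.toSpanSingleton ℝ v).compContinuousAlternatingMap β
  have hz : wedgeAt h b δ (hodgeCoord h (Matrix.diagonal fun _ => (1 : ℝ)) ζ)
      (fun i => stdVec i) = 0 := by
    rw [hη, wedgeAt_smul_right, ContinuousAlternatingMap.smul_apply, H δ, smul_zero]
  rw [wedgeAt_apply] at hz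
  have hterm : ∀ τ : Equiv.Perm (Fin d), ((Equiv.Perm.sign τ : ℤ) : ℝ) •
      b (δ fun i => stdVec (τ (Fin.cast h (Fin.castAdd q i))))
        (hodgeCoord h (Matrix.diagonal fun _ => (1 : ℝ)) ζ
          fun j => stdVec (τ (Fin.cast h (Fin.natAdd p j)))) =
      (β fun i => stdVec (τ (Fin.cast h (Fin.castAdd q i)))) ^ 2 := by
    intro τ
    have happ : appendIndex h (fun i => τ (Fin.cast h (Fin.castAdd q i)))
        (fun j => τ (Fin.cast h (Fin.natAdd p j))) = τ := by
      funext a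
      rcases exists_index h a with ⟨c, rfl⟩ | ⟨c, rfl⟩ <;> simp [appendIndex]
    have hsign : leviCivita τ = ((Equiv.Perm.sign τ : ℤ) : ℝ) := by
      have h := Matrix.det_permute τ (1 : Matrix (Fin d) (Fin d) ℝ)
      rw [Matrix.det_one, mul_one] at h
      rw [← h, leviCivita]
      congr 1
    rw [hodgeCoord_diagonal_apply h _ hone ζ _ _ (by rw [happ]; exact τ.injective), happ, hsign,
      Finset.prod_const_one, mul_one, map_smul, smul_smul]
    change _ • (b (β _ • v)) (ζ _) = _
    rw [map_smul, smul_apply]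
    have h2 : ((Equiv.Perm.sign τ : ℤ) : ℝ) * ((Equiv.Perm.sign τ : ℤ) : ℝ) = 1 := by
      rcases Int.units_eq_one_or (Equiv.Perm.sign τ) with h | h <;> simp [h]
    rw [h2, one_smul, sq]
    rfl
  rw [Finset.sum_congr rfl fun τ _ => hterm τ] at hz
  have hz' := (smul_eq_zero.1 hz).resolve_left (by positivity)
  -- Completing `I` to a permutation singles out the square that contains the component `I`.
  obtain ⟨k, hk⟩ := exists_complement h hI
  have := (Finset.sum_eq_zero_iff_of_nonneg fun τ _ => sq_nonneg _).1 hz'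
    (Equiv.ofBijective _ (Finite.injective_iff_bijective.1 hk)) (Finset.mem_univ _)
  rw [sq_eq_zero_iff] at this
  have hI' : (fun i => stdVec (I i) : Fin p → Model d) = fun i => stdVec (Equiv.ofBijective _
      (Finite.injective_iff_bijective.1 hk) (Fin.cast h (Fin.castAdd q i))) := by
    funext i
    simp [appendIndex]
  rw [hI']
  exact this

variable {M : Type*} [TopologicalSpace M] [ChartedSpace (Model d) M] {k p q : ℕ}

/-- The components of the pullback are `δ` evaluated on columns of `G z`, so they depend
polynomially on `G z`. -/
theorem contDiffAt_comp_form [FiniteDimensional ℝ V] (δ : Model d [⋀^Fin k]→L[ℝ] V)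
    {G : Model d → Model d →L[ℝ] Model d} {y : Model d} (hG : ContDiffAt ℝ ∞ G y) :
    ContDiffAt ℝ ∞ (fun z => δ.compContinuousLinearMap (G z)) y := by
  have hform : ∀ z, δ.compContinuousLinearMap (G z) = ∑ J : Fin k → Fin d,
      simpleForm J ((k.factorial : ℝ)⁻¹ • δ fun a => G z (stdVec (J a))) :=
    fun z => form_eq_sum _
  simp only [hform]
  refine ContDiffAt.sum fun J _ => ?_
  let F : V →ₗ[ℝ] (Model d [⋀^Fin k]→L[ℝ] V) :=
    { toFun := fun v => simpleForm J ((k.factorial : ℝ)⁻¹ • v)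
      map_add' := fun v w => by ext; simp
      map_smul' := fun c v => by ext; simp [smul_comm c] }
  have h1 : ContDiffAt ℝ ∞ (fun z => fun a : Fin k => G z (stdVec (J a))) y :=
    contDiffAt_pi.2 fun a => hG.clm_apply contDiffAt_const
  have h2 : ContDiffAt ℝ ∞ (fun z => δ fun a => G z (stdVec (J a))) y :=
    (δ.toContinuousMultilinearMap.contDiff.contDiffAt).comp y h1
  exact (LinearMap.toContinuousLinearMap F).contDiff.contDiffAt.comp y h2

open Classical in
/-- The form with coordinate expression `f • δ` in the chart around `a`, extended by zero. -/
def localForm (a : M) (f : Model d → ℝ) (δ : Model d [⋀^Fin k]→L[ℝ] V) : DForm d M k V := fun x =>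
  if x ∈ (extChartAt (𝓡 d) a).source then
    (f (extChartAt (𝓡 d) a x) • δ.compContinuousLinearMap
      (fderiv ℝ (transition x a) (extChartAt (𝓡 d) x x)) : Model d [⋀^Fin k]→L[ℝ] V) else 0

theorem localForm_value (a : M) (f : Model d → ℝ) (δ : Model d [⋀^Fin k]→L[ℝ] V) {x : M}
    (hx : x ∈ (extChartAt (𝓡 d) a).source) : (localForm a f δ).value x =
      f (extChartAt (𝓡 d) a x) • δ.compContinuousLinearMap
        (fderiv ℝ (transition x a) (extChartAt (𝓡 d) x x)) := if_pos hx

theorem localForm_eq_zero (a : M) {f : Model d → ℝ} (δ : Model d [⋀^Fin k]→L[ℝ] V) {x : M}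
    (hx : x ∉ (extChartAt (𝓡 d) a).symm '' tsupport f) : localForm a f δ x = 0 := by
  by_cases h : x ∈ (extChartAt (𝓡 d) a).source
  · have : extChartAt (𝓡 d) a x ∉ tsupport f :=
      fun hm => hx ⟨_, hm, (extChartAt (𝓡 d) a).left_inv h⟩
    change (localForm a f δ).value x = 0
    rw [localForm_value a f δ h, image_eq_zero_of_notMem_tsupport this, zero_smul]
  · exact if_neg h

theorem localForm_inChart [IsManifold (𝓡 d) ∞ M] (a : M) (f : Model d → ℝ)
    (δ : Model d [⋀^Fin k]→L[ℝ] V) {c : M} {y : Model d} (hy : y ∈ overlap c a) :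
    (localForm a f δ).inChart c y = f (transition c a y) •
      δ.compContinuousLinearMap (fderiv ℝ (transition c a) y) := by
  rw [inChart_eq _ hy.1 rfl, localForm_value a f δ hy.2,
    fderiv_transition_comp (mem_overlap_symm hy.1) hy]
  rfl

theorem isCompact_symm_image {f : Model d → ℝ} (hc : HasCompactSupport f) {a : M}
    (hs : tsupport f ⊆ (extChartAt (𝓡 d) a).target) :
    IsCompact ((extChartAt (𝓡 d) a).symm '' tsupport f) :=
  hc.isCompact.image_of_continuousOn ((continuousOn_extChartAt_symm a).mono hs)

theorem localForm_isCompactlySupported {f : Model d → ℝ} (hc : HasCompactSupport f) {a : M}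
    (hs : tsupport f ⊆ (extChartAt (𝓡 d) a).target) (δ : Model d [⋀^Fin k]→L[ℝ] V) :
    (localForm a f δ).IsCompactlySupported :=
  ⟨_, isCompact_symm_image hc hs, fun _ hx => localForm_eq_zero a δ hx⟩

theorem localForm_isSmooth [IsManifold (𝓡 d) ∞ M] [T2Space M] [FiniteDimensional ℝ V]
    {f : Model d → ℝ} (hf : ContDiff ℝ ∞ f)
    (hc : HasCompactSupport f) {a : M} (hs : tsupport f ⊆ (extChartAt (𝓡 d) a).target)
    (δ : Model d [⋀^Fin k]→L[ℝ] V) : (localForm a f δ).IsSmooth := by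
  intro c y hy
  apply ContDiffAt.contDiffWithinAt
  by_cases h : y ∈ overlap c a
  · have hev : (localForm a f δ).inChart c =ᶠ[nhds y] fun z => f (transition c a z) •
        δ.compContinuousLinearMap (fderiv ℝ (transition c a) z) := by
      filter_upwards [(isOpen_overlap c a).mem_nhds h] with z hz
      exact localForm_inChart a f δ hz
    refine ContDiffAt.congr_of_eventuallyEq ?_ hev
    have h1 := contDiffAt_transition h
    have h2 : ContDiffAt ℝ ∞ (fderiv ℝ (transition c a)) y := h1.fderiv_right (by simp)
    exact (hf.contDiffAt.comp y h1).smul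
      (contDiffAt_comp_form δ h2)
  -- Away from the overlap the form vanishes near `y`: the support is compact and the manifold is
  -- Hausdorff, so the support is closed.
  · have hn : (extChartAt (𝓡 d) c).symm y ∉ (extChartAt (𝓡 d) a).symm '' tsupport f := by
      rintro ⟨z, hz, hzy⟩
      exact h ⟨hy, by rw [← hzy]; exact (extChartAt (𝓡 d) a).map_target (hs hz)⟩
    have hcont : ContinuousAt (extChartAt (𝓡 d) c).symm y :=
      (continuousOn_extChartAt_symm c).continuousAt ((isOpen_extChartAt_target c).mem_nhds hy)
    have hev : (localForm a f δ).inChart c =ᶠ[nhds y] fun _ => 0 := by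
      filter_upwards [hcont ((isCompact_symm_image hc hs).isClosed.isOpen_compl.mem_nhds hn)]
        with z hz
      exact DForm.inChart_eq_zero (localForm_eq_zero a δ hz)
    exact contDiffAt_const.congr_of_eventuallyEq hev

/-- The fundamental lemma of the calculus of variations for forms. -/
theorem eq_zero_of_integral_wedge_eq_zero [IsManifold (𝓡 d) ∞ M] [T2Space M] [SigmaCompactSpace M]
    [FiniteDimensional ℝ V] [FiniteDimensional ℝ W] (hM : IsOrientedAtlas d M)
    (b : V →ₗ[ℝ] W →ₗ[ℝ] ℝ) (hb : ∀ w, (∀ v, b v w = 0) → w = 0) (h : p + q = d)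
    {E : DForm d M q W} (hE : E.IsSmooth)
    (H : ∀ δ : DForm d M p V, δ.IsSmooth → δ.IsCompactlySupported →
      (DForm.wedge b δ E h).integral = 0) : E = 0 := by
  refine DForm.ext_value fun x => ?_
  rw [← inChart_self E x]
  change _ = (0 : Model d [⋀^Fin q]→L[ℝ] W)
  refine eq_zero_of_wedgeAt_eq_zero h b.toContinuousBilinearMap hb _ fun δ => ?_
  -- The form `δ` has constant components in the chart around `x`. Bump functions times `δ` are
  -- admissible variations, which reduces the claim to the scalar fundamental lemma for the single
  -- function `c`.
  let c : Model d → ℝ := fun y =>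
    wedgeAt h b.toContinuousBilinearMap δ (E.inChart x y) fun i => stdVec i
  have hc : ContinuousOn c (extChartAt (𝓡 d) x).target := by
    have h1 : ContinuousOn (fun y => wedgeL h b.toContinuousBilinearMap δ (E.inChart x y))
        (extChartAt (𝓡 d) x).target :=
      (ContinuousLinearMap.continuous _).comp_continuousOn (hE x).continuousOn
    have h2 : Continuous fun τ : Model d [⋀^Fin d]→L[ℝ] ℝ => τ fun i => stdVec i :=
      continuous_eval_const _
    exact h2.comp_continuousOn h1
  have hopen : IsOpen (extChartAt (𝓡 d) x).target := isOpen_extChartAt_target x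
  have hae := hopen.ae_eq_zero_of_integral_contDiff_smul_eq_zero (μ := volume)
    (hc.locallyIntegrableOn hopen.measurableSet) (by
      intro f hf hfc hfs
      have hsm := localForm_isSmooth hf hfc hfs δ
      have h0 := H (localForm x f δ) hsm (localForm_isCompactlySupported hfc hfs δ)
      have hsub : (extChartAt (𝓡 d) x).symm '' tsupport f ⊆ (extChartAt (𝓡 d) x).source := by
        rintro _ ⟨y, hy, rfl⟩
        exact (extChartAt (𝓡 d) x).map_target (hfs hy)
      rw [DForm.integral_eq_of_support_subset hM (DForm.IsSmooth.wedge b hsm hE h)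
        (isCompact_symm_image hfc hfs) hsub fun z hz => by
          change wedgeAt h _ (localForm x f δ z) (E z) = 0
          rw [localForm_eq_zero x δ hz, wedgeAt_zero_left]] at h0
      have h1 : ∫ y in (extChartAt (𝓡 d) x).target, f y • c y = ∫ y, f y • c y :=
        setIntegral_eq_integral_of_forall_compl_eq_zero fun y hy => by
          rw [image_eq_zero_of_notMem_tsupport fun h => hy (hfs h), zero_smul]
      rw [← h1, ← h0]
      refine setIntegral_congr_fun hopen.measurableSet fun y hy => ?_
      have hyo : y ∈ overlap (d := d) x x := ⟨hy, (extChartAt (𝓡 d) x).map_target hy⟩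
      rw [DForm.topCoeff, DForm.inChart_wedge, localForm_inChart x f δ hyo, transition_self hy,
        fderiv_transition_self hy, wedgeAt_smul_left]
      rfl)
  have hres : c =ᵐ[volume.restrict (extChartAt (𝓡 d) x).target] fun _ => 0 :=
    (ae_restrict_iff' hopen.measurableSet).2 hae
  -- Continuity upgrades vanishing almost everywhere to vanishing at the point `x` itself.
  exact Measure.eqOn_open_of_ae_eq hres hopen hc continuousOn_const (mem_extChartAt_target x)

end FundamentalLemma

/-! ### Defining identities of the transposed algebraic maps -/

section Algebra

variable {𝔤 𝔥 𝔩 : Type*} [NormedRealLieAlgebra 𝔤] [NormedRealLieAlgebra 𝔥]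
  [NormedRealLieAlgebra 𝔩] [FiniteDimensional ℝ 𝔤] [FiniteDimensional ℝ 𝔥] [FiniteDimensional ℝ 𝔩]
  {D : DifferentialTwoCrossedModule 𝔤 𝔥 𝔩} (Q : InvariantForms D)

namespace InvariantForms

theorem formG_rieszG (f : Module.Dual ℝ 𝔤) (X : 𝔤) : Q.formG (Q.rieszG f) X = f X :=
  LinearMap.BilinForm.apply_toDual_symm_apply f X

theorem formH_rieszH (f : Module.Dual ℝ 𝔥) (Y : 𝔥) : Q.formH (Q.rieszH f) Y = f Y :=
  LinearMap.BilinForm.apply_toDual_symm_apply f Y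

theorem formL_rieszL (f : Module.Dual ℝ 𝔩) (Z : 𝔩) : Q.formL (Q.rieszL f) Z = f Z :=
  LinearMap.BilinForm.apply_toDual_symm_apply f Z

theorem formG_sigma (Y Y' : 𝔥) (X : 𝔤) : Q.formG (Q.sigma Y Y') X = -Q.formH Y (D.actH X Y') :=
  Q.formG_rieszG _ X

theorem formG_kappa (Z Z' : 𝔩) (X : 𝔤) : Q.formG (Q.kappa Z Z') X = -Q.formL Z (D.actL X Z') :=
  Q.formG_rieszG _ X

theorem formH_eta₁ (Z : 𝔩) (Y Y' : 𝔥) : Q.formH (Q.eta₁ Z Y) Y' = -Q.formL Z (D.lift Y Y') :=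
  Q.formH_rieszH _ Y'

theorem formH_eta₂ (Z : 𝔩) (Y Y' : 𝔥) : Q.formH (Q.eta₂ Z Y') Y = -Q.formL Z (D.lift Y Y') :=
  Q.formH_rieszH _ Y

theorem formH_alphaStar (X : 𝔤) (Y : 𝔥) : Q.formH (Q.alphaStar X) Y = Q.formG X (D.α Y) :=
  Q.formH_rieszH _ Y

theorem formL_betaStar (Y : 𝔥) (Z : 𝔩) : Q.formL (Q.betaStar Y) Z = Q.formH Y (D.β Z) :=
  Q.formL_rieszL _ Z

theorem eq_zero_of_formG (X : 𝔤) (h : ∀ X', Q.formG X' X = 0) : X = 0 := Q.nondegG.2 X h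

theorem eq_zero_of_formH (Y : 𝔥) (h : ∀ Y', Q.formH Y' Y = 0) : Y = 0 := Q.nondegH.2 Y h

theorem eq_zero_of_formL (Z : 𝔩) (h : ∀ Z', Q.formL Z' Z = 0) : Z = 0 := Q.nondegL.2 Z h

end InvariantForms

end Algebra

/-! ### First variation of polynomial curves of Lagrangians -/

section FirstVariation

variable {d : ℕ} {M : Type*} [TopologicalSpace M] [ChartedSpace (Model d) M]
  {V W U : Type*} [NormedAddCommGroup V] [NormedSpace ℝ V] [NormedAddCommGroup W]
  [NormedSpace ℝ W] [NormedAddCommGroup U] [NormedSpace ℝ U]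

namespace DForm

variable {k p q r : ℕ}

theorem wedge_neg_bilin [FiniteDimensional ℝ V] [FiniteDimensional ℝ W] (b : V →ₗ[ℝ] W →ₗ[ℝ] U)
    (θ : DForm d M p V) (η : DForm d M q W) (h : p + q = r) :
    wedge (-b) θ η h = -wedge b θ η h :=
  funext fun _ => wedgeAt_neg_bilin h b.toContinuousBilinearMap _ _

/-- Smooth compactly supported forms. -/
def IsTest (θ : DForm d M k V) : Prop := θ.IsSmooth ∧ θ.IsCompactlySupported

theorem isTest_zero : (0 : DForm d M k V).IsTest := ⟨isSmooth_zero, isCompactlySupported_zero⟩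

theorem IsTest.add {θ η : DForm d M k V} (hθ : θ.IsTest) (hη : η.IsTest) : (θ + η).IsTest :=
  ⟨hθ.1.add hη.1, hθ.2.add hη.2⟩

theorem IsTest.sub {θ η : DForm d M k V} (hθ : θ.IsTest) (hη : η.IsTest) : (θ - η).IsTest :=
  ⟨hθ.1.sub hη.1, hθ.2.sub hη.2⟩

theorem IsTest.smul (c : ℝ) {θ : DForm d M k V} (hθ : θ.IsTest) : (c • θ).IsTest :=
  ⟨hθ.1.smul c, hθ.2.smul c⟩

theorem IsTest.map [FiniteDimensional ℝ V] (f : V →ₗ[ℝ] W) {θ : DForm d M k V} (hθ : θ.IsTest) :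
    (θ.map f).IsTest := ⟨hθ.1.map f, hθ.2.map f⟩

theorem IsTest.extd [IsManifold (𝓡 d) ∞ M] [T2Space M] {θ : DForm d M k V} (hθ : θ.IsTest) :
    θ.extd.IsTest := ⟨hθ.1.extd, hθ.2.extd⟩

theorem IsTest.wedge_left [FiniteDimensional ℝ V] [FiniteDimensional ℝ W]
    (b : V →ₗ[ℝ] W →ₗ[ℝ] U) {θ : DForm d M p V} {η : DForm d M q W} (hθ : θ.IsTest)
    (hη : η.IsSmooth) (h : p + q = r) : (wedge b θ η h).IsTest :=
  ⟨hθ.1.wedge b hη h, hθ.2.wedge_left b η h⟩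

theorem IsTest.wedge_right [FiniteDimensional ℝ V] [FiniteDimensional ℝ W]
    (b : V →ₗ[ℝ] W →ₗ[ℝ] U) {θ : DForm d M p V} {η : DForm d M q W} (hθ : θ.IsSmooth)
    (hη : η.IsTest) (h : p + q = r) : (wedge b θ η h).IsTest :=
  ⟨hθ.wedge b hη.1 h, hη.2.wedge_right b θ h⟩

theorem IsTest.hodge [IsManifold (𝓡 d) ∞ M] [FiniteDimensional ℝ V] (hM : IsOrientedAtlas d M)
    {σ : ℝ} (hσ : σ = 1 ∨ σ = -1) (g : MetricTensor d M σ) {θ : DForm d M p V} (hθ : θ.IsTest)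
    (h : p + q = d) : (θ.hodge g h).IsTest := ⟨hθ.1.hodge hM hσ g h, hθ.2.hodge g h⟩

/-- `L₁` is the linear term of the curve `L` of Lagrangians, the higher terms being polynomial with
smooth compactly supported coefficients. -/
def FirstVariation (L : ℝ → DForm d M d ℝ) (L₁ : DForm d M d ℝ) : Prop :=
  L₁.IsTest ∧ ∃ R₂ R₃ R₄ : DForm d M d ℝ, R₂.IsTest ∧ R₃.IsTest ∧ R₄.IsTest ∧
    ∀ t, L t - L 0 = t • L₁ + t ^ 2 • R₂ + t ^ 3 • R₃ + t ^ 4 • R₄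

theorem FirstVariation.add {L L' : ℝ → DForm d M d ℝ} {L₁ L₁' : DForm d M d ℝ}
    (h : FirstVariation L L₁) (h' : FirstVariation L' L₁') :
    FirstVariation (fun t => L t + L' t) (L₁ + L₁') := by
  obtain ⟨h1, R₂, R₃, R₄, h2, h3, h4, hL⟩ := h
  obtain ⟨h1', R₂', R₃', R₄', h2', h3', h4', hL'⟩ := h'
  refine ⟨h1.add h1', R₂ + R₂', R₃ + R₃', R₄ + R₄', h2.add h2', h3.add h3', h4.add h4',
    fun t => ?_⟩
  rw [add_sub_add_comm, hL, hL']
  module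

theorem FirstVariation.smul (c : ℝ) {L : ℝ → DForm d M d ℝ} {L₁ : DForm d M d ℝ}
    (h : FirstVariation L L₁) : FirstVariation (fun t => c • L t) (c • L₁) := by
  obtain ⟨h1, R₂, R₃, R₄, h2, h3, h4, hL⟩ := h
  refine ⟨h1.smul c, c • R₂, c • R₃, c • R₄, h2.smul c, h3.smul c, h4.smul c, fun t => ?_⟩
  rw [← smul_sub, hL]
  module

/-- Every coefficient of a positive power of `t` contains at least one test factor, so it has
compact support although `θ₀` and `η₀` need not. Two quadratic curves give degree four, the bound
built into `FirstVariation`. -/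
theorem firstVariation_wedge [FiniteDimensional ℝ V] [FiniteDimensional ℝ W]
    (b : V →ₗ[ℝ] W →ₗ[ℝ] ℝ) (h : p + q = d) {θ : ℝ → DForm d M p V} {η : ℝ → DForm d M q W}
    {θ₀ θ₁ θ₂ : DForm d M p V} {η₀ η₁ η₂ : DForm d M q W}
    (hθ₀ : θ₀.IsSmooth) (hθ₁ : θ₁.IsTest) (hθ₂ : θ₂.IsTest)
    (hη₀ : η₀.IsSmooth) (hη₁ : η₁.IsTest) (hη₂ : η₂.IsTest)
    (hθ : ∀ t, θ t = θ₀ + t • θ₁ + t ^ 2 • θ₂) (hη : ∀ t, η t = η₀ + t • η₁ + t ^ 2 • η₂) :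
    FirstVariation (fun t => wedge b (θ t) (η t) h) (wedge b θ₁ η₀ h + wedge b θ₀ η₁ h) := by
  refine ⟨(hθ₁.wedge_left b hη₀ h).add (IsTest.wedge_right b hθ₀ hη₁ h),
    wedge b θ₁ η₁ h + wedge b θ₂ η₀ h + wedge b θ₀ η₂ h,
    wedge b θ₁ η₂ h + wedge b θ₂ η₁ h, wedge b θ₂ η₂ h,
    ((hθ₁.wedge_left b hη₁.1 h).add (hθ₂.wedge_left b hη₀ h)).add
      (IsTest.wedge_right b hθ₀ hη₂ h),
    (hθ₁.wedge_left b hη₂.1 h).add (hθ₂.wedge_left b hη₁.1 h), hθ₂.wedge_left b hη₂.1 h,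
    fun t => ?_⟩
  simp only [hθ, hη, wedge_add_left, wedge_add_right, wedge_smul_left, wedge_smul_right]
  module

variable [IsManifold (𝓡 d) ∞ M] [T2Space M] [SigmaCompactSpace M]

theorem IsTest.integral_add {θ η : DForm d M d ℝ} (hθ : θ.IsTest) (hη : η.IsTest) :
    (θ + η).integral = θ.integral + η.integral := DForm.integral_add hθ.1 hθ.2 hη.1 hη.2

/-- Linearity of the integral on test forms turns the varied action into a real polynomial in `t`
without constant term. -/
theorem FirstVariation.hasDerivAt {L : ℝ → DForm d M d ℝ} {L₁ : DForm d M d ℝ}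
    (h : FirstVariation L L₁) : HasDerivAt (fun t => (L t - L 0).integral) L₁.integral 0 := by
  obtain ⟨h1, R₂, R₃, R₄, h2, h3, h4, hL⟩ := h
  have heq : (fun t => (L t - L 0).integral) = fun t => t * L₁.integral + t ^ 2 * R₂.integral +
      t ^ 3 * R₃.integral + t ^ 4 * R₄.integral := by
    funext t
    rw [hL, (((h1.smul t).add (h2.smul _)).add (h3.smul _)).integral_add (h4.smul _),
      ((h1.smul t).add (h2.smul _)).integral_add (h3.smul _),
      (h1.smul t).integral_add (h2.smul _), integral_smul, integral_smul, integral_smul,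
      integral_smul]
  rw [heq]
  have := ((((hasDerivAt_id' (0 : ℝ)).mul_const L₁.integral).fun_add
    ((hasDerivAt_pow 2 (0 : ℝ)).mul_const R₂.integral)).fun_add
    ((hasDerivAt_pow 3 (0 : ℝ)).mul_const R₃.integral)).fun_add
    ((hasDerivAt_pow 4 (0 : ℝ)).mul_const R₄.integral)
  simpa using this

theorem FirstVariation.hasDerivAt_zero_iff {L : ℝ → DForm d M d ℝ} {L₁ : DForm d M d ℝ}
    (h : FirstVariation L L₁) :
    HasDerivAt (fun t => (L t - L 0).integral) 0 0 ↔ L₁.integral = 0 :=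
  ⟨fun h' => h.hasDerivAt.unique h', fun h' => h' ▸ h.hasDerivAt⟩

end DForm

end FirstVariation

/-! ### Variation of the curvatures -/

section GaugeVariation

variable {n : ℕ} {M : Type*} [TopologicalSpace M] [ChartedSpace (Model (n + 4)) M]
  {𝔤 𝔥 𝔩 : Type*} [NormedRealLieAlgebra 𝔤] [NormedRealLieAlgebra 𝔥] [NormedRealLieAlgebra 𝔩]
  [FiniteDimensional ℝ 𝔤] [FiniteDimensional ℝ 𝔥] [FiniteDimensional ℝ 𝔩]

/-- Smooth compactly supported variations of the gauge field. -/
def GaugeField.IsTest (φ : GaugeField n M 𝔤 𝔥 𝔩) : Prop := φ.A.IsTest ∧ φ.B.IsTest ∧ φ.C.IsTest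

/-- Smooth compactly supported variations of the multipliers. -/
def Multipliers.IsTest (m : Multipliers n M 𝔤 𝔥 𝔩) : Prop :=
  m.Bb.IsTest ∧ m.Cb.IsTest ∧ m.Db.IsTest

theorem GaugeField.vary_zero (φ δ : GaugeField n M 𝔤 𝔥 𝔩) : φ.vary δ 0 = φ := by
  simp [GaugeField.vary]

theorem Multipliers.vary_zero (m δ : Multipliers n M 𝔤 𝔥 𝔩) : m.vary δ 0 = m := by
  simp [Multipliers.vary]

namespace GaugeField

variable (D : DifferentialTwoCrossedModule 𝔤 𝔥 𝔩)

/-- The linear term of the fake curvature. -/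
def varF (φ δ : GaugeField n M 𝔤 𝔥 𝔩) : DForm (n + 4) M 2 𝔤 :=
  δ.A.extd + DForm.wedge (lieBracketₗ 𝔤) φ.A δ.A - δ.B.map D.α.toLinearMap

/-- The linear term of the fake 2-curvature. -/
def varG (φ δ : GaugeField n M 𝔤 𝔥 𝔩) : DForm (n + 4) M 3 𝔥 :=
  δ.B.extd + (DForm.wedge D.actHₗ δ.A φ.B + DForm.wedge D.actHₗ φ.A δ.B) -
    δ.C.map D.β.toLinearMap

/-- The linear term of the 3-curvature. -/
def varH (φ δ : GaugeField n M 𝔤 𝔥 𝔩) : DForm (n + 4) M 4 𝔩 :=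
  δ.C.extd + (DForm.wedge D.actLₗ δ.A φ.C + DForm.wedge D.actLₗ φ.A δ.C) +
    (DForm.wedge D.lift δ.B φ.B + DForm.wedge D.lift φ.B δ.B)

/-- Two signs cancel: the bracket is antisymmetric and 1-forms anticommute. This merges the two
cross terms of `½ A ∧ A`, so no factor `½` survives in the linear term. -/
theorem wedge_lieBracket_comm (A A' : DForm (n + 4) M 1 𝔤) :
    DForm.wedge (r := 2) (lieBracketₗ 𝔤) A' A = DForm.wedge (r := 2) (lieBracketₗ 𝔤) A A' := by
  have hflip : (lieBracketₗ 𝔤).flip = -lieBracketₗ 𝔤 := by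
    ext X Y
    exact (lie_skew Y X).symm
  rw [DForm.wedge_swap (lieBracketₗ 𝔤) A' A (by omega) (by omega), hflip, DForm.wedge_neg_bilin]
  simp

variable [IsManifold (𝓡 (n + 4)) ∞ M]

theorem curvF_vary {φ δ : GaugeField n M 𝔤 𝔥 𝔩} (hφ : φ.IsSmooth) (hδ : δ.IsSmooth) (t : ℝ) :
    (φ.vary δ t).curvF D = φ.curvF D + t • φ.varF D δ +
      t ^ 2 • ((1 / 2 : ℝ) • DForm.wedge (lieBracketₗ 𝔤) δ.A δ.A) := by
  simp only [curvF, vary, varF]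
  rw [DForm.extd_add hφ.1 (hδ.1.smul t), DForm.extd_smul, DForm.map_add_form, DForm.map_smul_form]
  simp only [DForm.wedge_add_left, DForm.wedge_add_right, DForm.wedge_smul_left,
    DForm.wedge_smul_right]
  rw [wedge_lieBracket_comm φ.A δ.A]
  module

theorem curvG_vary {φ δ : GaugeField n M 𝔤 𝔥 𝔩} (hφ : φ.IsSmooth) (hδ : δ.IsSmooth) (t : ℝ) :
    (φ.vary δ t).curvG D = φ.curvG D + t • φ.varG D δ +
      t ^ 2 • DForm.wedge D.actHₗ δ.A δ.B := by
  simp only [curvG, vary, varG]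
  rw [DForm.extd_add hφ.2.1 (hδ.2.1.smul t), DForm.extd_smul, DForm.map_add_form,
    DForm.map_smul_form]
  simp only [DForm.wedge_add_left, DForm.wedge_add_right, DForm.wedge_smul_left,
    DForm.wedge_smul_right]
  module

theorem curvH_vary {φ δ : GaugeField n M 𝔤 𝔥 𝔩} (hφ : φ.IsSmooth) (hδ : δ.IsSmooth) (t : ℝ) :
    (φ.vary δ t).curvH D = φ.curvH D + t • φ.varH D δ +
      t ^ 2 • (DForm.wedge D.actLₗ δ.A δ.C + DForm.wedge D.lift δ.B δ.B) := by
  simp only [curvH, vary, varH]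
  rw [DForm.extd_add hφ.2.2 (hδ.2.2.smul t), DForm.extd_smul]
  simp only [DForm.wedge_add_left, DForm.wedge_add_right, DForm.wedge_smul_left,
    DForm.wedge_smul_right]
  module

theorem IsTest.isSmooth {δ : GaugeField n M 𝔤 𝔥 𝔩} (h : δ.IsTest) : δ.IsSmooth :=
  ⟨h.1.1, h.2.1.1, h.2.2.1⟩

theorem IsSmooth.curvF {φ : GaugeField n M 𝔤 𝔥 𝔩} (hφ : φ.IsSmooth) : (φ.curvF D).IsSmooth :=
  (hφ.1.extd.add ((hφ.1.wedge _ hφ.1 _).smul _)).sub (hφ.2.1.map _)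

theorem IsSmooth.curvG {φ : GaugeField n M 𝔤 𝔥 𝔩} (hφ : φ.IsSmooth) : (φ.curvG D).IsSmooth :=
  (hφ.2.1.extd.add (hφ.1.wedge _ hφ.2.1 _)).sub (hφ.2.2.map _)

theorem IsSmooth.curvH {φ : GaugeField n M 𝔤 𝔥 𝔩} (hφ : φ.IsSmooth) : (φ.curvH D).IsSmooth :=
  (hφ.2.2.extd.add (hφ.1.wedge _ hφ.2.2 _)).add (hφ.2.1.wedge _ hφ.2.1 _)

variable [T2Space M]

theorem IsTest.varF {φ δ : GaugeField n M 𝔤 𝔥 𝔩} (hφ : φ.IsSmooth) (hδ : δ.IsTest) :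
    (φ.varF D δ).IsTest :=
  (hδ.1.extd.add (DForm.IsTest.wedge_right _ hφ.1 hδ.1 _)).sub (hδ.2.1.map _)

theorem IsTest.varG {φ δ : GaugeField n M 𝔤 𝔥 𝔩} (hφ : φ.IsSmooth) (hδ : δ.IsTest) :
    (φ.varG D δ).IsTest :=
  (hδ.2.1.extd.add ((hδ.1.wedge_left _ hφ.2.1 _).add
    (DForm.IsTest.wedge_right _ hφ.1 hδ.2.1 _))).sub (hδ.2.2.map _)

theorem IsTest.varH {φ δ : GaugeField n M 𝔤 𝔥 𝔩} (hφ : φ.IsSmooth) (hδ : δ.IsTest) :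
    (φ.varH D δ).IsTest :=
  (hδ.2.2.extd.add ((hδ.1.wedge_left _ hφ.2.2 _).add
    (DForm.IsTest.wedge_right _ hφ.1 hδ.2.2 _))).add
    ((hδ.2.1.wedge_left _ hφ.2.1 _).add (DForm.IsTest.wedge_right _ hφ.2.1 hδ.2.1 _))

end GaugeField

end GaugeVariation

/-! ### Covariant integration by parts -/

section CovariantDerivative

variable {d : ℕ} {M : Type*} [TopologicalSpace M] [ChartedSpace (Model d) M]
  [IsManifold (𝓡 d) ∞ M]
  {G V U : Type*} [NormedAddCommGroup V] [NormedSpace ℝ V] [NormedAddCommGroup G]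
  [NormedSpace ℝ G] [FiniteDimensional ℝ G] [FiniteDimensional ℝ V]
  {p q r p₁ q₁ s : ℕ}

/-- Integration by parts for the covariant derivative `d + A ∧^ρ` and an invariant bilinear form,
before integration. -/
theorem DForm.wedge_covariantDeriv (b : V →ₗ[ℝ] V →ₗ[ℝ] ℝ) (ρ : G →ₗ[ℝ] V →ₗ[ℝ] V)
    (hb : ∀ X v w, b (ρ X v) w = -b v (ρ X w)) (A : DForm d M 1 G) {θ : DForm d M p V}
    {η : DForm d M q V} (hθ : θ.IsSmooth) (hη : η.IsSmooth) (h : p + q = r)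
    (hp : 1 + p = p + 1) (hq : 1 + q = q + 1) (h₁ : p + 1 + q = r + 1)
    (h₂ : p + (q + 1) = r + 1) :
    DForm.wedge b θ (η.extd + DForm.wedge ρ A η hq) h₂ =
      (-1 : ℝ) ^ p • (DForm.wedge b θ η h).extd -
        (-1 : ℝ) ^ p • DForm.wedge b (θ.extd + DForm.wedge ρ A θ hp) η h₁ := by
  -- Invariance moves the action of `A` from `η` to `θ` with a minus sign, and carrying the 1-form
  -- `A` past `θ` costs `(-1)^p`. These are the signs of the derivative terms in the Leibniz rule,
  -- so the two combine into covariant derivatives.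
  have key : DForm.wedge b θ (DForm.wedge ρ A η hq) h₂ =
      -((-1 : ℝ) ^ p • DForm.wedge b (DForm.wedge ρ A θ hp) η h₁) := by
    rw [DForm.wedge_assoc ρ b (-ρ.flip) b (fun v X w => by simp [hb]) θ A η hq h₂ rfl h₁,
      DForm.wedge_neg_bilin, DForm.wedge_neg_left, DForm.wedge_swap ρ.flip θ A rfl hp,
      DForm.wedge_smul_left, LinearMap.flip_flip, mul_one]
  rw [DForm.extd_wedge b hθ hη h h₁ h₂, DForm.wedge_add_right, DForm.wedge_add_left, key, smul_add,
    smul_smul, neg_one_pow_mul_self]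
  module

end CovariantDerivative

/-! ### The gauge variation as residuals plus an exact form -/

section GaugeVariation

variable {n : ℕ} {M : Type*} [TopologicalSpace M] [ChartedSpace (Model (n + 4)) M]
  {𝔤 𝔥 𝔩 : Type*} [NormedRealLieAlgebra 𝔤] [NormedRealLieAlgebra 𝔥] [NormedRealLieAlgebra 𝔩]
  [FiniteDimensional ℝ 𝔤] [FiniteDimensional ℝ 𝔥] [FiniteDimensional ℝ 𝔩]
  {D : DifferentialTwoCrossedModule 𝔤 𝔥 𝔩} (Q : InvariantForms D)

/-- The linear term of `⟨B̄, 𝓕⟩ + ⟨C̄, 𝓖⟩ + ⟨D̄, 𝓗⟩` for a variation of the gauge field. -/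
def gaugeVariation (φ : GaugeField n M 𝔤 𝔥 𝔩) (m : Multipliers n M 𝔤 𝔥 𝔩)
    (δ : GaugeField n M 𝔤 𝔥 𝔩) : DForm (n + 4) M (n + 4) ℝ :=
  DForm.wedge Q.formG m.Bb (φ.varF D δ) + DForm.wedge Q.formH m.Cb (φ.varG D δ) +
    DForm.wedge Q.formL m.Db (φ.varH D δ)

/-- The difference of the two sides of the first gauge equation. -/
def residualA (φ : GaugeField n M 𝔤 𝔥 𝔩) (m : Multipliers n M 𝔤 𝔥 𝔩) :
    DForm (n + 4) M (n + 3) 𝔤 :=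
  m.Bb.extd + DForm.wedge (lieBracketₗ 𝔤) φ.A m.Bb -
    ((-1 : ℝ) ^ (n + 4 + 1) • DForm.wedge Q.sigma m.Cb φ.B +
      (-1 : ℝ) ^ (n + 4) • DForm.wedge Q.kappa m.Db φ.C)

/-- The difference of the two sides of the second gauge equation. -/
def residualB (φ : GaugeField n M 𝔤 𝔥 𝔩) (m : Multipliers n M 𝔤 𝔥 𝔩) :
    DForm (n + 4) M (n + 2) 𝔥 :=
  m.Cb.extd + DForm.wedge D.actHₗ φ.A m.Cb -
    ((-1 : ℝ) ^ (n + 4) • m.Bb.map Q.alphaStar +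
      (-1 : ℝ) ^ (n + 4) • (DForm.wedge Q.eta₂ m.Db φ.B + DForm.wedge Q.eta₁ m.Db φ.B))

/-- The difference of the two sides of the third gauge equation. -/
def residualC (φ : GaugeField n M 𝔤 𝔥 𝔩) (m : Multipliers n M 𝔤 𝔥 𝔩) :
    DForm (n + 4) M (n + 1) 𝔩 :=
  m.Db.extd + DForm.wedge D.actLₗ φ.A m.Db - (-1 : ℝ) ^ (n + 4 + 1) • m.Cb.map Q.betaStar

theorem gaugeEquations_iff_residual (φ : GaugeField n M 𝔤 𝔥 𝔩) (m : Multipliers n M 𝔤 𝔥 𝔩) :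
    GaugeEquations3BFYM Q φ m ↔
      residualA Q φ m = 0 ∧ residualB Q φ m = 0 ∧ residualC Q φ m = 0 := by
  rw [residualA, residualB, residualC, sub_eq_zero, sub_eq_zero, sub_eq_zero]
  rfl

theorem wedge_formG_map_alpha (θ : DForm (n + 4) M (n + 2) 𝔤) (η : DForm (n + 4) M 2 𝔥) :
    (DForm.wedge Q.formG θ (η.map D.α.toLinearMap) : DForm (n + 4) M (n + 4) ℝ) =
      DForm.wedge Q.formH (θ.map Q.alphaStar) η :=
  DForm.wedge_map_right_eq _ _ _ _ (fun X Y => (Q.formH_alphaStar X Y).symm) _ _ _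

theorem wedge_formH_map_beta (θ : DForm (n + 4) M (n + 1) 𝔥) (η : DForm (n + 4) M 3 𝔩) :
    (DForm.wedge Q.formH θ (η.map D.β.toLinearMap) : DForm (n + 4) M (n + 4) ℝ) =
      DForm.wedge Q.formL (θ.map Q.betaStar) η :=
  DForm.wedge_map_right_eq _ _ _ _ (fun Y Z => (Q.formL_betaStar Y Z).symm) _ _ _

/-- Carrying `A` past the 2-form `B` is free, so only the minus sign in the definition of `σ`
remains. -/
theorem wedge_formH_actH (C : DForm (n + 4) M (n + 1) 𝔥) (A : DForm (n + 4) M 1 𝔤)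
    (B : DForm (n + 4) M 2 𝔥) :
    (DForm.wedge Q.formH C (DForm.wedge D.actHₗ A B : DForm (n + 4) M 3 𝔥) :
        DForm (n + 4) M (n + 4) ℝ) =
      -DForm.wedge Q.formG (DForm.wedge Q.sigma C B : DForm (n + 4) M (n + 3) 𝔤) A := by
  rw [DForm.wedge_swap D.actHₗ A B (by omega) (by omega), DForm.wedge_smul_right,
    DForm.wedge_assoc D.actHₗ.flip Q.formH (-Q.sigma) Q.formG
      (fun u v w => by simp [Q.formG_sigma]; rfl) C B A (by omega) (by omega)
      (u := n + 3) (by omega) (by omega), DForm.wedge_neg_bilin, DForm.wedge_neg_left]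
  simp

/-- Here `A` passes a 3-form, and the resulting sign cancels the minus in the definition of `κ`.
This is why the `σ` and `κ` terms enter the first gauge equation with opposite signs. -/
theorem wedge_formL_actL (E : DForm (n + 4) M n 𝔩) (A : DForm (n + 4) M 1 𝔤)
    (C : DForm (n + 4) M 3 𝔩) :
    (DForm.wedge Q.formL E (DForm.wedge D.actLₗ A C : DForm (n + 4) M 4 𝔩) :
        DForm (n + 4) M (n + 4) ℝ) =
      DForm.wedge Q.formG (DForm.wedge Q.kappa E C : DForm (n + 4) M (n + 3) 𝔤) A := by
  rw [DForm.wedge_swap D.actLₗ A C (by omega) (by omega), DForm.wedge_smul_right,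
    DForm.wedge_assoc D.actLₗ.flip Q.formL (-Q.kappa) Q.formG
      (fun u v w => by simp [Q.formG_kappa]; rfl) E C A (by omega) (by omega)
      (u := n + 3) (by omega) (by omega), DForm.wedge_neg_bilin, DForm.wedge_neg_left]
  simp [pow_succ]

/-- Isolates a variation in the second slot of the Peiffer lifting. The first slot needs `η₂`
instead, as the lifting is not assumed symmetric, and exchanging the two 2-forms there produces no
sign. -/
theorem wedge_formL_lift_right (E : DForm (n + 4) M n 𝔩) (B B' : DForm (n + 4) M 2 𝔥) :
    (DForm.wedge Q.formL E (DForm.wedge D.lift B B' : DForm (n + 4) M 4 𝔩) :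
        DForm (n + 4) M (n + 4) ℝ) =
      -DForm.wedge Q.formH (DForm.wedge Q.eta₁ E B : DForm (n + 4) M (n + 2) 𝔥) B' := by
  rw [DForm.wedge_assoc D.lift Q.formL (-Q.eta₁) Q.formH
      (fun u v w => by simp [Q.formH_eta₁]) E B B' (by omega) (by omega)
      (u := n + 2) (by omega) (by omega), DForm.wedge_neg_bilin, DForm.wedge_neg_left]

theorem wedge_formL_lift_left (E : DForm (n + 4) M n 𝔩) (B B' : DForm (n + 4) M 2 𝔥) :
    (DForm.wedge Q.formL E (DForm.wedge D.lift B' B : DForm (n + 4) M 4 𝔩) :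
        DForm (n + 4) M (n + 4) ℝ) =
      -DForm.wedge Q.formH (DForm.wedge Q.eta₂ E B : DForm (n + 4) M (n + 2) 𝔥) B' := by
  rw [DForm.wedge_swap D.lift B' B (by omega) (by omega), DForm.wedge_smul_right,
    DForm.wedge_assoc D.lift.flip Q.formL (-Q.eta₂) Q.formH
      (fun u v w => by simp [Q.formH_eta₂]) E B B' (by omega) (by omega)
      (u := n + 2) (by omega) (by omega), DForm.wedge_neg_bilin, DForm.wedge_neg_left]
  norm_num

variable [IsManifold (𝓡 (n + 4)) ∞ M]

/-- The derivative terms are integrated by parts and the algebraic ones transposed until `δA`, `δB`,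
`δC` stand undifferentiated on the right. Their cofactors are the residuals. The alternating signs
reflect the multiplier degrees `n + 2`, `n + 1`, `n`, and the identity holds before integration. -/
theorem gaugeVariation_eq {φ δ : GaugeField n M 𝔤 𝔥 𝔩} {m : Multipliers n M 𝔤 𝔥 𝔩}
    (hm : m.IsSmooth) (hδ : δ.IsSmooth) :
    gaugeVariation Q φ m δ =
      ((-1 : ℝ) ^ n • (-DForm.wedge Q.formG (residualA Q φ m) δ.A +
        DForm.wedge Q.formH (residualB Q φ m) δ.B - DForm.wedge Q.formL (residualC Q φ m) δ.C)) +
      (-1 : ℝ) ^ n • ((DForm.wedge Q.formG m.Bb δ.A : DForm (n + 4) M (n + 3) ℝ).extd -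
        (DForm.wedge Q.formH m.Cb δ.B : DForm (n + 4) M (n + 3) ℝ).extd +
        (DForm.wedge Q.formL m.Db δ.C : DForm (n + 4) M (n + 3) ℝ).extd) := by
  have hA := DForm.wedge_covariantDeriv Q.formG (lieBracketₗ 𝔤) Q.invG φ.A hm.1 hδ.1
    (r := n + 3) (by omega) (by omega) (by omega) (by omega) (by omega)
  have hB := DForm.wedge_covariantDeriv Q.formH D.actHₗ Q.invH φ.A hm.2.1 hδ.2.1
    (r := n + 3) (by omega) (by omega) (by omega) (by omega) (by omega)
  have hC := DForm.wedge_covariantDeriv Q.formL D.actLₗ Q.invL φ.A hm.2.2 hδ.2.2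
    (r := n + 3) (by omega) (by omega) (by omega) (by omega) (by omega)
  simp only [DForm.wedge_add_right, DForm.wedge_add_left] at hA hB hC
  simp only [gaugeVariation, GaugeField.varF, GaugeField.varG, GaugeField.varH, residualA,
    residualB, residualC, DForm.wedge_add_right, DForm.wedge_add_left, DForm.wedge_sub_right,
    DForm.wedge_sub_left, DForm.wedge_smul_left, wedge_formG_map_alpha, wedge_formH_map_beta]
  rw [eq_sub_of_add_eq hA, eq_sub_of_add_eq hB, eq_sub_of_add_eq hC, wedge_formH_actH Q m.Cb δ.A,
    wedge_formL_actL Q m.Db δ.A, wedge_formL_lift_left, wedge_formL_lift_right]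
  -- All remaining signs depend only on the parity of `n`, and in each case the identity is linear.
  rcases neg_one_pow_eq_or ℝ n with h | h <;> simp only [pow_add, h] <;> module

end GaugeVariation

/-! ### From vanishing gauge variation to the gauge equations -/

section Criticality

variable {n : ℕ} {M : Type*} [TopologicalSpace M] [ChartedSpace (Model (n + 4)) M]
  [IsManifold (𝓡 (n + 4)) ∞ M]
  {𝔤 𝔥 𝔩 : Type*} [NormedRealLieAlgebra 𝔤] [NormedRealLieAlgebra 𝔥] [NormedRealLieAlgebra 𝔩]
  [FiniteDimensional ℝ 𝔤] [FiniteDimensional ℝ 𝔥] [FiniteDimensional ℝ 𝔩]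
  {D : DifferentialTwoCrossedModule 𝔤 𝔥 𝔩} (Q : InvariantForms D)

theorem isSmooth_residualA {φ : GaugeField n M 𝔤 𝔥 𝔩} {m : Multipliers n M 𝔤 𝔥 𝔩}
    (hφ : φ.IsSmooth) (hm : m.IsSmooth) : (residualA Q φ m).IsSmooth :=
  (hm.1.extd.add (hφ.1.wedge _ hm.1 _)).sub
    (((hm.2.1.wedge _ hφ.2.1 _).smul _).add ((hm.2.2.wedge _ hφ.2.2 _).smul _))

theorem isSmooth_residualB {φ : GaugeField n M 𝔤 𝔥 𝔩} {m : Multipliers n M 𝔤 𝔥 𝔩}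
    (hφ : φ.IsSmooth) (hm : m.IsSmooth) : (residualB Q φ m).IsSmooth :=
  (hm.2.1.extd.add (hφ.1.wedge _ hm.2.1 _)).sub (((hm.1.map _).smul _).add
    (((hm.2.2.wedge _ hφ.2.1 _).add (hm.2.2.wedge _ hφ.2.1 _)).smul _))

theorem isSmooth_residualC {φ : GaugeField n M 𝔤 𝔥 𝔩} {m : Multipliers n M 𝔤 𝔥 𝔩}
    (hφ : φ.IsSmooth) (hm : m.IsSmooth) : (residualC Q φ m).IsSmooth :=
  (hm.2.2.extd.add (hφ.1.wedge _ hm.2.2 _)).sub ((hm.2.1.map _).smul _)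

variable [T2Space M]

theorem isTest_gaugeVariation {φ δ : GaugeField n M 𝔤 𝔥 𝔩} {m : Multipliers n M 𝔤 𝔥 𝔩}
    (hφ : φ.IsSmooth) (hm : m.IsSmooth) (hδ : δ.IsTest) : (gaugeVariation Q φ m δ).IsTest :=
  ((DForm.IsTest.wedge_right _ hm.1 (GaugeField.IsTest.varF D hφ hδ) _).add
    (DForm.IsTest.wedge_right _ hm.2.1 (GaugeField.IsTest.varG D hφ hδ) _)).add
    (DForm.IsTest.wedge_right _ hm.2.2 (GaugeField.IsTest.varH D hφ hδ) _)

variable [SigmaCompactSpace M]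

/-- Stokes' theorem kills the exact part. It applies to arbitrary smooth multipliers, because the
variation supplies the compact support. -/
theorem integral_gaugeVariation (hM : IsOrientedAtlas (n + 4) M) {φ δ : GaugeField n M 𝔤 𝔥 𝔩}
    {m : Multipliers n M 𝔤 𝔥 𝔩} (hφ : φ.IsSmooth) (hm : m.IsSmooth) (hδ : δ.IsTest) :
    (gaugeVariation Q φ m δ).integral =
      (-1 : ℝ) ^ n * (-DForm.wedge Q.formG (residualA Q φ m) δ.A +
        DForm.wedge Q.formH (residualB Q φ m) δ.B -
        DForm.wedge Q.formL (residualC Q φ m) δ.C : DForm (n + 4) M (n + 4) ℝ).integral := by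
  have hA := DForm.IsTest.wedge_right (r := n + 3) Q.formG hm.1 hδ.1 (by omega)
  have hB := DForm.IsTest.wedge_right (r := n + 3) Q.formH hm.2.1 hδ.2.1 (by omega)
  have hC := DForm.IsTest.wedge_right (r := n + 3) Q.formL hm.2.2 hδ.2.2 (by omega)
  have hAr := DForm.IsTest.wedge_right (r := n + 4) Q.formG (isSmooth_residualA Q hφ hm) hδ.1
    (by omega)
  have hBr := DForm.IsTest.wedge_right (r := n + 4) Q.formH (isSmooth_residualB Q hφ hm) hδ.2.1
    (by omega)
  have hCr := DForm.IsTest.wedge_right (r := n + 4) Q.formL (isSmooth_residualC Q hφ hm) hδ.2.2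
    (by omega)
  have hAn : (-DForm.wedge Q.formG (residualA Q φ m) δ.A : DForm (n + 4) M (n + 4) ℝ).IsTest :=
    ⟨hAr.1.neg, hAr.2.neg⟩
  have hS : ∀ {θ : DForm (n + 4) M (n + 3) ℝ}, θ.IsTest → θ.extd.integral = 0 := fun h =>
    DForm.integral_extd_eq_zero (m := n + 3) hM h.1 h.2
  rw [gaugeVariation_eq Q hm hδ.isSmooth, ((hAn.add hBr).sub hCr |>.smul _).integral_add
    (((hA.extd.sub hB.extd).add hC.extd).smul _), DForm.integral_smul, DForm.integral_smul,
    (hA.extd.sub hB.extd).integral_add hC.extd, sub_eq_add_neg (DForm.extd _),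
    ← neg_one_smul ℝ (DForm.extd _), hA.extd.integral_add (hB.extd.smul _), DForm.integral_smul,
    hS hA, hS hB, hS hC]
  simp

/-- The integrated variation of the gauge field vanishes for all test variations if and only if the
gauge equations hold. -/
theorem forall_integral_gaugeVariation_iff (hM : IsOrientedAtlas (n + 4) M)
    {φ : GaugeField n M 𝔤 𝔥 𝔩} {m : Multipliers n M 𝔤 𝔥 𝔩} (hφ : φ.IsSmooth) (hm : m.IsSmooth) :
    (∀ δ : GaugeField n M 𝔤 𝔥 𝔩, δ.IsTest → (gaugeVariation Q φ m δ).integral = 0) ↔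
      GaugeEquations3BFYM Q φ m := by
  rw [gaugeEquations_iff_residual]
  constructor
  · intro H
    have hs : (-1 : ℝ) ^ n ≠ 0 := pow_ne_zero _ (by norm_num)
    refine ⟨?_, ?_, ?_⟩
    -- One component of the gauge field is varied at a time, which isolates one residual. The
    -- fundamental lemma has the test form on the left, so the factors are exchanged, at the price
    -- of a sign only.
    · refine eq_zero_of_integral_wedge_eq_zero (p := 1) (q := n + 3) hM Q.formG Q.eq_zero_of_formG
        (by omega) (isSmooth_residualA Q hφ hm) fun δ hδ hδc => ?_
      have hδ' : GaugeField.IsTest (⟨δ, 0, 0⟩ : GaugeField n M 𝔤 𝔥 𝔩) :=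
        ⟨⟨hδ, hδc⟩, DForm.isTest_zero, DForm.isTest_zero⟩
      have h := H _ hδ'
      rw [integral_gaugeVariation Q hM hφ hm hδ', mul_eq_zero_iff_left hs] at h
      rw [DForm.wedge_comm_of_symm Q.symmG δ _ (by omega) (by omega), DForm.integral_smul,
        mul_eq_zero]
      rw [DForm.wedge_zero_right, DForm.wedge_zero_right, add_zero, sub_zero,
        ← neg_one_smul ℝ (DForm.wedge _ _ _ _), DForm.integral_smul] at h
      exact Or.inr (by linarith)
    · refine eq_zero_of_integral_wedge_eq_zero (p := 2) (q := n + 2) hM Q.formH Q.eq_zero_of_formH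
        (by omega) (isSmooth_residualB Q hφ hm) fun δ hδ hδc => ?_
      have hδ' : GaugeField.IsTest (⟨0, δ, 0⟩ : GaugeField n M 𝔤 𝔥 𝔩) :=
        ⟨DForm.isTest_zero, ⟨hδ, hδc⟩, DForm.isTest_zero⟩
      have h := H _ hδ'
      rw [integral_gaugeVariation Q hM hφ hm hδ', mul_eq_zero_iff_left hs] at h
      rw [DForm.wedge_comm_of_symm Q.symmH δ _ (by omega) (by omega), DForm.integral_smul,
        mul_eq_zero]
      rw [DForm.wedge_zero_right, DForm.wedge_zero_right, sub_zero, neg_zero, zero_add] at h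
      exact Or.inr h
    · refine eq_zero_of_integral_wedge_eq_zero (p := 3) (q := n + 1) hM Q.formL Q.eq_zero_of_formL
        (by omega) (isSmooth_residualC Q hφ hm) fun δ hδ hδc => ?_
      have hδ' : GaugeField.IsTest (⟨0, 0, δ⟩ : GaugeField n M 𝔤 𝔥 𝔩) :=
        ⟨DForm.isTest_zero, DForm.isTest_zero, ⟨hδ, hδc⟩⟩
      have h := H _ hδ'
      rw [integral_gaugeVariation Q hM hφ hm hδ', mul_eq_zero_iff_left hs] at h
      rw [DForm.wedge_comm_of_symm Q.symmL δ _ (by omega) (by omega), DForm.integral_smul,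
        mul_eq_zero]
      rw [DForm.wedge_zero_right, DForm.wedge_zero_right, neg_zero, zero_add, zero_sub,
        ← neg_one_smul ℝ (DForm.wedge _ _ _ _), DForm.integral_smul] at h
      exact Or.inr (by linarith)
  · rintro ⟨hA, hB, hC⟩ δ hδ
    rw [integral_gaugeVariation Q hM hφ hm hδ, hA, hB, hC, DForm.wedge_zero_left,
      DForm.wedge_zero_left, DForm.wedge_zero_left]
    simp [DForm.integral_zero]

end Criticality

/-! ### First variation of terms containing the Hodge star -/

section FirstVariation

variable {d p q : ℕ} {M : Type*} [TopologicalSpace M] [ChartedSpace (Model d) M]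
  [IsManifold (𝓡 d) ∞ M] {V : Type*} [NormedAddCommGroup V] [NormedSpace ℝ V]
  [FiniteDimensional ℝ V]

/-- The first variation of `⟨θ, η⟩ + c ⟨θ, *θ⟩`. -/
theorem DForm.firstVariation_wedge_add_hodge (hM : IsOrientedAtlas d M) {σ : ℝ} (hσ : σ = 1 ∨ σ = -1)
    (hd : 0 < d) (g : MetricTensor d M σ) (b : V →ₗ[ℝ] V →ₗ[ℝ] ℝ) (hb : ∀ v w, b v w = b w v)
    (h : p + q = d) (c : ℝ) {θ : ℝ → DForm d M p V} {η : ℝ → DForm d M q V}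
    {θ₀ θ₁ : DForm d M p V} {η₀ η₁ η₂ : DForm d M q V} (hθ₀ : θ₀.IsSmooth) (hθ₁ : θ₁.IsTest)
    (hη₀ : η₀.IsSmooth) (hη₁ : η₁.IsTest) (hη₂ : η₂.IsTest) (hθ : ∀ t, θ t = θ₀ + t • θ₁)
    (hη : ∀ t, η t = η₀ + t • η₁ + t ^ 2 • η₂) :
    FirstVariation (fun t => wedge b (θ t) (η t) h + c • wedge b (θ t) ((θ t).hodge g h) h)
      (wedge b θ₁ (η₀ + (2 * c) • θ₀.hodge g h) h + wedge b θ₀ η₁ h) := by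
  have hθ' : ∀ t, θ t = θ₀ + t • θ₁ + t ^ 2 • (0 : DForm d M p V) := fun t => by
    rw [hθ, smul_zero, add_zero]
  have h1 := firstVariation_wedge b h hθ₀ hθ₁ isTest_zero hη₀ hη₁ hη₂ hθ' hη
  have h2 := firstVariation_wedge (η := fun t => (θ t).hodge g h) b h hθ₀ hθ₁ isTest_zero
    (hθ₀.hodge hM hσ g h) (hθ₁.hodge hM hσ g h) isTest_zero hθ'
    (fun t => by rw [hθ, hodge_add, hodge_smul, smul_zero, add_zero])
  convert h1.add (h2.smul c) using 1
  -- The two cross terms of the quadratic form `⟨θ, *θ⟩` agree by symmetry, which is the origin of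
  -- the factor `2` in the multiplier equations.
  rw [wedge_hodge_symm g hσ hd b hb θ₀ θ₁ h, wedge_add_right, wedge_smul_right]
  module

/-- The first variation of `⟨θ, *θ⟩`. -/
theorem DForm.firstVariation_wedge_hodge (hM : IsOrientedAtlas d M) {σ : ℝ} (hσ : σ = 1 ∨ σ = -1)
    (hd : 0 < d) (g : MetricTensor d M σ) (b : V →ₗ[ℝ] V →ₗ[ℝ] ℝ) (hb : ∀ v w, b v w = b w v)
    (h : p + q = d) {θ : ℝ → DForm d M p V} {θ₀ θ₁ θ₂ : DForm d M p V} (hθ₀ : θ₀.IsSmooth)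
    (hθ₁ : θ₁.IsTest) (hθ₂ : θ₂.IsTest) (hθ : ∀ t, θ t = θ₀ + t • θ₁ + t ^ 2 • θ₂) :
    FirstVariation (fun t => wedge b (θ t) ((θ t).hodge g h) h)
      ((2 : ℝ) • wedge b θ₁ (θ₀.hodge g h) h) := by
  have h2 := firstVariation_wedge (η := fun t => (θ t).hodge g h) b h hθ₀ hθ₁ hθ₂
    (hθ₀.hodge hM hσ g h) (hθ₁.hodge hM hσ g h) (hθ₂.hodge hM hσ g h) hθ
    (fun t => by rw [hθ, hodge_add, hodge_add, hodge_smul, hodge_smul])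
  convert h2 using 1
  rw [wedge_hodge_symm g hσ hd b hb θ₀ θ₁ h]
  module

end FirstVariation

/-! ### Euler-Lagrange equations of the 3BFYM action -/

section EulerLagrange

variable {n : ℕ} {M : Type*} [TopologicalSpace M] [ChartedSpace (Model (n + 4)) M]
  [IsManifold (𝓡 (n + 4)) ∞ M] [T2Space M]
  {𝔤 𝔥 𝔩 : Type*} [NormedRealLieAlgebra 𝔤] [NormedRealLieAlgebra 𝔥] [NormedRealLieAlgebra 𝔩]
  [FiniteDimensional ℝ 𝔤] [FiniteDimensional ℝ 𝔥] [FiniteDimensional ℝ 𝔩]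
  {D : DifferentialTwoCrossedModule 𝔤 𝔥 𝔩} (Q : InvariantForms D)
  {σ : ℝ} (g : MetricTensor (n + 4) M σ)

/-- The linear term of the 3BFYM Lagrangian for a variation of the multipliers. -/
def multiplierVariation (e : ℝ) (φ : GaugeField n M 𝔤 𝔥 𝔩) (m δ : Multipliers n M 𝔤 𝔥 𝔩) :
    DForm (n + 4) M (n + 4) ℝ :=
  DForm.wedge Q.formG δ.Bb (φ.curvF D + (2 * e ^ 2) • m.Bb.hodge g) +
    DForm.wedge Q.formH δ.Cb (φ.curvG D + (2 * e ^ 2) • m.Cb.hodge g) +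
    DForm.wedge Q.formL δ.Db (φ.curvH D + (2 * e ^ 2) • m.Db.hodge g)

theorem firstVariation_lagrangian3BFYM (hM : IsOrientedAtlas (n + 4) M) (hσ : σ = 1 ∨ σ = -1)
    (e : ℝ) {φ δ : GaugeField n M 𝔤 𝔥 𝔩} {m δm : Multipliers n M 𝔤 𝔥 𝔩} (hφ : φ.IsSmooth)
    (hδ : δ.IsTest) (hm : m.IsSmooth) (hδm : δm.IsTest) :
    DForm.FirstVariation (fun t => lagrangian3BFYM Q g e (φ.vary δ t) (m.vary δm t))
      (multiplierVariation Q g e φ m δm + gaugeVariation Q φ m δ) := by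
  have hF := DForm.firstVariation_wedge_add_hodge hM hσ (by omega) g Q.formG Q.symmG (by omega)
    (e ^ 2) hm.1 hδm.1 (hφ.curvF D) (GaugeField.IsTest.varF D hφ hδ)
    ((hδ.1.wedge_left (lieBracketₗ 𝔤) hδ.1.1 (by omega)).smul (1 / 2))
    (fun t => rfl) (GaugeField.curvF_vary D hφ hδ.isSmooth)
  have hG := DForm.firstVariation_wedge_add_hodge hM hσ (by omega) g Q.formH Q.symmH (by omega)
    (e ^ 2) hm.2.1 hδm.2.1 (hφ.curvG D) (GaugeField.IsTest.varG D hφ hδ)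
    (hδ.1.wedge_left D.actHₗ hδ.2.1.1 (by omega))
    (fun t => rfl) (GaugeField.curvG_vary D hφ hδ.isSmooth)
  have hH := DForm.firstVariation_wedge_add_hodge hM hσ (by omega) g Q.formL Q.symmL (by omega)
    (e ^ 2) hm.2.2 hδm.2.2 (hφ.curvH D) (GaugeField.IsTest.varH D hφ hδ)
    ((hδ.1.wedge_left D.actLₗ hδ.2.2.1 (by omega)).add
      (hδ.2.1.wedge_left D.lift hδ.2.1.1 (by omega)))
    (fun t => rfl) (GaugeField.curvH_vary D hφ hδ.isSmooth)
  convert (hF.add hG).add hH using 1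
  · funext t
    simp only [lagrangian3BFYM, Multipliers.vary, add_assoc]
  · rw [multiplierVariation, gaugeVariation]
    abel

theorem isTest_multiplierVariation (hM : IsOrientedAtlas (n + 4) M) (hσ : σ = 1 ∨ σ = -1) (e : ℝ)
    {φ : GaugeField n M 𝔤 𝔥 𝔩} {m δ : Multipliers n M 𝔤 𝔥 𝔩} (hφ : φ.IsSmooth)
    (hm : m.IsSmooth) (hδ : δ.IsTest) : (multiplierVariation Q g e φ m δ).IsTest :=
  ((hδ.1.wedge_left _ ((hφ.curvF D).add ((hm.1.hodge hM hσ g _).smul _)) _).add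
    (hδ.2.1.wedge_left _ ((hφ.curvG D).add ((hm.2.1.hodge hM hσ g _).smul _)) _)).add
    (hδ.2.2.wedge_left _ ((hφ.curvH D).add ((hm.2.2.hodge hM hσ g _).smul _)) _)

variable [SigmaCompactSpace M]

/-- The multipliers enter without derivatives, so the fundamental lemma applies directly, one
component at a time, without integration by parts. -/
theorem forall_integral_multiplierVariation_iff (hM : IsOrientedAtlas (n + 4) M)
    (hσ : σ = 1 ∨ σ = -1) (e : ℝ) {φ : GaugeField n M 𝔤 𝔥 𝔩} {m : Multipliers n M 𝔤 𝔥 𝔩}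
    (hφ : φ.IsSmooth) (hm : m.IsSmooth) :
    (∀ δ : Multipliers n M 𝔤 𝔥 𝔩, δ.IsTest → (multiplierVariation Q g e φ m δ).integral = 0) ↔
      MultiplierEquations g D e φ m := by
  constructor
  · intro H
    refine ⟨?_, ?_, ?_⟩
    · refine eq_zero_of_integral_wedge_eq_zero (p := n + 2) (q := 2) hM Q.formG Q.eq_zero_of_formG
        (by omega) ((hφ.curvF D).add ((hm.1.hodge hM hσ g _).smul _)) fun δ hδ hδc => ?_
      have h := H ⟨δ, 0, 0⟩ ⟨⟨hδ, hδc⟩, DForm.isTest_zero, DForm.isTest_zero⟩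
      rwa [multiplierVariation, DForm.wedge_zero_left, DForm.wedge_zero_left, add_zero,
        add_zero] at h
    · refine eq_zero_of_integral_wedge_eq_zero (p := n + 1) (q := 3) hM Q.formH Q.eq_zero_of_formH
        (by omega) ((hφ.curvG D).add ((hm.2.1.hodge hM hσ g _).smul _)) fun δ hδ hδc => ?_
      have h := H ⟨0, δ, 0⟩ ⟨DForm.isTest_zero, ⟨hδ, hδc⟩, DForm.isTest_zero⟩
      rwa [multiplierVariation, DForm.wedge_zero_left, DForm.wedge_zero_left, add_zero,
        zero_add] at h
    · refine eq_zero_of_integral_wedge_eq_zero (p := n) (q := 4) hM Q.formL Q.eq_zero_of_formL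
        (by omega) ((hφ.curvH D).add ((hm.2.2.hodge hM hσ g _).smul _)) fun δ hδ hδc => ?_
      have h := H ⟨0, 0, δ⟩ ⟨DForm.isTest_zero, DForm.isTest_zero, ⟨hδ, hδc⟩⟩
      rwa [multiplierVariation, DForm.wedge_zero_left, DForm.wedge_zero_left, add_zero,
        zero_add] at h
  · rintro ⟨hF, hG, hH⟩ δ -
    rw [multiplierVariation, hF, hG, hH, DForm.wedge_zero_right, DForm.wedge_zero_right,
      DForm.wedge_zero_right, add_zero, add_zero, DForm.integral_zero]

/-- The equations of motion of the 3BFYM action. -/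
theorem isCritical3BFYM_iff (hM : IsOrientedAtlas (n + 4) M) (hσ : σ = 1 ∨ σ = -1) (e : ℝ)
    {φ : GaugeField n M 𝔤 𝔥 𝔩} {m : Multipliers n M 𝔤 𝔥 𝔩} (hφ : φ.IsSmooth) (hm : m.IsSmooth) :
    IsCritical3BFYM Q g e φ m ↔ MultiplierEquations g D e φ m ∧ GaugeEquations3BFYM Q φ m := by
  have hcrit : IsCritical3BFYM Q g e φ m ↔ ∀ (δ : GaugeField n M 𝔤 𝔥 𝔩)
      (δm : Multipliers n M 𝔤 𝔥 𝔩), δ.IsTest → δm.IsTest →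
        (multiplierVariation Q g e φ m δm).integral + (gaugeVariation Q φ m δ).integral = 0 := by
    have key : ∀ (δ : GaugeField n M 𝔤 𝔥 𝔩) (δm : Multipliers n M 𝔤 𝔥 𝔩), δ.IsTest → δm.IsTest →
        (HasDerivAt (fun t : ℝ => (lagrangian3BFYM Q g e (φ.vary δ t) (m.vary δm t) -
          lagrangian3BFYM Q g e φ m : DForm (n + 4) M (n + 4) ℝ).integral) 0 0 ↔
        (multiplierVariation Q g e φ m δm).integral + (gaugeVariation Q φ m δ).integral = 0) := by
      intro δ δm hδ hδm
      have h := (firstVariation_lagrangian3BFYM Q g hM hσ e hφ hδ hm hδm).hasDerivAt_zero_iff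
      rwa [(isTest_multiplierVariation Q g hM hσ e hφ hm hδm).integral_add
        (isTest_gaugeVariation Q hφ hm hδ), φ.vary_zero, m.vary_zero] at h
    constructor
    · intro H δ δm hδ hδm
      exact (key δ δm hδ hδm).1 (H δ δm hδ.isSmooth ⟨hδ.1.2, hδ.2.1.2, hδ.2.2.2⟩
        ⟨hδm.1.1, hδm.2.1.1, hδm.2.2.1⟩ ⟨hδm.1.2, hδm.2.1.2, hδm.2.2.2⟩)
    · intro H δ δm h1 h2 h3 h4
      have hδ : δ.IsTest := ⟨⟨h1.1, h2.1⟩, ⟨h1.2.1, h2.2.1⟩, ⟨h1.2.2, h2.2.2⟩⟩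
      have hδm : δm.IsTest := ⟨⟨h3.1, h4.1⟩, ⟨h3.2.1, h4.2.1⟩, ⟨h3.2.2, h4.2.2⟩⟩
      exact (key δ δm hδ hδm).2 (H δ δm hδ hδm)
  rw [hcrit, ← forall_integral_multiplierVariation_iff Q g hM hσ e hφ hm,
    ← forall_integral_gaugeVariation_iff Q hM hφ hm]
  -- The joint first variation is a sum of two independent parts. Setting the variation of the gauge
  -- field, or that of the multipliers, to zero separates them.
  constructor
  · intro H
    constructor
    · intro δm hδm
      have h0 : GaugeField.IsTest (⟨0, 0, 0⟩ : GaugeField n M 𝔤 𝔥 𝔩) :=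
        ⟨DForm.isTest_zero, DForm.isTest_zero, DForm.isTest_zero⟩
      have h := H _ δm h0 hδm
      rwa [integral_gaugeVariation Q hM hφ hm h0, DForm.wedge_zero_right, DForm.wedge_zero_right,
        DForm.wedge_zero_right, neg_zero, add_zero, sub_zero, DForm.integral_zero, mul_zero,
        add_zero] at h
    · intro δ hδ
      have h := H δ ⟨0, 0, 0⟩ hδ ⟨DForm.isTest_zero, DForm.isTest_zero, DForm.isTest_zero⟩
      rwa [multiplierVariation, DForm.wedge_zero_left, DForm.wedge_zero_left,
        DForm.wedge_zero_left, add_zero, add_zero, DForm.integral_zero, zero_add] at h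
  · rintro ⟨h1, h2⟩ δ δm hδ hδm
    rw [h1 δm hδm, h2 δ hδ, add_zero]

end EulerLagrange

/-! ### Elimination of the multipliers and the 3YM theory -/

section SolvedMultipliers

variable {n : ℕ} {M : Type*} [TopologicalSpace M] [ChartedSpace (Model (n + 4)) M]
  [IsManifold (𝓡 (n + 4)) ∞ M]
  {𝔤 𝔥 𝔩 : Type*} [NormedRealLieAlgebra 𝔤] [NormedRealLieAlgebra 𝔥] [NormedRealLieAlgebra 𝔩]
  [FiniteDimensional ℝ 𝔤] [FiniteDimensional ℝ 𝔥] [FiniteDimensional ℝ 𝔩]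
  {D : DifferentialTwoCrossedModule 𝔤 𝔥 𝔩} (Q : InvariantForms D)
  {σ : ℝ} (g : MetricTensor (n + 4) M σ)

/-- Solving `η + 2e² *θ = 0` for `θ`. -/
theorem DForm.add_hodge_eq_zero_iff {d p q : ℕ} {M : Type*} [TopologicalSpace M]
    [ChartedSpace (Model d) M] [IsManifold (𝓡 d) ∞ M] {V : Type*} [NormedAddCommGroup V]
    [NormedSpace ℝ V] {σ : ℝ} (hσ : σ = 1 ∨ σ = -1) (hd : 0 < d) (g : MetricTensor d M σ) {e : ℝ}
    (he : e ≠ 0) (θ : DForm d M p V) (η : DForm d M q V) (h : p + q = d) (h' : q + p = d) :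
    η + (2 * e ^ 2) • θ.hodge g h = 0 ↔
      θ = (-((-1) ^ (p * q) * (σ / (2 * e ^ 2)))) • η.hodge g h' := by
  -- Both scalars in `** = (-1)^(pq) σ` square to one, so the star inverts itself up to that sign.
  have hs : ((-1 : ℝ) ^ (p * q)) * (-1) ^ (p * q) = 1 := neg_one_pow_mul_self _
  have hσ2 : σ * σ = 1 := by rcases hσ with h | h <;> rw [h] <;> norm_num
  have he2 : 2 * e ^ 2 ≠ 0 := by positivity
  constructor
  · intro H
    have h1 : η = (-(2 * e ^ 2)) • θ.hodge g h := by
      rw [neg_smul]; exact eq_neg_of_add_eq_zero_left H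
    rw [h1, hodge_smul, hodge_hodge g hσ hd, smul_smul, smul_smul, mul_assoc]
    have : -((-1) ^ (p * q) * (σ / (2 * e ^ 2))) * (-(2 * e ^ 2) * ((-1) ^ (p * q) * σ)) =
        ((-1 : ℝ) ^ (p * q)) * (-1) ^ (p * q) * (σ * σ) * ((2 * e ^ 2) / (2 * e ^ 2)) := by ring
    rw [this, hs, hσ2, div_self he2]
    simp
  · intro H
    rw [H, hodge_smul, hodge_hodge g hσ hd, smul_smul, smul_smul, mul_comm q p,
      mul_assoc (2 * e ^ 2)]
    have : 2 * e ^ 2 * (-((-1) ^ (p * q) * (σ / (2 * e ^ 2))) * ((-1) ^ (p * q) * σ)) =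
        -(((-1 : ℝ) ^ (p * q)) * (-1) ^ (p * q) * (σ * σ) * ((2 * e ^ 2) / (2 * e ^ 2))) := by ring
    rw [this, hs, hσ2, div_self he2]
    simp

/-- For a solved multiplier the quadratic term is minus half of the linear one. Half of the linear
term survives, which turns the coefficient `1/(2e²)` of the multipliers into the `1/(4e²)` of the
3YM action. -/
theorem DForm.smul_wedge_hodge_of_eq {d p q : ℕ} {M : Type*} [TopologicalSpace M]
    [ChartedSpace (Model d) M] {V : Type*} [NormedAddCommGroup V] [NormedSpace ℝ V]
    [FiniteDimensional ℝ V] {σ : ℝ} (g : MetricTensor d M σ) (b : LinearMap.BilinForm ℝ V) {e : ℝ}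
    {θ : DForm d M p V} {η : DForm d M q V} (h : p + q = d)
    (hη : η + (2 * e ^ 2) • θ.hodge g h = 0) :
    e ^ 2 • DForm.wedge b θ (θ.hodge g h) h = (-(1 / 2) : ℝ) • DForm.wedge b θ η h := by
  rw [eq_neg_of_add_eq_zero_left hη, DForm.wedge_neg_right, DForm.wedge_smul_right]
  module

theorem eq_iff_of_eq_smul {E : Type*} [AddCommGroup E] [Module ℝ E] {a : ℝ} {x y x' y' : E}
    (ha : a ≠ 0) (hx : x = a • x') (hy : y = a • y') : x = y ↔ x' = y' := by
  rw [hx, hy]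
  exact (smul_right_injective E ha).eq_iff

/-- The sign `(-1)^(pq)` of `**` is trivial for the degree pairs `(n+2, 2)` and `(n, 4)` but equals
`(-1)^(n+1)` for `(n+1, 3)`. This explains why only `C̄` carries a factor `(-1)^d`. -/
theorem multiplierEquations_iff (hσ : σ = 1 ∨ σ = -1) {e : ℝ} (he : e ≠ 0)
    (φ : GaugeField n M 𝔤 𝔥 𝔩) (m : Multipliers n M 𝔤 𝔥 𝔩) :
    MultiplierEquations g D e φ m ↔ m = solvedMultipliers g D e φ := by
  have hd : 0 < n + 4 := by omega
  have h1 : (-1 : ℝ) ^ ((n + 2) * 2) = 1 := by rw [mul_comm, pow_mul]; norm_num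
  have h2 : -((-1 : ℝ) ^ ((n + 1) * 3)) = (-1) ^ (n + 4) := by
    rw [mul_comm, pow_mul]; norm_num [pow_add]
  have h3 : (-1 : ℝ) ^ (n * 4) = 1 := by rw [mul_comm, pow_mul]; norm_num
  rw [MultiplierEquations, DForm.add_hodge_eq_zero_iff hσ hd g he m.Bb _ _ (by omega),
    DForm.add_hodge_eq_zero_iff hσ hd g he m.Cb _ _ (by omega),
    DForm.add_hodge_eq_zero_iff hσ hd g he m.Db _ _ (by omega), ← neg_mul ((-1 : ℝ) ^ ((n + 1) * 3)),
    h1, h2, h3, one_mul]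
  obtain ⟨Bb, Cb, Db⟩ := m
  simp only [solvedMultipliers, Multipliers.mk.injEq]

theorem isSmooth_solvedMultipliers (hM : IsOrientedAtlas (n + 4) M) (hσ : σ = 1 ∨ σ = -1) (e : ℝ)
    {φ : GaugeField n M 𝔤 𝔥 𝔩} (hφ : φ.IsSmooth) : (solvedMultipliers g D e φ).IsSmooth :=
  ⟨((hφ.curvF D).hodge hM hσ g _).smul _, ((hφ.curvG D).hodge hM hσ g _).smul _,
    ((hφ.curvH D).hodge hM hσ g _).smul _⟩

/-- With `c = σ/(2e²)`, the three gauge equations are the Yang-Mills equations multiplied by `-c`,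
`(-1)^d c` and `-c`. These are non-zero constants, which also shows why the coupling disappears from
the equations. -/
theorem gaugeEquations_solvedMultipliers_iff (hσ : σ = 1 ∨ σ = -1) {e : ℝ} (he : e ≠ 0)
    (φ : GaugeField n M 𝔤 𝔥 𝔩) :
    GaugeEquations3BFYM Q φ (solvedMultipliers g D e φ) ↔ Equations3YM Q g φ := by
  have hc : σ / (2 * e ^ 2) ≠ 0 :=
    div_ne_zero (by rcases hσ with h | h <;> rw [h] <;> norm_num) (by positivity)
  simp only [GaugeEquations3BFYM, Equations3YM, solvedMultipliers, DForm.extd_smul,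
    DForm.wedge_smul_left, DForm.wedge_smul_right, DForm.map_smul_form]
  generalize σ / (2 * e ^ 2) = c at hc
  have hs : (-1 : ℝ) ^ (n + 4) ≠ 0 := pow_ne_zero _ (by norm_num)
  refine and_congr (eq_iff_of_eq_smul (neg_ne_zero.2 hc) (by module) ?_)
    (and_congr (eq_iff_of_eq_smul (mul_ne_zero hs hc) (by module) ?_)
      (eq_iff_of_eq_smul (neg_ne_zero.2 hc) (by module) ?_))
  all_goals
    rcases neg_one_pow_eq_or ℝ n with h | h <;> simp only [pow_add, h] <;> module

theorem lagrangian3BFYM_solvedMultipliers (hσ : σ = 1 ∨ σ = -1) {e : ℝ} (he : e ≠ 0)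
    (φ : GaugeField n M 𝔤 𝔥 𝔩) :
    lagrangian3BFYM Q g e φ (solvedMultipliers g D e φ) = lagrangian3YM Q g e φ := by
  obtain ⟨hF, hG, hH⟩ := (multiplierEquations_iff g hσ he φ _).2 rfl
  rw [lagrangian3BFYM, DForm.smul_wedge_hodge_of_eq g Q.formG _ hF,
    DForm.smul_wedge_hodge_of_eq g Q.formH _ hG, DForm.smul_wedge_hodge_of_eq g Q.formL _ hH,
    lagrangian3YM]
  simp only [solvedMultipliers, DForm.wedge_smul_left]
  -- Moving the star to the right factor produces, in the middle term, a sign that combines with the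
  -- `(-1)^d` of `C̄` to a minus. All three terms then carry the same coefficient.
  rw [DForm.wedge_comm_of_symm Q.symmG _ (φ.curvF D) (by omega) (by omega),
    DForm.wedge_comm_of_symm Q.symmH _ (φ.curvG D) (by omega) (by omega),
    DForm.wedge_comm_of_symm Q.symmL _ (φ.curvH D) (by omega) (by omega)]
  have hc : σ / (4 * e ^ 2) = 1 / 2 * (σ / (2 * e ^ 2)) := by field_simp; norm_num
  rw [hc]
  rcases neg_one_pow_eq_or ℝ n with h | h <;> simp only [pow_add, pow_mul, h] <;> module

variable [T2Space M]

/-- This is the envelope principle: the multipliers are stationary at their solved values, so only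
the explicit dependence on the gauge field contributes to the variation. Here it is verified
directly, and the two linear terms agree as forms, not only after integration. -/
theorem firstVariation_lagrangian3YM (hM : IsOrientedAtlas (n + 4) M) (hσ : σ = 1 ∨ σ = -1)
    {e : ℝ} (he : e ≠ 0) {φ δ : GaugeField n M 𝔤 𝔥 𝔩} (hφ : φ.IsSmooth) (hδ : δ.IsTest) :
    DForm.FirstVariation (fun t => lagrangian3YM Q g e (φ.vary δ t))
      (gaugeVariation Q φ (solvedMultipliers g D e φ) δ) := by
  have hF := DForm.firstVariation_wedge_hodge hM hσ (by omega) g Q.formG Q.symmG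
    (q := n + 2) (by omega) (hφ.curvF D) (GaugeField.IsTest.varF D hφ hδ)
    ((hδ.1.wedge_left (lieBracketₗ 𝔤) hδ.1.1 (by omega)).smul (1 / 2))
    (GaugeField.curvF_vary D hφ hδ.isSmooth)
  have hG := DForm.firstVariation_wedge_hodge hM hσ (by omega) g Q.formH Q.symmH
    (q := n + 1) (by omega) (hφ.curvG D) (GaugeField.IsTest.varG D hφ hδ)
    (hδ.1.wedge_left D.actHₗ hδ.2.1.1 (by omega))
    (GaugeField.curvG_vary D hφ hδ.isSmooth)
  have hH := DForm.firstVariation_wedge_hodge hM hσ (by omega) g Q.formL Q.symmL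
    (q := n) (by omega) (hφ.curvH D) (GaugeField.IsTest.varH D hφ hδ)
    ((hδ.1.wedge_left D.actLₗ hδ.2.2.1 (by omega)).add
      (hδ.2.1.wedge_left D.lift hδ.2.1.1 (by omega)))
    (GaugeField.curvH_vary D hφ hδ.isSmooth)
  refine Eq.mp (congrArg _ ?_) (((hF.add hG).add hH).smul (-(σ / (4 * e ^ 2))))
  simp only [gaugeVariation, solvedMultipliers, DForm.wedge_smul_left]
  rw [DForm.wedge_comm_of_symm Q.symmG _ (φ.varF D δ) (by omega) (by omega),
    DForm.wedge_comm_of_symm Q.symmH _ (φ.varG D δ) (by omega) (by omega),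
    DForm.wedge_comm_of_symm Q.symmL _ (φ.varH D δ) (by omega) (by omega)]
  have hc : σ / (4 * e ^ 2) = 1 / 2 * (σ / (2 * e ^ 2)) := by field_simp; norm_num
  rw [hc]
  rcases neg_one_pow_eq_or ℝ n with h | h <;> simp only [pow_add, pow_mul, h] <;> module

variable [SigmaCompactSpace M]

/-- The equations of motion of the 3YM action. -/
theorem isCritical3YM_iff (hM : IsOrientedAtlas (n + 4) M) (hσ : σ = 1 ∨ σ = -1) {e : ℝ}
    (he : e ≠ 0) {φ : GaugeField n M 𝔤 𝔥 𝔩} (hφ : φ.IsSmooth) :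
    IsCritical3YM Q g e φ ↔ Equations3YM Q g φ := by
  -- The Yang-Mills equations are traded for the gauge equations at the solved multipliers, and
  -- these for the vanishing of the gauge variation there, which is literally the criticality
  -- condition.
  rw [← gaugeEquations_solvedMultipliers_iff Q g hσ he,
    ← forall_integral_gaugeVariation_iff Q hM hφ (isSmooth_solvedMultipliers g hM hσ e hφ)]
  have key : ∀ δ : GaugeField n M 𝔤 𝔥 𝔩, δ.IsTest →
      (HasDerivAt (fun t : ℝ => (lagrangian3YM Q g e (φ.vary δ t) -
        lagrangian3YM Q g e φ : DForm (n + 4) M (n + 4) ℝ).integral) 0 0 ↔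
      (gaugeVariation Q φ (solvedMultipliers g D e φ) δ).integral = 0) := by
    intro δ hδ
    have h := (firstVariation_lagrangian3YM Q g hM hσ he hφ hδ).hasDerivAt_zero_iff
    rwa [φ.vary_zero] at h
  constructor
  · intro H δ hδ
    exact (key δ hδ).1 (H δ hδ.isSmooth ⟨hδ.1.2, hδ.2.1.2, hδ.2.2.2⟩)
  · intro H δ h1 h2
    have hδ : δ.IsTest := ⟨⟨h1.1, h2.1⟩, ⟨h1.2.1, h2.2.1⟩, ⟨h1.2.2, h2.2.2⟩⟩
    exact (key δ hδ).2 (H δ hδ)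

/-- The 3BFYM action of multipliers with compact support tends to the 3BF action. -/
theorem tendsto_action3BFYM (hM : IsOrientedAtlas (n + 4) M) (hσ : σ = 1 ∨ σ = -1)
    {φ : GaugeField n M 𝔤 𝔥 𝔩} {m : Multipliers n M 𝔤 𝔥 𝔩} (hφ : φ.IsSmooth) (hm : m.IsTest) :
    Filter.Tendsto (fun ε : ℝ => action3BFYM Q g ε φ m) (nhdsWithin 0 {0}ᶜ)
      (nhds (action3BF Q φ m)) := by
  let R : DForm (n + 4) M (n + 4) ℝ :=
    DForm.wedge Q.formG m.Bb (m.Bb.hodge g : DForm (n + 4) M 2 𝔤) +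
      DForm.wedge Q.formH m.Cb (m.Cb.hodge g : DForm (n + 4) M 3 𝔥) +
      DForm.wedge Q.formL m.Db (m.Db.hodge g : DForm (n + 4) M 4 𝔩)
  have hR : R.IsTest :=
    ((hm.1.wedge_left _ (hm.1.1.hodge hM hσ g _) _).add
      (hm.2.1.wedge_left _ (hm.2.1.1.hodge hM hσ g _) _)).add
      (hm.2.2.wedge_left _ (hm.2.2.1.hodge hM hσ g _) _)
  have hL : (lagrangian3BF Q φ m).IsTest :=
    ((hm.1.wedge_left _ (hφ.curvF D) _).add (hm.2.1.wedge_left _ (hφ.curvG D) _)).add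
      (hm.2.2.wedge_left _ (hφ.curvH D) _)
  -- Compact support of the multipliers makes the integral additive on the two parts, so the action
  -- is a quadratic polynomial in the coupling whose constant term is the 3BF action.
  have heq : (fun ε : ℝ => action3BFYM Q g ε φ m) =
      fun ε => action3BF Q φ m + ε ^ 2 * R.integral := by
    funext ε
    rw [action3BF, ← DForm.integral_smul, ← hL.integral_add (hR.smul _), action3BFYM]
    congr 1
    simp only [lagrangian3BFYM, lagrangian3BF, R]
    module
  rw [heq]
  have hcont : Continuous fun ε : ℝ => action3BF Q φ m + ε ^ 2 * R.integral := by fun_prop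
  have := hcont.tendsto 0
  rw [zero_pow two_ne_zero, zero_mul, add_zero] at this
  exact this.mono_left nhdsWithin_le_nhds

end SolvedMultipliers

end

/-! ### Equivalence of the 3BFYM and 3YM theories -/

theorem mainTheorem2 (n : ℕ) (M : Type*) [TopologicalSpace M] [ChartedSpace (Model (n + 4)) M]
    [IsManifold (𝓡 (n + 4)) ∞ M] [T2Space M] [SigmaCompactSpace M]
    (hM : IsOrientedAtlas (n + 4) M)
    (𝔤 𝔥 𝔩 : Type*) [NormedRealLieAlgebra 𝔤] [NormedRealLieAlgebra 𝔥] [NormedRealLieAlgebra 𝔩]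
    [FiniteDimensional ℝ 𝔤] [FiniteDimensional ℝ 𝔥] [FiniteDimensional ℝ 𝔩]
    (D : DifferentialTwoCrossedModule 𝔤 𝔥 𝔩) (hD : D.IsNice) (Q : InvariantForms D)
    (σ : ℝ) (hσ : σ = 1 ∨ σ = -1) (g : MetricTensor (n + 4) M σ) (e : ℝ) (he : e ≠ 0) :
    -- the equations of motion of the 3BFYM action
    (∀ (φ : GaugeField n M 𝔤 𝔥 𝔩) (m : Multipliers n M 𝔤 𝔥 𝔩), φ.IsSmooth → m.IsSmooth →
      (IsCritical3BFYM Q g e φ m ↔ MultiplierEquations g D e φ m ∧ GaugeEquations3BFYM Q φ m)) ∧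
    -- the first three determine the multipliers
    (∀ (φ : GaugeField n M 𝔤 𝔥 𝔩) (m : Multipliers n M 𝔤 𝔥 𝔩), φ.IsSmooth → m.IsSmooth →
      (MultiplierEquations g D e φ m ↔ m = solvedMultipliers g D e φ)) ∧
    -- substitution into the remaining equations and into the action
    (∀ φ : GaugeField n M 𝔤 𝔥 𝔩, φ.IsSmooth →
      (solvedMultipliers g D e φ).IsSmooth ∧
      (GaugeEquations3BFYM Q φ (solvedMultipliers g D e φ) ↔ Equations3YM Q g φ) ∧
      lagrangian3BFYM Q g e φ (solvedMultipliers g D e φ) = lagrangian3YM Q g e φ ∧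
      action3BFYM Q g e φ (solvedMultipliers g D e φ) = action3YM Q g e φ) ∧
    -- the 3YM equations are the equations of motion of the 3YM action
    (∀ φ : GaugeField n M 𝔤 𝔥 𝔩, φ.IsSmooth → (IsCritical3YM Q g e φ ↔ Equations3YM Q g φ)) ∧
    -- the solution spaces of the two theories correspond to each other
    Set.BijOn Prod.fst (solutions3BFYM Q g e) (solutions3YM Q g e) ∧
    Set.InvOn (fun φ => (φ, solvedMultipliers g D e φ)) Prod.fst
      (solutions3BFYM Q g e) (solutions3YM Q g e) ∧
    -- for vanishing coupling the 3BFYM action reduces to the 3BF action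
    (∀ (φ : GaugeField n M 𝔤 𝔥 𝔩) (m : Multipliers n M 𝔤 𝔥 𝔩), φ.IsSmooth → m.IsSmooth →
      m.IsCompactlySupported →
      Filter.Tendsto (fun ε : ℝ => action3BFYM Q g ε φ m) (nhdsWithin 0 {0}ᶜ)
        (nhds (action3BF Q φ m))) := by
  have hcrit := fun (φ : GaugeField n M 𝔤 𝔥 𝔩) (m : Multipliers n M 𝔤 𝔥 𝔩) (hφ : φ.IsSmooth)
    (hm : m.IsSmooth) => isCritical3BFYM_iff Q g hM hσ e hφ hm
  have hsolve := fun (φ : GaugeField n M 𝔤 𝔥 𝔩) (m : Multipliers n M 𝔤 𝔥 𝔩) =>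
    multiplierEquations_iff (D := D) g hσ he φ m
  have hsmooth := fun (φ : GaugeField n M 𝔤 𝔥 𝔩) (hφ : φ.IsSmooth) =>
    isSmooth_solvedMultipliers (D := D) g hM hσ e hφ
  have hgauge := gaugeEquations_solvedMultipliers_iff Q g hσ he
  have hYM := fun (φ : GaugeField n M 𝔤 𝔥 𝔩) (hφ : φ.IsSmooth) =>
    isCritical3YM_iff Q g hM hσ he hφ
  have hL := lagrangian3BFYM_solvedMultipliers Q g hσ he
  -- The second conjunct is what gives injectivity of the projection: on a solution the multipliers
  -- are a function of the gauge field.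
  have hmaps : ∀ p ∈ solutions3BFYM Q g e,
      p.1 ∈ solutions3YM Q g e ∧ p.2 = solvedMultipliers g D e p.1 := by
    rintro ⟨φ, m⟩ ⟨hφ, hm, hc⟩
    obtain ⟨h1, h2⟩ := (hcrit φ m hφ hm).1 hc
    have hmeq := (hsolve φ m).1 h1
    exact ⟨⟨hφ, (hYM φ hφ).2 ((hgauge φ).1 (hmeq ▸ h2))⟩, hmeq⟩
  have hinv : ∀ φ ∈ solutions3YM Q g e, (φ, solvedMultipliers g D e φ) ∈ solutions3BFYM Q g e := by
    rintro φ ⟨hφ, hc⟩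
    exact ⟨hφ, hsmooth φ hφ, (hcrit φ _ hφ (hsmooth φ hφ)).2
      ⟨(hsolve φ _).2 rfl, (hgauge φ).2 ((hYM φ hφ).1 hc)⟩⟩
  have hInvOn : Set.InvOn (fun φ => (φ, solvedMultipliers g D e φ)) Prod.fst
      (solutions3BFYM Q g e) (solutions3YM Q g e) :=
    ⟨fun p hp => Prod.ext rfl (hmaps p hp).2.symm, fun φ _ => rfl⟩
  exact ⟨hcrit, fun φ m _ _ => hsolve φ m,
    fun φ hφ => ⟨hsmooth φ hφ, hgauge φ, hL φ, congrArg DForm.integral (hL φ)⟩, hYM,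
    hInvOn.bijOn (fun p hp => (hmaps p hp).1) hinv, hInvOn,
    fun φ m hφ hm hmc => tendsto_action3BFYM Q g hM hσ hφ
      ⟨⟨hm.1, hmc.1⟩, ⟨hm.2.1, hmc.2.1⟩, ⟨hm.2.2, hmc.2.2⟩⟩⟩
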